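/- All vector spaces are over $\mathbb{C}$. A Lie conformal algebra is a $\mathbb{C}[\partial]$-module $A$ with a $\mathbb{C}$-linear $\lambda$-bracket $A\otimes A\to\mathbb{C}[\lambda]\otimes A$, $a\otimes b\mapsto[a_\lambda b]$, such that $[\partial a_\lambda b]=-\lambda[a_\lambda b]$, $[a_\lambda\partial b]=(\partial+\lambda)[a_\lambda b]$, $[a_\lambda b]=-[b_{-\lambda-\partial}a]$ and $[a_\lambda[b_\mu c]]=[[a_\lambda b]_{\lambda+\mu}c]+[b_\mu[a_\lambda c]]$. **Cochains.** For $\mathbb{C}[\partial]$-modules $A,M$ and $k\ge1$, $C^k(A,M)$ is the space of $\mathbb{C}$-linear maps $f:A^{\otimes k}\to\mathbb{C}[\lambda_1,\dots,\lambda_{k-1}]\otimes M$ with $f_{\lambda_1,\dots,\lambda_{k-1}}(a_1,\dots,\partial a_i,\dots,a_k)=-\lambda_i f_{\lambda_1,\dots,\lambda_{k-1}}(a_1,\dots,a_k)$ for $1\le i\le k$, where for $i=k$ one reads $\lambda_k$ as $\lambda_k^\dagger=-\sum_{j<k}\lambda_j-\partial$, and $f_{\lambda_1,\dots,\lambda_{k-1}}(a_1,\dots,a_k)=(-1)^\sigma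 f_{\lambda_{\sigma(1)},\dots,\lambda_{\sigma(k-1)}}(a_{\sigma(1)},\dots,a_{\sigma(k)})|_{\lambda_k\mapsto\lambda_k^\dagger}$ for all $\sigma\in S_k$ ($\partial$ acts from the left). Put $C^*(A,M)=\bigoplus_{k\ge1}C^k(A,M)$, with $C^k(A,M)$ in degree $k$. **Nijenhuis–Richardson bracket.** Let $S_{(i,N-i)}$ be the set of $\sigma\in S_N$ with $\sigma(1)<\dots<\sigma(i)$ and $\sigma(i+1)<\dots<\sigma(N)$. For $f\in C^m(A,A)$, $g\in C^n(A,A)$ let $[f,g]_{NR}=f\diamond g-(-1)^{(m-1)(n-1)}g\diamond f$, where $$(f\diamond g)_{\lambda_1,\dots,\lambda_{m+n-2}}(a_1,\dots,a_{m+n-1})=\sum_{\sigma\in S_{(n,m-1)}}(-1)^\sigma f_{\lambda_{\sigma(1)}+\dots+\lambda_{\sigma(n)},\lambda_{\sigma(n+1)},\dots,\lambda_{\sigma(m+n-2)}}\big(g_{\lambda_{\sigma(1)},\dots,\lambda_{\sigma(n-1)}}(a_{\sigma(1)},\dots,a_{\sigma(n)}),a_{\sigma(n+1)},\dots,a_{\sigma(m+n-1)}\big)\big|_{\lambda_{m+n-1}\mapsto\lambda^\dagger_{m+n-1}}.$$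 Here $f$ is extended $\mathbb{C}[\lambda]$-linearly in its first argument; as many $\lambda$'s are used as $f$ has (none if $m=1$). **Bidegree and lift.** A cochain $f\in C^{k+l+1}(A_1\oplus A_2,A_1\oplus A_2)$ has bidegree $k|l$ if, on arguments each of which lies in $A_1$ or in $A_2$, its values have coefficients in $A_1$ when $k+1$ arguments are in $A_1$ and $l$ in $A_2$, have coefficients in $A_2$ when $k$ are in $A_1$ and $l+1$ in $A_2$, and are $0$ otherwise. The lift of $f\in C^k(A_2,A_1)$ is the cochain $\hat f$ on $A_1\oplus A_2$ given by $\hat f((a_1,v_1),\dots,(a_k,v_k))=(f(v_1,\dots,v_k),0)$. **$L_\infty$-algebras.** An $L_\infty$-algebra is a graded vector space $\mathfrak{g}=\bigoplus_{i\in\mathbb{N}}\mathfrak{g}^i$ with multilinear maps $l_k:\mathfrak{g}^{\otimes k}\to\mathfrak{g}$, $k\ge1$, of degree $2-k$, such that for homogeneous $v_1,\dots,v_n$: $l_n(v_{\sigma(1)},\dots,v_{\sigma(n)})=\chi(\sigma)l_n(v_1,\dots,v_n)$ for $\sigma\in S_n$, $n\ge1$, where $\chi(\sigma)$ is the sign of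 $\sigma$ times the factor $(-1)^{|v||v'|}$ for every pair $v,v'$ whose order is reversed; and $$\sum_{i+j=n+1}(-1)^i\sum_{\sigma\in S_{(i,n-i)}}\chi(\sigma)\,l_j\big(l_i(v_{\sigma(1)},\dots,v_{\sigma(i)}),v_{\sigma(i+1)},\dots,v_{\sigma(n)}\big)=0\qquad(n\ge1,\ i,j\ge1).$$ **Theorem.** Let $A_1,A_2$ be $\mathbb{C}[\partial]$-modules and let $A=A_1\oplus A_2$ be a Lie conformal algebra that is quasi-twilled, that is, its structure $\Pi_\lambda(x,y)=[x_\lambda y]$ is a sum $\Pi=\hat\phi_1+\hat\mu_1+\hat\mu_2$ of $2$-cochains $\hat\phi_1,\hat\mu_1,\hat\mu_2$ of bidegrees $2|{-1}$, $1|0$, $0|1$ (equivalently, $A_2$ is a subalgebra of $A$). Then there are well-defined maps $d_{\hat\mu_2}:C^m(A_2,A_1)\to C^{m+1}(A_2,A_1)$, $[\cdot,\cdot]_{\hat\mu_1}:C^m(A_2,A_1)\times C^n(A_2,A_1)\to C^{m+n}(A_2,A_1)$ and $[\cdot,\cdot,\cdot]_{\hat\phi_1}:C^m(A_2,A_1)\times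 C^n(A_2,A_1)\times C^k(A_2,A_1)\to C^{m+n+k-1}(A_2,A_1)$ whose values have the lifts $$[\hat\mu_2,\hat f_1]_{NR},\qquad(-1)^{m-1}[[\hat\mu_1,\hat f_1]_{NR},\hat f_2]_{NR},\qquad(-1)^{n-1}[[[\hat\phi_1,\hat f_1]_{NR},\hat f_2]_{NR},\hat f_3]_{NR},$$ respectively, for $f_1\in C^m(A_2,A_1)$, $f_2\in C^n(A_2,A_1)$, $f_3\in C^k(A_2,A_1)$; these maps are uniquely determined; and $C^*(A_2,A_1)$ with $l_1=d_{\hat\mu_2}$, $l_2=[\cdot,\cdot]_{\hat\mu_1}$, $l_3=[\cdot,\cdot,\cdot]_{\hat\phi_1}$ and $l_k=0$ for $k\ge4$ is an $L_\infty$-algebra. -/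

import Mathlib

set_option maxSynthPendingDepth 3

open scoped TensorProduct

noncomputable section

namespace LieConformal

/-! ## `ℂ[∂]`-modules and polynomials in `λ₁, …, λₙ` with values in a module

A `ℂ[∂]`-module is a module over `Polynomial ℂ`, the variable acting as `∂`. -/

/-- `ℂ[λ₁, …, λₙ]`. -/
abbrev Lam (n : ℕ) : Type := MvPolynomial (Fin n) ℂ

/-- `ℂ[λ₁, …, λₙ] ⊗ M`. -/
abbrev Val (n : ℕ) (M : Type*) [AddCommGroup M] [Module ℂ M] : Type _ := Lam n ⊗[ℂ] M

/-- `ℂ[λ₁, …, λₙ][∂]`: the expressions in `λ₁, …, λₙ, ∂` that may be substituted for a `λ`. -/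
abbrev Expr (n : ℕ) : Type := Polynomial (Lam n)

/-- The variable `λᵢ` as an expression. -/
def lv {n : ℕ} (i : Fin n) : Expr n := Polynomial.C (MvPolynomial.X i)

/-- `∂` as an expression. -/
def dv {n : ℕ} : Expr n := Polynomial.X

/-- The list `λ₁, …, λₙ, λ†ₙ₊₁` with `λ†ₙ₊₁ = -(λ₁ + ⋯ + λₙ) - ∂`. -/
def lam (n : ℕ) : Fin (n + 1) → Expr n := Fin.snoc (fun i => lv i) (-(∑ i, lv i) - dv)

section
variable {A M : Type*} [AddCommGroup A] [Module ℂ A]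
  [AddCommGroup M] [Module ℂ M] [Module (Polynomial ℂ) M] [IsScalarTower ℂ (Polynomial ℂ) M]

/-- The action of `∂` on a `ℂ[∂]`-module. -/
def del (M : Type*) [AddCommGroup M] [Module ℂ M] [Module (Polynomial ℂ) M]
    [IsScalarTower ℂ (Polynomial ℂ) M] : M →ₗ[ℂ] M :=
  Algebra.lsmul ℂ ℂ M (Polynomial.X : Polynomial ℂ)

/-- The action of expressions in `λ₁, …, λₙ, ∂` on `ℂ[λ₁, …, λₙ] ⊗ M`: the `λᵢ` multiply the
polynomial factor, `∂` acts on `M`. -/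
def act {n : ℕ} : Expr n →ₐ[Lam n] Module.End (Lam n) (Val n M) :=
  Polynomial.aeval ((del M).baseChange (Lam n))

/-- The map `p(λ₁, …, λₖ) ⊗ x ↦ p(e₁, …, eₖ) · G(x)`: a linear map `G` is extended to an argument
from `ℂ[λ₁, …, λₖ] ⊗ A`, its variables are replaced by the expressions `e₁, …, eₖ`, and a `∂`
that occurs in them acts from the left on the result. -/
def extend {k n : ℕ} (e : Fin k → Expr n) (G : A →ₗ[ℂ] Val n M) : Val k A →ₗ[ℂ] Val n M :=
  TensorProduct.lift (LinearMap.mk₂ ℂ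
    (fun (p : Lam k) (x : A) => act (MvPolynomial.aeval e p) (G x))
    (fun p q x => by simp) (fun c p x => by
      rw [map_smul, ← IsScalarTower.algebraMap_smul (Lam n) c (MvPolynomial.aeval e p), map_smul,
        LinearMap.smul_apply, IsScalarTower.algebraMap_smul])
    (fun p x y => by simp) (fun c p x => by
      rw [map_smul, LinearMap.map_smul_of_tower]))

/-- The substitution `λᵢ ↦ eᵢ`, with `∂` acting from the left. -/
def subst {k n : ℕ} (e : Fin k → Expr n) : Val k M →ₗ[ℂ] Val n M :=
  extend e (TensorProduct.mk ℂ (Lam n) M 1)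

end

/-! ## Cochains -/

/-- `ℂ`-linear maps `A^{⊗(n+1)} → ℂ[λ₁, …, λₙ] ⊗ M`. -/
abbrev CMap (n : ℕ) (A M : Type*) [AddCommGroup A] [Module ℂ A] [AddCommGroup M] [Module ℂ M] :
    Type _ :=
  MultilinearMap ℂ (fun _ : Fin (n + 1) => A) (Val n M)

/-- The space `C^{n+1}(A, M)` of conformally sesquilinear, skew-symmetric maps. -/
def Cochain (n : ℕ) (A M : Type*)
    [AddCommGroup A] [Module ℂ A] [Module (Polynomial ℂ) A] [IsScalarTower ℂ (Polynomial ℂ) A]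
    [AddCommGroup M] [Module ℂ M] [Module (Polynomial ℂ) M] [IsScalarTower ℂ (Polynomial ℂ) M] :
    Submodule ℂ (CMap n A M) where
  carrier := {f |
    (∀ (i : Fin (n + 1)) (a : Fin (n + 1) → A),
      f (Function.update a i (del A (a i))) = -act (lam n i) (f a)) ∧
    (∀ (σ : Equiv.Perm (Fin (n + 1))) (a : Fin (n + 1) → A),
      f a = (Equiv.Perm.sign σ : ℤ) •
        subst (fun i : Fin n => lam n (σ i.castSucc)) (f (fun i => a (σ i))))}
  zero_mem' := by simp
  add_mem' := by
    rintro f g ⟨hf, hf'⟩ ⟨hg, hg'⟩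
    refine ⟨fun i a => ?_, fun σ a => ?_⟩
    · simp only [add_apply, hf, hg, map_add]; abel
    · rw [add_apply, add_apply, map_add, smul_add, ← hf', ← hg']
  smul_mem' := by
    rintro c f ⟨hf, hf'⟩
    refine ⟨fun i a => ?_, fun σ a => ?_⟩
    · simp only [smul_apply, hf, smul_neg, LinearMap.map_smul_of_tower]
    · rw [smul_apply, smul_apply, map_smul, smul_comm, ← hf']

/-- The cochain space `C^*(A, M) = ⨁_{k ≥ 1} C^k(A, M)`. -/
abbrev CochainSpace (A M : Type*)
    [AddCommGroup A] [Module ℂ A] [Module (Polynomial ℂ) A] [IsScalarTower ℂ (Polynomial ℂ) A]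
    [AddCommGroup M] [Module ℂ M] [Module (Polynomial ℂ) M] [IsScalarTower ℂ (Polynomial ℂ) M] :
    Type _ :=
  DirectSum ℕ (fun n => Cochain n A M)

/-- The inclusion of `C^{n+1}(A, M)` in `C^*(A, M)`. -/
def incl {A M : Type*}
    [AddCommGroup A] [Module ℂ A] [Module (Polynomial ℂ) A] [IsScalarTower ℂ (Polynomial ℂ) A]
    [AddCommGroup M] [Module ℂ M] [Module (Polynomial ℂ) M] [IsScalarTower ℂ (Polynomial ℂ) M]
    (n : ℕ) : Cochain n A M →ₗ[ℂ] CochainSpace A M :=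
  DirectSum.lof ℂ ℕ (fun n => Cochain n A M) n

/-- The grading of `C^*(A, M)`: `C^k(A, M)` has degree `k`, and there is nothing in degree `0`. -/
def cochainDeg (A M : Type*)
    [AddCommGroup A] [Module ℂ A] [Module (Polynomial ℂ) A] [IsScalarTower ℂ (Polynomial ℂ) A]
    [AddCommGroup M] [Module ℂ M] [Module (Polynomial ℂ) M] [IsScalarTower ℂ (Polynomial ℂ) M] :
    ℕ → Submodule ℂ (CochainSpace A M)
  | 0 => ⊥
  | n + 1 => LinearMap.range (incl n)

/-! ## The Nijenhuis–Richardson bracket -/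

/-- `σ` is an `(i, N-i)`-unshuffle: it is increasing on the first `i` places and on the others. -/
def IsUnshuffle {N : ℕ} (i : ℕ) (σ : Equiv.Perm (Fin N)) : Prop :=
  (∀ a b : Fin N, a < b → b.val < i → σ a < σ b) ∧
  (∀ a b : Fin N, a < b → i ≤ a.val → σ a < σ b)

instance {N : ℕ} (i : ℕ) (σ : Equiv.Perm (Fin N)) : Decidable (IsUnshuffle i σ) := by
  unfold IsUnshuffle; infer_instance

/-- The set `S_(i, N-i)` of unshuffles. -/
def unshuffles (N i : ℕ) : Finset (Equiv.Perm (Fin N)) :=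
  Finset.univ.filter (fun σ => IsUnshuffle i σ)

section
variable {A : Type*} [AddCommGroup A] [Module ℂ A]

/-- `x ↦ f(x, r₁, …, rₘ)`. -/
def firstArg {m : ℕ} (f : CMap m A A) (r : Fin m → A) : A →ₗ[ℂ] Val m A where
  toFun x := f (Fin.cons x r)
  map_add' x y := f.cons_add r x y
  map_smul' c x := f.cons_smul r c x

theorem firstArg_update_add {m : ℕ} (f : CMap m A A) (r : Fin m → A) (j : Fin m) (x y : A) :
    firstArg f (Function.update r j (x + y)) =
      firstArg f (Function.update r j x) + firstArg f (Function.update r j y) := by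
  ext z
  simp [firstArg, Fin.cons_update]

theorem firstArg_update_smul {m : ℕ} (f : CMap m A A) (r : Fin m → A) (j : Fin m) (c : ℂ) (x : A) :
    firstArg f (Function.update r j (c • x)) = c • firstArg f (Function.update r j x) := by
  ext z
  simp [firstArg, Fin.cons_update]

end

/-- The `i`-th of the first `n + 1` places among `m + n + 1`. -/
def headIx {m n p : ℕ} (h : m + n = p) (i : Fin (n + 1)) : Fin (p + 1) := ⟨i.val, by omega⟩

/-- The `j`-th of the last `m` places among `m + n + 1`. -/
def tailIx {m n p : ℕ} (h : m + n = p) (j : Fin m) : Fin (p + 1) := ⟨n + 1 + j.val, by omega⟩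

/-- A place is one of the first `n + 1` or one of the last `m`. -/
theorem place_cases {m n p : ℕ} (h : m + n = p) (j : Fin (p + 1)) :
    (∃ i, j = headIx h i) ∨ ∃ i, j = tailIx h i := by
  by_cases hj : j.val < n + 1
  · exact Or.inl ⟨⟨j.val, hj⟩, rfl⟩
  · refine Or.inr ⟨⟨j.val - (n + 1), by omega⟩, Fin.ext ?_⟩
    simp only [tailIx]; omega

theorem update_head {m n p : ℕ} (h : m + n = p) (σ : Equiv.Perm (Fin (p + 1)))
    {A : Type*} (a : Fin (p + 1) → A) (i : Fin (n + 1)) (x : A) :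
    (fun k => Function.update a (σ (headIx h i)) x (σ (headIx h k))) =
        Function.update (fun k => a (σ (headIx h k))) i x ∧
      (fun k => Function.update a (σ (headIx h i)) x (σ (tailIx h k))) =
        fun k => a (σ (tailIx h k)) := by
  refine ⟨Function.update_comp_eq_of_injective' a
    (fun u v huv => Fin.ext (by simpa [headIx] using σ.injective huv)) i x, funext fun k => ?_⟩
  refine Function.update_of_ne (fun hk => ?_) x a
  have := congrArg Fin.val (σ.injective hk)
  simp only [tailIx, headIx] at this
  omega

theorem update_tail {m n p : ℕ} (h : m + n = p) (σ : Equiv.Perm (Fin (p + 1)))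
    {A : Type*} (a : Fin (p + 1) → A) (i : Fin m) (x : A) :
    (fun k => Function.update a (σ (tailIx h i)) x (σ (headIx h k))) =
        (fun k => a (σ (headIx h k))) ∧
      (fun k => Function.update a (σ (tailIx h i)) x (σ (tailIx h k))) =
        Function.update (fun k => a (σ (tailIx h k))) i x := by
  refine ⟨funext fun k => ?_, Function.update_comp_eq_of_injective' a
    (fun u v huv => Fin.ext (by simpa [tailIx] using σ.injective huv)) i x⟩
  refine Function.update_of_ne (fun hk => ?_) x a
  have := congrArg Fin.val (σ.injective hk)
  simp only [tailIx, headIx] at this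
  omega

theorem extend_add_right {B M : Type*} [AddCommGroup B] [Module ℂ B]
    [AddCommGroup M] [Module ℂ M] [Module (Polynomial ℂ) M] [IsScalarTower ℂ (Polynomial ℂ) M]
    {k n : ℕ} (e : Fin k → Expr n) (G H : B →ₗ[ℂ] Val n M) :
    extend e (G + H) = extend e G + extend e H :=
  TensorProduct.ext' fun p x => by simp [extend]

theorem extend_smul_right {B M : Type*} [AddCommGroup B] [Module ℂ B]
    [AddCommGroup M] [Module ℂ M] [Module (Polynomial ℂ) M] [IsScalarTower ℂ (Polynomial ℂ) M]
    {k n : ℕ} (e : Fin k → Expr n) (c : ℂ) (G : B →ₗ[ℂ] Val n M) :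
    extend e (c • G) = c • extend e G :=
  TensorProduct.ext' fun p x => by simp [extend, LinearMap.map_smul_of_tower]

section NR
variable {A : Type*} [AddCommGroup A] [Module ℂ A] [Module (Polynomial ℂ) A]
  [IsScalarTower ℂ (Polynomial ℂ) A]

/-- The summand of `f ⋄ g` that belongs to `σ`, without its sign: `g`, with variables
`λ_σ(1), …, λ_σ(n)` and arguments `a_σ(1), …, a_σ(n+1)`, is the first argument of `f`, whose
variables are `λ_σ(1) + ⋯ + λ_σ(n+1), λ_σ(n+2), …` (as many as `f` has) and whose other arguments
are `a_σ(n+2), …, a_σ(m+n+1)`; the last of the `m + n + 1` variables is replaced by `λ†`. -/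
def circTerm {m n p : ℕ} (h : m + n = p) (f : CMap m A A) (g : CMap n A A)
    (σ : Equiv.Perm (Fin (p + 1))) (a : Fin (p + 1) → A) : Val p A :=
  let vars : Fin (m + 1) → Expr p :=
    Fin.cons (∑ i : Fin (n + 1), lam p (σ (headIx h i))) (fun j => lam p (σ (tailIx h j)))
  extend (fun i : Fin n => lam p (σ (headIx h i.castSucc)))
    (subst (fun j : Fin m => vars j.castSucc) ∘ₗ firstArg f (fun j => a (σ (tailIx h j))))
    (g (fun i => a (σ (headIx h i))))

theorem circTerm_update_add {m n p : ℕ} (h : m + n = p) (f : CMap m A A) (g : CMap n A A)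
    (σ : Equiv.Perm (Fin (p + 1))) (a : Fin (p + 1) → A) (j : Fin (p + 1)) (x y : A) :
    circTerm h f g σ (Function.update a j (x + y)) =
      circTerm h f g σ (Function.update a j x) + circTerm h f g σ (Function.update a j y) := by
  obtain ⟨l, rfl⟩ := σ.surjective j
  obtain ⟨i, rfl⟩ | ⟨i, rfl⟩ := place_cases h l
  · simp only [circTerm, update_head, MultilinearMap.map_update_add, map_add]
  · simp only [circTerm, update_tail, firstArg_update_add, LinearMap.comp_add, extend_add_right,
      LinearMap.add_apply]

theorem circTerm_update_smul {m n p : ℕ} (h : m + n = p) (f : CMap m A A) (g : CMap n A A)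
    (σ : Equiv.Perm (Fin (p + 1))) (a : Fin (p + 1) → A) (j : Fin (p + 1)) (c : ℂ) (x : A) :
    circTerm h f g σ (Function.update a j (c • x)) =
      c • circTerm h f g σ (Function.update a j x) := by
  obtain ⟨l, rfl⟩ := σ.surjective j
  obtain ⟨i, rfl⟩ | ⟨i, rfl⟩ := place_cases h l
  · simp only [circTerm, update_head, MultilinearMap.map_update_smul, map_smul]
  · simp only [circTerm, update_tail, firstArg_update_smul, LinearMap.comp_smul,
      extend_smul_right, LinearMap.smul_apply]

/-- `f ⋄ g`, for `f` with `m + 1` and `g` with `n + 1` arguments. -/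
def circ {m n p : ℕ} (h : m + n = p) (f : CMap m A A) (g : CMap n A A) : CMap p A A where
  toFun a := ∑ σ ∈ unshuffles (p + 1) (n + 1), (Equiv.Perm.sign σ : ℤ) • circTerm h f g σ a
  map_update_add' {inst} a j x y := by
    obtain rfl : inst = instDecidableEqFin _ := Subsingleton.elim _ _
    simp only [circTerm_update_add, smul_add, Finset.sum_add_distrib]
  map_update_smul' {inst} a j c x := by
    obtain rfl : inst = instDecidableEqFin _ := Subsingleton.elim _ _
    simp only [circTerm_update_smul, Finset.smul_sum, smul_comm c]

/-- The Nijenhuis–Richardson bracket `[f, g] = f ⋄ g - (-1)^{mn} g ⋄ f` of `f` with `m + 1` and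
`g` with `n + 1` arguments. -/
def nr {m n : ℕ} (f : CMap m A A) (g : CMap n A A) : CMap (m + n) A A :=
  circ rfl f g - (-1 : ℤ) ^ (m * n) • circ (Nat.add_comm n m) g f

end NR

/-! ## Lie conformal algebras -/

/-- A Lie conformal algebra structure on the `ℂ[∂]`-module `A`. In the Jacobi identity
`λ` and `μ` are the variables `lv 0` and `lv 1`. -/
structure LieConformalAlgebra (A : Type*) [AddCommGroup A] [Module ℂ A] [Module (Polynomial ℂ) A]
    [IsScalarTower ℂ (Polynomial ℂ) A] where
  /-- The `λ`-bracket `[a_λ b]`. -/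
  bracket : A →ₗ[ℂ] A →ₗ[ℂ] Val 1 A
  sesq_left : ∀ a b, bracket (del A a) b = -act (lv 0) (bracket a b)
  sesq_right : ∀ a b, bracket a (del A b) = act (dv + lv 0) (bracket a b)
  skew : ∀ a b, bracket a b = -subst (fun _ => -lv 0 - dv) (bracket b a)
  jacobi : ∀ a b c,
    extend (n := 2) (fun _ => lv 1) (subst (fun _ => lv 0) ∘ₗ bracket a) (bracket b c) =
      extend (fun _ => lv 0) (subst (fun _ => lv 0 + lv 1) ∘ₗ bracket.flip c) (bracket a b) +
      extend (fun _ => lv 0) (subst (fun _ => lv 1) ∘ₗ bracket b) (bracket a c)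

theorem subst_lv {M : Type*} [AddCommGroup M] [Module ℂ M] [Module (Polynomial ℂ) M]
    [IsScalarTower ℂ (Polynomial ℂ) M] {n : ℕ} (y : Val n M) :
    subst (fun i : Fin n => lv i) y = y := by
  have key : ∀ p : Lam n, MvPolynomial.aeval (fun i : Fin n => lv i) p = algebraMap _ (Expr n) p := by
    intro p
    induction p using MvPolynomial.induction_on with
    | C c => rw [MvPolynomial.aeval_C]; rfl
    | add p q hp hq => rw [map_add, map_add, hp, hq]
    | mul_X p i hp => rw [map_mul, map_mul, hp, MvPolynomial.aeval_X]; rfl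
  have : subst (fun i : Fin n => lv i) = (LinearMap.id : Val n M →ₗ[ℂ] Val n M) := by
    refine TensorProduct.ext' fun p x => ?_
    rw [subst, extend, TensorProduct.lift.tmul, LinearMap.mk₂_apply, key, AlgHom.commutes,
      TensorProduct.mk_apply, Module.algebraMap_end_apply, TensorProduct.smul_tmul', smul_eq_mul,
      mul_one, LinearMap.id_apply]
  rw [this, LinearMap.id_apply]

/-- The structure `Π_λ(a, b) = [a_λ b]` of a Lie conformal algebra, as a `2`-cochain. -/
def LieConformalAlgebra.toCochain {A : Type*} [AddCommGroup A] [Module ℂ A]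
    [Module (Polynomial ℂ) A] [IsScalarTower ℂ (Polynomial ℂ) A] (L : LieConformalAlgebra A) :
    Cochain 1 A A where
  val := 
    { toFun := fun a => L.bracket (a 0) (a 1)
      map_update_add' := by
        intro inst a j x y
        obtain rfl : inst = instDecidableEqFin _ := Subsingleton.elim _ _
        fin_cases j <;> simp [Function.update]
      map_update_smul' := by
        intro inst a j c x
        obtain rfl : inst = instDecidableEqFin _ := Subsingleton.elim _ _
        fin_cases j <;> simp [Function.update] }
  property := by
    have h0 : lam 1 0 = lv 0 := Fin.snoc_castSucc (α := fun _ => Expr 1) _ _ 0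
    have h1 : lam 1 1 = -lv 0 - dv := by
      rw [show (1 : Fin 2) = Fin.last 1 from rfl, lam, Fin.snoc_last, Fin.sum_univ_one]
    refine ⟨fun i a => ?_, fun σ a => ?_⟩
    · fin_cases i
      · simpa [h0] using L.sesq_left (a 0) (a 1)
      · have := L.sesq_right (a 0) (a 1)
        have e : (dv + lv 0 : Expr 1) = -(-lv 0 - dv) := by ring
        rw [e, map_neg, LinearMap.neg_apply] at this
        simpa [h1] using this
    · have hσ : σ = 1 ∨ σ = Equiv.swap 0 1 := by decide +revert
      obtain rfl | rfl := hσ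
      · have e : (fun i : Fin 1 => lam 1 ((1 : Equiv.Perm (Fin 2)) i.castSucc)) = fun i => lv i :=
          funext fun i => Fin.snoc_castSucc (α := fun _ => Expr 1) _ _ i
        rw [e, subst_lv]
        simp
      · have e : (fun i : Fin 1 => lam 1 (Equiv.swap 0 1 i.castSucc)) = fun _ => -lv 0 - dv := by
          funext i
          fin_cases i
          exact h1
        rw [e]
        simpa using L.skew (a 0) (a 1)

/-! ## Bidegrees, lifts and quasi-twilled Lie conformal algebras -/

section Twilled
variable {A₁ A₂ : Type*}
  [AddCommGroup A₁] [Module ℂ A₁] [Module (Polynomial ℂ) A₁] [IsScalarTower ℂ (Polynomial ℂ) A₁]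
  [AddCommGroup A₂] [Module ℂ A₂] [Module (Polynomial ℂ) A₂] [IsScalarTower ℂ (Polynomial ℂ) A₂]

/-- `f` has bidegree `k|l`, where `k + l + 1` is the number of its arguments. Here `S` is the set
of places whose arguments lie in `A₁`, the arguments in the other places lying in `A₂`: the value
is in `A₁` if there are `k + 1` of the former, in `A₂` if there are `k`, and otherwise `0`. -/
def HasBidegree {n : ℕ} (k l : ℤ) (f : CMap n (A₁ × A₂) (A₁ × A₂)) : Prop :=
  k + l = n ∧ ∀ (S : Finset (Fin (n + 1))) (x : Fin (n + 1) → A₁ × A₂),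
    (∀ i ∈ S, (x i).2 = 0) → (∀ i ∉ S, (x i).1 = 0) →
      ((S.card : ℤ) = k + 1 → (LinearMap.snd ℂ A₁ A₂).lTensor (Lam n) (f x) = 0) ∧
      ((S.card : ℤ) = k → (LinearMap.fst ℂ A₁ A₂).lTensor (Lam n) (f x) = 0) ∧
      ((S.card : ℤ) ≠ k + 1 → (S.card : ℤ) ≠ k → f x = 0)

/-- The lift `f̂((a₁, v₁), …) = (f(v₁, …), 0)` of a map `A₂^{⊗(n+1)} → ℂ[λ₁, …, λₙ] ⊗ A₁`. -/
def lift {n : ℕ} (f : CMap n A₂ A₁) : CMap n (A₁ × A₂) (A₁ × A₂) :=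
  ((LinearMap.inl ℂ A₁ A₂).lTensor (Lam n)).compMultilinearMap
    (f.compLinearMap (fun _ => LinearMap.snd ℂ A₁ A₂))

/-- `(A₁ ⊕ A₂, A₁, A₂)` is quasi-twilled with structure `Π = φ̂₁ + μ̂₁ + μ̂₂`: the components of `Π`
of bidegrees `2|-1`, `1|0`, `0|1` are `φ₁`, `μ₁`, `μ₂`, and the one of bidegree `-1|2` vanishes. -/
structure IsQuasiTwilled (L : LieConformalAlgebra (A₁ × A₂))
    (φ₁ μ₁ μ₂ : Cochain 1 (A₁ × A₂) (A₁ × A₂)) : Prop where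
  bidegree_φ₁ : HasBidegree 2 (-1) φ₁.1
  bidegree_μ₁ : HasBidegree 1 0 μ₁.1
  bidegree_μ₂ : HasBidegree 0 1 μ₂.1
  structure_eq : L.toCochain = φ₁ + μ₁ + μ₂

end Twilled

/-! ## `L_∞`-algebras -/

/-- The sign `χ(σ)` with `v₁ ∧ ⋯ ∧ v_N = χ(σ) v_σ(1) ∧ ⋯ ∧ v_σ(N)` for `vⱼ` of degree `d j`: the
sign of `σ` times `(-1)^{d d'}` for each pair of elements whose order is reversed. -/
def koszul {N : ℕ} (d : Fin N → ℕ) (σ : Equiv.Perm (Fin N)) : ℤ :=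
  (Equiv.Perm.sign σ : ℤ) *
    ∏ i : Fin N, ∏ j : Fin N, if i < j ∧ σ j < σ i then (-1) ^ (d (σ i) * d (σ j)) else 1

/-- `V = ⨁_{i ∈ ℕ} G i` with the brackets `l k`, `k ≥ 1`, is an `L_∞`-algebra (`l 0` is not part of
the structure and is set to `0`). In the higher Jacobi identity the inner bracket has `i + 1` and
the outer one `(N - 1 - i) + 1` arguments, which add up to `N + 1`. -/
structure IsLInftyAlgebra {V : Type*} [AddCommGroup V] [Module ℂ V] (G : ℕ → Submodule ℂ V)
    (l : ∀ k : ℕ, MultilinearMap ℂ (fun _ : Fin k => V) V) : Prop where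
  isInternal : DirectSum.IsInternal G
  zero : l 0 = 0
  degree : ∀ (k : ℕ), 1 ≤ k → ∀ (d : Fin k → ℕ) (v : Fin k → V), (∀ j, v j ∈ G (d j)) →
    (∃ e : ℕ, (e : ℤ) = ∑ j, (d j : ℤ) + 2 - k ∧ l k v ∈ G e) ∨ l k v = 0
  skew : ∀ (k : ℕ), 1 ≤ k → ∀ (d : Fin k → ℕ) (v : Fin k → V), (∀ j, v j ∈ G (d j)) →
    ∀ σ : Equiv.Perm (Fin k), l k (fun j => v (σ j)) = koszul d σ • l k v
  jacobi : ∀ (N : ℕ), 1 ≤ N → ∀ (d : Fin N → ℕ) (v : Fin N → V), (∀ j, v j ∈ G (d j)) →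
    ∑ i : Fin N, (-1 : ℤ) ^ (i.val + 1) • ∑ σ ∈ unshuffles N (i.val + 1), koszul d σ •
      l (N - 1 - i.val + 1)
        (Fin.cons (l (i.val + 1) (fun a => v (σ ⟨a.val, by omega⟩)))
          (fun b : Fin (N - 1 - i.val) => v (σ ⟨i.val + 1 + b.val, by omega⟩))) = 0

end LieConformal

end

open LieConformal

set_option linter.unusedSectionVars false

noncomputable section

namespace LieConformal

/-! ### Substitution of expressions in λ₁, …, λₙ, ∂ -/

section Calculus
variable {A B M M' : Type*} [AddCommGroup A] [Module ℂ A] [Module (Polynomial ℂ) A]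
  [IsScalarTower ℂ (Polynomial ℂ) A]
  [AddCommGroup B] [Module ℂ B]
  [AddCommGroup M] [Module ℂ M] [Module (Polynomial ℂ) M] [IsScalarTower ℂ (Polynomial ℂ) M]
  [AddCommGroup M'] [Module ℂ M'] [Module (Polynomial ℂ) M'] [IsScalarTower ℂ (Polynomial ℂ) M']

/-! The brackets are Voronov's derived brackets. Put C^{n+1}(A, A) in degree n; the
Nijenhuis–Richardson bracket makes 𝔤 = C^*(A, A) a graded Lie algebra. The lifts form an abelian
subalgebra, since a lift has values in A₁ and vanishes as soon as one argument lies in A₁.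
Restricting a cochain to A₂, projecting its values to A₁ and lifting back is a projection P of 𝔤
onto this subalgebra. Its kernel consists of the cochains that send arguments in A₂ to values in A₂,
and so it is a subalgebra too. The structure Π has degree 1, [Π, Π] = 0 is the Jacobi identity of A,
and P Π = 0 says that A₂ is a subalgebra. In this situation the expressions P[…[Π, f₁], …, fₖ], with
suitable signs, are the brackets of an L∞-algebra on the lifts, with degrees shifted by one.

That 𝔤 is a graded Lie algebra rests on the pre-Lie identity of ⋄. Up to factorials, f ⋄ g is the
skew-symmetrization of the insertion of g in the first argument of f, because unshuffles represent
the cosets of the permutations preserving the two blocks (`factorial_smul_circ`). In (f ⋄ g) ⋄ h the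
cochain h enters an argument of g or a further argument of f (`circ_circ_left`). The terms of the
first kind make up f ⋄ (g ⋄ h), and those of the second kind are symmetric in g and h up to sign
(`twoIns_symm`). This is `circ_preLie`, and it implies the Jacobi identity `nrL_jacobi`.

For the higher Jacobi identity let T_a y = (-1)^{|y|}[y, a]. On 𝔤 these operators are derivations up
to sign, and for lifts a they commute up to sign. Applying all of them, and then P, to [Π, Π] = 0
gives a sum over subsets S that record which operators act on the second factor (`W_br`). The
identity `P_br_eq` splits it into two equal halves, each a sum of nested derived brackets
(`sum_jacobiSign`). Subsets correspond to unshuffles, and the signs agree by `koszul_unshuffle`.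

Bidegrees are handled by one operator: let E be the projection to A₁, regarded as a 1-cochain. A
cochain of bidegree k|l is an eigenvector of [·, E] with eigenvalue k (`HasBidegree.nrC_euler`).
Eigenvalues add under the bracket, lifts have eigenvalue -1, and P annihilates every other
eigenvalue and is the identity on that one. As φ₁, μ₁, μ₂ have eigenvalues 2, 1, 0, they contribute
to l₃, l₂, l₁ respectively and to nothing else. In particular lₖ = 0 for k ≥ 4. -/

theorem act_C_tmul {n : ℕ} (q p : Lam n) (b : M) :
    act (Polynomial.C q) (p ⊗ₜ[ℂ] b) = (q * p) ⊗ₜ[ℂ] b := by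
  rw [act, Polynomial.aeval_C, Module.algebraMap_end_apply, TensorProduct.smul_tmul', smul_eq_mul]

theorem act_dv_tmul {n : ℕ} (p : Lam n) (b : M) :
    act dv (p ⊗ₜ[ℂ] b) = p ⊗ₜ[ℂ] del M b := by
  rw [act, dv, Polynomial.aeval_X, LinearMap.baseChange_tmul]

theorem act_mul {n : ℕ} (D E : Expr n) (v : Val n M) : act (D * E) v = act D (act E v) := by
  rw [map_mul]; rfl

theorem act_comm {n : ℕ} (D E : Expr n) (v : Val n M) : act D (act E v) = act E (act D v) := by
  rw [← act_mul, mul_comm, act_mul]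

theorem act_smul {n : ℕ} (D : Expr n) (c : ℂ) (v : Val n M) : act D (c • v) = c • act D v :=
  LinearMap.map_smul_of_tower (act D) c v

/-- The action of an expression as a `ℂ`-linear map. -/
def actL {n : ℕ} (D : Expr n) : Val n M →ₗ[ℂ] Val n M where
  toFun v := act D v
  map_add' := map_add _
  map_smul' c v := act_smul D c v

@[simp]
theorem actL_apply {n : ℕ} (D : Expr n) (v : Val n M) : actL D v = act D v := rfl

/-- The substitution `λᵢ ↦ xᵢ`, `∂ ↦ κ` in expressions. -/
def ev {k n : ℕ} (x : Fin k → Expr n) (κ : Expr n) : Expr k →+* Expr n :=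
  Polynomial.eval₂RingHom (MvPolynomial.aeval x : Lam k →ₐ[ℂ] Expr n).toRingHom κ

theorem ev_C {k n : ℕ} (x : Fin k → Expr n) (κ : Expr n) (q : Lam k) :
    ev x κ (Polynomial.C q) = MvPolynomial.aeval x q := by
  simp [ev]

theorem ev_lv {k n : ℕ} (x : Fin k → Expr n) (κ : Expr n) (i : Fin k) : ev x κ (lv i) = x i := by
  simp [lv, ev_C]

theorem ev_dv {k n : ℕ} (x : Fin k → Expr n) (κ : Expr n) : ev x κ dv = κ := by
  simp [dv, ev]

theorem ev_aeval {j k n : ℕ} (x : Fin k → Expr n) (κ : Expr n) (y : Fin j → Expr k) (q : Lam j) :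
    ev x κ (MvPolynomial.aeval y q) = MvPolynomial.aeval (fun i => ev x κ (y i)) q := by
  induction q using MvPolynomial.induction_on with
  | C c =>
    rw [MvPolynomial.aeval_C, MvPolynomial.aeval_C]
    have : algebraMap ℂ (Expr k) c = Polynomial.C (MvPolynomial.C c) := rfl
    rw [this, ev_C, MvPolynomial.aeval_C]
  | add p q hp hq => simp [hp, hq]
  | mul_X p i hp => simp [hp]

theorem lam_castSucc {n : ℕ} (i : Fin n) : lam n i.castSucc = lv i :=
  Fin.snoc_castSucc (α := fun _ => Expr n) _ _ i

theorem lam_last {n : ℕ} : lam n (Fin.last n) = -(∑ i, lv i) - dv :=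
  Fin.snoc_last (α := fun _ => Expr n) _ _

theorem sum_lam (n : ℕ) : ∑ i, lam n i = -dv := by
  simp only [Fin.sum_univ_castSucc, lam_castSucc, lam_last]; ring

/-- λ† is minus the other variables minus ∂, so it is sent to the last of the x's exactly because
these add up to -κ. This settles every substitution for λ†; later statements only have to carry the
condition on the sum. -/
theorem ev_lam {n p : ℕ} (x : Fin (n + 1) → Expr p) (κ : Expr p) (hx : ∑ i, x i = -κ)
    (i : Fin (n + 1)) : ev (fun i : Fin n => x i.castSucc) κ (lam n i) = x i := by
  refine Fin.lastCases ?_ (fun i => ?_) i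
  · rw [lam_last, map_sub, map_neg, map_sum, ev_dv]
    simp only [ev_lv]
    rw [Fin.sum_univ_castSucc] at hx
    linear_combination -hx
  · rw [lam_castSucc, ev_lv]

/-- `G` intertwines `∂` with the expression `κ`. -/
def IsConf {p : ℕ} (κ : Expr p) (G : A →ₗ[ℂ] Val p M) : Prop := ∀ b, G (del A b) = act κ (G b)

theorem extend_tmul {k n : ℕ} (e : Fin k → Expr n) (G : B →ₗ[ℂ] Val n M) (q : Lam k) (b : B) :
    extend e G (q ⊗ₜ[ℂ] b) = act (MvPolynomial.aeval e q) (G b) := rfl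

/-- Since G turns ∂ into κ, an expression acting on the argument can be moved outside, with its
variables and its ∂ substituted. -/
theorem extend_act {k n : ℕ} (x : Fin k → Expr n) {κ : Expr n} {G : A →ₗ[ℂ] Val n M}
    (hG : IsConf κ G) (E : Expr k) (v : Val k A) :
    extend x G (act E v) = act (ev x κ E) (extend x G v) := by
  have hC : ∀ (q : Lam k) (v : Val k A),
      extend x G (act (Polynomial.C q) v) = act (ev x κ (Polynomial.C q)) (extend x G v) := by
    intro q v
    induction v using TensorProduct.induction_on with
    | zero => simp
    | add u v hu hv => simp only [map_add, hu, hv]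
    | tmul r b => rw [act_C_tmul, extend_tmul, extend_tmul, map_mul, act_mul, ev_C]
  have hX : ∀ v : Val k A, extend x G (act dv v) = act κ (extend x G v) := by
    intro v
    induction v using TensorProduct.induction_on with
    | zero => simp
    | add u v hu hv => simp only [map_add, hu, hv]
    | tmul r b => rw [act_dv_tmul, extend_tmul, extend_tmul, hG, act_comm]
  induction E using Polynomial.induction_on generalizing v with
  | C q => exact hC q v
  | add D E hD hE => simp only [map_add, LinearMap.add_apply, hD, hE]
  | monomial n q h =>
    rw [pow_succ, ← mul_assoc, act_mul, h]
    change act _ (extend x G (act dv v)) = act (ev x κ (_ * dv)) _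
    rw [hX, map_mul _ _ dv, ev_dv, ← act_mul]

theorem extend_extend {j k n : ℕ} (x : Fin k → Expr n) {κ : Expr n} {G : A →ₗ[ℂ] Val n M}
    (hG : IsConf κ G) (y : Fin j → Expr k) (H : B →ₗ[ℂ] Val k A) (v : Val j B) :
    extend x G (extend y H v) = extend (fun i => ev x κ (y i)) (extend x G ∘ₗ H) v := by
  induction v using TensorProduct.induction_on with
  | zero => simp
  | add u v hu hv => simp only [map_add, hu, hv]
  | tmul q b =>
    rw [extend_tmul, extend_tmul, extend_act x hG, ev_aeval]; rfl

/-- The inclusion of the constants. -/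
def cst (p : ℕ) (M : Type*) [AddCommGroup M] [Module ℂ M] : M →ₗ[ℂ] Val p M :=
  TensorProduct.mk ℂ (Lam p) M 1

theorem isConf_cst (p : ℕ) : IsConf dv (cst p A) := fun b => by
  simp [cst, act_dv_tmul]

theorem extend_cst {k n : ℕ} (x : Fin k → Expr n) (G : B →ₗ[ℂ] Val n M) :
    extend x G ∘ₗ cst k B = G := by
  ext b
  simp [cst, extend_tmul]

theorem extend_subst {j k n : ℕ} (x : Fin k → Expr n) {κ : Expr n} {G : A →ₗ[ℂ] Val n M}
    (hG : IsConf κ G) (y : Fin j → Expr k) (v : Val j A) :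
    extend x G (subst y v) = extend (fun i => ev x κ (y i)) G v := by
  rw [subst, extend_extend x hG, ← cst, extend_cst]

theorem extend_actL {k n : ℕ} (x : Fin k → Expr n) (D : Expr n) (G : B →ₗ[ℂ] Val n M)
    (v : Val k B) : extend x (actL D ∘ₗ G) v = act D (extend x G v) := by
  induction v using TensorProduct.induction_on with
  | zero => simp
  | add u v hu hv => simp only [map_add, hu, hv]
  | tmul q b => rw [extend_tmul, extend_tmul, act_comm]; rfl

theorem extend_neg_right {k n : ℕ} (x : Fin k → Expr n) (G : B →ₗ[ℂ] Val n M) :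
    extend x (-G) = -extend x G := by
  have := extend_smul_right x (-1 : ℂ) G
  simpa using this

theorem extend_comp_lTensor {A' : Type*} [AddCommGroup A'] [Module ℂ A'] {k n : ℕ}
    (x : Fin k → Expr n) (G : B →ₗ[ℂ] Val n M) (β : A' →ₗ[ℂ] B) (v : Val k A') :
    extend x G (β.lTensor (Lam k) v) = extend x (G ∘ₗ β) v := by
  induction v using TensorProduct.induction_on with
  | zero => simp
  | add u v hu hv => simp only [map_add, hu, hv]
  | tmul q b => rw [LinearMap.lTensor_tmul, extend_tmul, extend_tmul]; rfl

theorem act_lTensor {n : ℕ} (α : M →ₗ[ℂ] M') (hα : ∀ b, α (del M b) = del M' (α b))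
    (D : Expr n) (v : Val n M) :
    α.lTensor (Lam n) (act D v) = act D (α.lTensor (Lam n) v) := by
  have hC : ∀ (q : Lam n) (v : Val n M), α.lTensor (Lam n) (act (Polynomial.C q) v) =
      act (Polynomial.C q) (α.lTensor (Lam n) v) := by
    intro q v
    induction v using TensorProduct.induction_on with
    | zero => simp
    | add u v hu hv => simp only [map_add, hu, hv]
    | tmul r b => rw [act_C_tmul, LinearMap.lTensor_tmul, LinearMap.lTensor_tmul, act_C_tmul]
  have hX : ∀ v : Val n M, α.lTensor (Lam n) (act dv v) = act dv (α.lTensor (Lam n) v) := by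
    intro v
    induction v using TensorProduct.induction_on with
    | zero => simp
    | add u v hu hv => simp only [map_add, hu, hv]
    | tmul r b => rw [act_dv_tmul, LinearMap.lTensor_tmul, LinearMap.lTensor_tmul, act_dv_tmul, hα]
  induction D using Polynomial.induction_on generalizing v with
  | C q => exact hC q v
  | add D E hD hE => simp only [map_add, LinearMap.add_apply, hD, hE]
  | monomial n q h =>
    rw [pow_succ, ← mul_assoc, act_mul, h]
    change act _ (α.lTensor (Lam _) (act dv v)) = act (_ * dv) _
    rw [hX, ← act_mul]

theorem lTensor_extend {k n : ℕ} (α : M →ₗ[ℂ] M') (hα : ∀ b, α (del M b) = del M' (α b))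
    (x : Fin k → Expr n) (G : B →ₗ[ℂ] Val n M) (v : Val k B) :
    α.lTensor (Lam n) (extend x G v) = extend x (α.lTensor (Lam n) ∘ₗ G) v := by
  induction v using TensorProduct.induction_on with
  | zero => simp
  | add u v hu hv => simp only [map_add, hu, hv]
  | tmul q b => rw [extend_tmul, extend_tmul, act_lTensor α hα]; rfl

/-- The polynomial factors of v and w act on the result by commuting operators, so the two arguments
of a bilinear map may be filled in either order. -/
theorem extend_fubini {C : Type*} [AddCommGroup C] [Module ℂ C] {j k n : ℕ} (x : Fin k → Expr n)
    (y : Fin j → Expr n) (F : B →ₗ[ℂ] C →ₗ[ℂ] Val n M) (v : Val k B) (w : Val j C)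
    (H : B →ₗ[ℂ] Val n M) (H' : C →ₗ[ℂ] Val n M) (hH : ∀ b, H b = extend y (F b) w)
    (hH' : ∀ c, H' c = extend x (F.flip c) v) : extend x H v = extend y H' w := by
  -- H depends on w and H' on v. They are written out explicitly so that the inductions on v and w
  -- act on them as well.
  have e1 : H = LinearMap.mk ⟨fun b => extend y (F b) w, fun a b => by
      rw [map_add, extend_add_right]; rfl⟩ (fun c b => by
        simp only [map_smul, extend_smul_right]; rfl) := LinearMap.ext hH
  have e2 : H' = LinearMap.mk ⟨fun c => extend x (F.flip c) v, fun a b => by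
      rw [map_add, extend_add_right]; rfl⟩ (fun c b => by
        simp only [map_smul, extend_smul_right]; rfl) := LinearMap.ext hH'
  clear hH hH'
  subst e1 e2
  induction v using TensorProduct.induction_on with
  | zero =>
    rw [map_zero]
    induction w using TensorProduct.induction_on with
    | zero => simp
    | add u v hu hv => rw [map_add, ← hu, ← hv, add_zero]
    | tmul q b => simp [extend_tmul]
  | add u v hu hv =>
    rw [map_add, hu, hv]
    rw [← LinearMap.add_apply, ← extend_add_right]
    congr 2
    ext c
    simp
  | tmul q b =>
    rw [extend_tmul]
    simp only [LinearMap.coe_mk, AddHom.coe_mk]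
    rw [← extend_actL]
    rfl

end Calculus

/-! ### Values of cochains at lists of points, and insertion -/

section Points
variable {A M : Type*} [AddCommGroup A] [Module ℂ A] [Module (Polynomial ℂ) A]
  [IsScalarTower ℂ (Polynomial ℂ) A]
  [AddCommGroup M] [Module ℂ M] [Module (Polynomial ℂ) M] [IsScalarTower ℂ (Polynomial ℂ) M]

/-- The value of a cochain `F` at a list `z` of pairs consisting of an expression, that is
substituted for a variable, and an argument; `G` is applied to the coefficients. -/
def Φ {n p : ℕ} {B : Type*} [AddCommGroup B] [Module ℂ B] (F : CMap n B A) (G : A →ₗ[ℂ] Val p M)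
    (z : Fin (n + 1) → Expr p × B) : Val p M :=
  extend (fun i : Fin n => (z i.castSucc).1) G (F (fun i => (z i).2))

/-- `b ↦ Φ F G ((s, b), r)`. -/
def first {n p : ℕ} (F : CMap n A A) (G : A →ₗ[ℂ] Val p M) (s : Expr p)
    (r : Fin n → Expr p × A) : A →ₗ[ℂ] Val p M :=
  extend (fun i : Fin n => Fin.cons (α := fun _ => Expr p) s (fun j => (r j).1) i.castSucc) G ∘ₗ
    firstArg F (fun j => (r j).2)

theorem first_apply {n p : ℕ} (F : CMap n A A) (G : A →ₗ[ℂ] Val p M) (s : Expr p)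
    (r : Fin n → Expr p × A) (b : A) :
    first F G s r b = Φ F G (Fin.cons (α := fun _ => Expr p × A) (s, b) r) := by
  have e1 : ∀ i, (Fin.cons (α := fun _ => Expr p × A) (s, b) r i).1 =
      Fin.cons (α := fun _ => Expr p) s (fun j => (r j).1) i := by
    intro i; refine Fin.cases rfl (fun i => rfl) i
  have e2 : (fun i => (Fin.cons (α := fun _ => Expr p × A) (s, b) r i).2) =
      Fin.cons (α := fun _ => A) b (fun j => (r j).2) := by
    funext i; refine Fin.cases rfl (fun i => rfl) i
  simp only [Φ, e1, e2]
  rfl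

/-- The points `(λᵢ, aᵢ)`. -/
def pts {B : Type*} {p : ℕ} (a : Fin (p + 1) → B) (i : Fin (p + 1)) : Expr p × B := (lam p i, a i)

theorem sum_pts {B : Type*} {p : ℕ} (a : Fin (p + 1) → B) (σ : Equiv.Perm (Fin (p + 1))) :
    ∑ i, (pts a (σ i)).1 = -dv :=
  (Equiv.sum_comp σ (fun i => (pts a i).1)).trans (sum_lam p)

theorem sum_pts_one {B : Type*} {p : ℕ} (a : Fin (p + 1) → B) : ∑ i, (pts a i).1 = -dv := sum_lam p

theorem Φ_pts {B : Type*} [AddCommGroup B] [Module ℂ B] {p : ℕ} (F : CMap p B A)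
    (a : Fin (p + 1) → B) : Φ F (cst p A) (pts a) = F a := by
  have : (fun i : Fin p => (pts a i.castSucc).1) = fun i => lv i :=
    funext fun i => lam_castSucc i
  rw [Φ, this]
  exact subst_lv _

theorem cmap_ext {B : Type*} [AddCommGroup B] [Module ℂ B] {p : ℕ} {F F' : CMap p B A}
    (h : ∀ a, Φ F (cst p A) (pts a) = Φ F' (cst p A) (pts a)) : F = F' :=
  MultilinearMap.ext fun a => by rw [← Φ_pts F, ← Φ_pts F', h]

/-- The action of a permutation on `C^{n+1}`, without the sign. -/
def perm {B : Type*} [AddCommGroup B] [Module ℂ B] {n : ℕ} (σ : Equiv.Perm (Fin (n + 1))) :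
    CMap n B A →ₗ[ℂ] CMap n B A where
  toFun F := (subst (fun i : Fin n => lam n (σ i.castSucc))).compMultilinearMap (F.domDomCongr σ)
  map_add' F G := by ext a; simp
  map_smul' c F := by ext a; simp

theorem perm_apply {B : Type*} [AddCommGroup B] [Module ℂ B] {n : ℕ}
    (σ : Equiv.Perm (Fin (n + 1))) (F : CMap n B A) (a : Fin (n + 1) → B) :
    perm σ F a = subst (fun i : Fin n => lam n (σ i.castSucc)) (F (fun i => a (σ i))) := rfl

/-- The last expression of a list does not occur in `Φ`, but by `ev_lam` the condition on the sum
forces it to be what λ† becomes. Hence a permutation that moves the last place also just permutes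
the points. -/
theorem Φ_perm {B : Type*} [AddCommGroup B] [Module ℂ B] {n p : ℕ}
    (σ : Equiv.Perm (Fin (n + 1))) (F : CMap n B A) {κ : Expr p} {G : A →ₗ[ℂ] Val p M}
    (hG : IsConf κ G) (z : Fin (n + 1) → Expr p × B) (hz : ∑ i, (z i).1 = -κ) :
    Φ (perm σ F) G z = Φ F G (fun i => z (σ i)) := by
  rw [Φ, perm_apply, extend_subst _ hG]
  have : ∀ j, ev (fun i : Fin n => (z i.castSucc).1) κ (lam n j) = (z j).1 :=
    fun j => ev_lam (fun i => (z i).1) κ hz j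
  simp only [this]
  rfl

theorem perm_apply_pts {B : Type*} [AddCommGroup B] [Module ℂ B] {n : ℕ}
    (σ : Equiv.Perm (Fin (n + 1))) (F : CMap n B A) (a : Fin (n + 1) → B) :
    perm σ F a = Φ F (cst n A) (fun i => pts a (σ i)) := rfl

theorem perm_perm {B : Type*} [AddCommGroup B] [Module ℂ B] {n : ℕ}
    (σ τ : Equiv.Perm (Fin (n + 1))) (F : CMap n B A) :
    perm σ (perm τ F) = perm (σ * τ) F := by
  ext a
  rw [perm_apply_pts, Φ_perm τ F (isConf_cst n) _ (sum_pts a σ)]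
  rfl

/-- The conformal sesquilinearity of a map. -/
def Sesq {B : Type*} [AddCommGroup B] [Module ℂ B] [Module (Polynomial ℂ) B]
    [IsScalarTower ℂ (Polynomial ℂ) B] {n : ℕ} (F : CMap n B A) : Prop :=
  ∀ (i : Fin (n + 1)) (a : Fin (n + 1) → B),
      F (Function.update a i (del B (a i))) = -act (lam n i) (F a)

theorem Φ_del {B : Type*} [AddCommGroup B] [Module ℂ B] [Module (Polynomial ℂ) B]
    [IsScalarTower ℂ (Polynomial ℂ) B] {n p : ℕ} {F : CMap n B A} (hF : Sesq F) {κ : Expr p}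
    {G : A →ₗ[ℂ] Val p M} (hG : IsConf κ G) (z : Fin (n + 1) → Expr p × B)
    (hz : ∑ i, (z i).1 = -κ) (j : Fin (n + 1)) :
    Φ F G (Function.update z j ((z j).1, del B (z j).2)) = -act (z j).1 (Φ F G z) := by
  have e1 : ∀ i, (Function.update z j ((z j).1, del B (z j).2) i).1 = (z i).1 := by
    intro i
    by_cases h : i = j
    · subst h; simp
    · rw [Function.update_of_ne h]
  have e2 : (fun i => (Function.update z j ((z j).1, del B (z j).2) i).2) =
      Function.update (fun i => (z i).2) j (del B (z j).2) := by
    funext i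
    by_cases h : i = j
    · subst h; simp
    · rw [Function.update_of_ne h, Function.update_of_ne h]
  simp only [Φ, e1, e2]
  rw [hF j (fun i => (z i).2), map_neg, extend_act _ hG, ev_lam (fun i => (z i).1) κ hz j]

/-- By sesquilinearity a ∂ in the first argument is -s, so a cochain inserted there sees -s in the
role of ∂. When s is the sum of the expressions at its own points, these satisfy the condition on
the sum again, and insertions can be nested. -/
theorem isConf_first {n p : ℕ} {F : CMap n A A} (hF : Sesq F) {κ : Expr p}
    {G : A →ₗ[ℂ] Val p M} (hG : IsConf κ G) (s : Expr p) (r : Fin n → Expr p × A)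
    (hs : s + ∑ i, (r i).1 = -κ) : IsConf (-s) (first F G s r) := by
  intro b
  have := Φ_del hF hG (Fin.cons (α := fun _ => Expr p × A) (s, b) r)
    (by rw [Fin.sum_univ_succ]; simpa using hs) 0
  rw [Fin.cons_zero, Fin.update_cons_zero] at this
  rw [first_apply, first_apply, this, map_neg]
  rfl

theorem Sesq.perm {n : ℕ} {F : CMap n A M} (hF : Sesq F) (σ : Equiv.Perm (Fin (n + 1))) :
    Sesq (perm σ F) := by
  intro i a
  obtain ⟨i, rfl⟩ := σ.surjective i
  have := Φ_del hF (isConf_cst n) (fun j => pts a (σ j)) (sum_pts a σ) i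
  rw [perm_apply_pts, perm_apply_pts]
  change _ = -act (pts a (σ i)).1 _
  rw [← this]
  congr 1
  funext j
  by_cases h : j = i
  · subst h; simp [pts]
  · rw [Function.update_of_ne h, pts, Function.update_of_ne (σ.injective.ne h)]; rfl

/-- The insertion of `g` in the first argument of `f`. -/
def ins {m n p : ℕ} (h : m + n = p) (f : CMap m A A) (g : CMap n A A) : CMap p A A where
  toFun a := circTerm h f g 1 a
  map_update_add' {inst} a j x y := by
    obtain rfl : inst = instDecidableEqFin _ := Subsingleton.elim _ _
    exact circTerm_update_add h f g 1 a j x y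
  map_update_smul' {inst} a j c x := by
    obtain rfl : inst = instDecidableEqFin _ := Subsingleton.elim _ _
    exact circTerm_update_smul h f g 1 a j c x

theorem sum_places {m n p : ℕ} (h : m + n = p) {R : Type*} [AddCommMonoid R]
    (w : Fin (p + 1) → R) :
    ∑ i, w i = ∑ i : Fin (n + 1), w (headIx h i) + ∑ j : Fin m, w (tailIx h j) := by
  subst h
  have e : n + 1 + m = m + n + 1 := by omega
  rw [← Fin.sum_congr' w e, Fin.sum_univ_add]
  rfl

theorem circTerm_eq {m n p : ℕ} (h : m + n = p) (f : CMap m A A) (g : CMap n A A)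
    (σ : Equiv.Perm (Fin (p + 1))) (a : Fin (p + 1) → A) :
    circTerm h f g σ a =
      Φ g (first f (cst p A) (∑ i, (pts a (σ (headIx h i))).1) (fun j => pts a (σ (tailIx h j))))
        (fun i => pts a (σ (headIx h i))) := rfl

/-- All substitutions inside the composite are resolved at once by `ev_lam`, which leaves nested
values at the given points. Identities between composites thereby become rearrangements of points.
-/
theorem Φ_ins {m n p q : ℕ} (h : m + n = p) (f : CMap m A A) (g : CMap n A A) {κ : Expr q}
    {G : A →ₗ[ℂ] Val q M} (hG : IsConf κ G) (z : Fin (p + 1) → Expr q × A)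
    (hz : ∑ i, (z i).1 = -κ) :
    Φ (ins h f g) G z =
      Φ g (first f G (∑ i, (z (headIx h i)).1) (fun j => z (tailIx h j)))
        (fun i => z (headIx h i)) := by
  have hl : ∀ j, ev (fun i : Fin p => (z i.castSucc).1) κ (lam p j) = (z j).1 :=
    fun j => ev_lam (fun i => (z i).1) κ hz j
  have hv : ∀ j, ev (fun i : Fin p => (z i.castSucc).1) κ
      (Fin.cons (α := fun _ => Expr p) (∑ i : Fin (n + 1), lam p (headIx h i))
        (fun j => lam p (tailIx h j)) j) =
      Fin.cons (α := fun _ => Expr q) (∑ i, (z (headIx h i)).1) (fun j => (z (tailIx h j)).1) j := by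
    intro j
    refine Fin.cases ?_ (fun j => ?_) j
    · simp only [Fin.cons_zero, map_sum, hl]
    · simp only [Fin.cons_succ, hl]
  change extend _ G (circTerm h f g 1 (fun i => (z i).2)) = _
  simp only [circTerm, Equiv.Perm.coe_one, id]
  rw [extend_extend _ hG]
  simp only [hl]
  rw [Φ]
  congr 2
  ext b
  simp only [LinearMap.comp_apply, first]
  rw [extend_subst _ hG]
  simp only [hv]

theorem circTerm_eq_perm {m n p : ℕ} (h : m + n = p) (f : CMap m A A) (g : CMap n A A)
    (σ : Equiv.Perm (Fin (p + 1))) (a : Fin (p + 1) → A) :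
    circTerm h f g σ a = perm σ (ins h f g) a := by
  rw [perm_apply_pts, Φ_ins h f g (isConf_cst p) _ (sum_pts a σ), circTerm_eq]

end Points

/-! ### Unshuffles as coset representatives -/

section Blocks
variable {m n p : ℕ}

/-- The places as the disjoint union of the head and the tail. -/
def placeEquiv (h : m + n = p) : Fin (n + 1) ⊕ Fin m ≃ Fin (p + 1) :=
  finSumFinEquiv.trans (finCongr (by omega))

theorem placeEquiv_inl (h : m + n = p) (i : Fin (n + 1)) :
    placeEquiv h (Sum.inl i) = headIx h i := rfl

theorem placeEquiv_inr (h : m + n = p) (j : Fin m) : placeEquiv h (Sum.inr j) = tailIx h j := rfl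

/-- A permutation of the head and one of the tail combined. -/
def blockPerm (h : m + n = p) (v : Equiv.Perm (Fin (n + 1))) (w : Equiv.Perm (Fin m)) :
    Equiv.Perm (Fin (p + 1)) := (placeEquiv h).permCongr (Equiv.Perm.sumCongr v w)

@[simp]
theorem blockPerm_head (h : m + n = p) (v : Equiv.Perm (Fin (n + 1))) (w : Equiv.Perm (Fin m))
    (i : Fin (n + 1)) : blockPerm h v w (headIx h i) = headIx h (v i) := by
  simp [blockPerm, Equiv.permCongr_apply, ← placeEquiv_inl]

@[simp]
theorem blockPerm_tail (h : m + n = p) (v : Equiv.Perm (Fin (n + 1))) (w : Equiv.Perm (Fin m))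
    (i : Fin m) : blockPerm h v w (tailIx h i) = tailIx h (w i) := by
  simp [blockPerm, Equiv.permCongr_apply, ← placeEquiv_inr]

theorem sign_blockPerm (h : m + n = p) (v : Equiv.Perm (Fin (n + 1))) (w : Equiv.Perm (Fin m)) :
    Equiv.Perm.sign (blockPerm h v w) = Equiv.Perm.sign v * Equiv.Perm.sign w := by
  rw [blockPerm, Equiv.Perm.sign_permCongr, Equiv.Perm.sign_sumCongr]

theorem perm_ext_places (h : m + n = p) {σ τ : Equiv.Perm (Fin (p + 1))}
    (h1 : ∀ i, σ (headIx h i) = τ (headIx h i)) (h2 : ∀ i, σ (tailIx h i) = τ (tailIx h i)) :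
    σ = τ := by
  ext1 j
  obtain ⟨i, rfl⟩ | ⟨i, rfl⟩ := place_cases h j
  exacts [h1 i, h2 i]

theorem blockPerm_mul (h : m + n = p) (v v' : Equiv.Perm (Fin (n + 1))) (w w' : Equiv.Perm (Fin m)) :
    blockPerm h v w * blockPerm h v' w' = blockPerm h (v * v') (w * w') :=
  perm_ext_places h (fun i => by simp) (fun i => by simp)

theorem headIx_injective (h : m + n = p) : Function.Injective (headIx h) := fun i j hij => by
  rw [← placeEquiv_inl, ← placeEquiv_inl] at hij
  simpa using (placeEquiv h).injective hij

theorem tailIx_injective (h : m + n = p) : Function.Injective (tailIx h) := fun i j hij => by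
  rw [← placeEquiv_inr, ← placeEquiv_inr] at hij
  simpa using (placeEquiv h).injective hij

theorem headIx_ne_tailIx (h : m + n = p) (i : Fin (n + 1)) (j : Fin m) :
    headIx h i ≠ tailIx h j := fun hij => by
  rw [← placeEquiv_inl, ← placeEquiv_inr] at hij
  simpa using (placeEquiv h).injective hij

theorem isUnshuffle_iff (h : m + n = p) (σ : Equiv.Perm (Fin (p + 1))) :
    IsUnshuffle (n + 1) σ ↔
      StrictMono (fun i => σ (headIx h i)) ∧ StrictMono (fun j => σ (tailIx h j)) := by
  constructor
  · rintro ⟨h1, h2⟩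
    refine ⟨fun a b hab => h1 _ _ ?_ b.2, fun a b hab => h2 _ _ ?_ (by simp [tailIx])⟩
    · exact hab
    · simp only [Fin.lt_def, tailIx] at hab ⊢; omega
  · rintro ⟨h1, h2⟩
    refine ⟨fun a b hab hb => ?_, fun a b hab ha => ?_⟩
    · obtain ⟨a, rfl⟩ | ⟨a, rfl⟩ := place_cases h a <;> obtain ⟨b, rfl⟩ | ⟨b, rfl⟩ := place_cases h b
      · exact h1 (show a < b from hab)
      · simp only [tailIx] at hb; omega
      · simp only [tailIx, headIx, Fin.lt_def] at hab hb; omega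
      · simp only [tailIx] at hb; omega
    · obtain ⟨a, rfl⟩ | ⟨a, rfl⟩ := place_cases h a <;> obtain ⟨b, rfl⟩ | ⟨b, rfl⟩ := place_cases h b
      · simp only [headIx] at ha; omega
      · simp only [headIx] at ha; omega
      · simp only [tailIx, headIx, Fin.lt_def] at hab ha; omega
      · exact h2 (show a < b by simp only [Fin.lt_def, tailIx] at hab ⊢; omega)

/-- Sort the values on the head and those on the tail separately. -/
theorem exists_isUnshuffle (h : m + n = p) (σ : Equiv.Perm (Fin (p + 1))) :
    ∃ v w, IsUnshuffle (n + 1) (σ * blockPerm h v w) := by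
  refine ⟨Tuple.sort (fun i => σ (headIx h i)), Tuple.sort (fun i => σ (tailIx h i)), ?_⟩
  rw [isUnshuffle_iff h]
  constructor
  · refine Monotone.strictMono_of_injective ?_ ?_
    · simp only [Equiv.Perm.mul_apply, blockPerm_head]
      exact Tuple.monotone_sort (fun i => σ (headIx h i))
    · intro a b hab
      simpa [(headIx_injective h).eq_iff] using hab
  · refine Monotone.strictMono_of_injective ?_ ?_
    · simp only [Equiv.Perm.mul_apply, blockPerm_tail]
      exact Tuple.monotone_sort (fun i => σ (tailIx h i))
    · intro a b hab
      simpa [(tailIx_injective h).eq_iff] using hab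

theorem strictMono_comp_perm {k N : ℕ} {f : Fin k → Fin N} {v : Equiv.Perm (Fin k)}
    (hf : StrictMono f) (hfv : StrictMono (fun i => f (v i))) : v = 1 := by
  have : (fun i => f (v i)) = f := by
    refine (StrictMono.range_inj hfv hf).1 ?_
    exact v.surjective.range_comp f
  ext1 i
  exact hf.injective (congrFun this i)

theorem isUnshuffle_unique (h : m + n = p) {σ τ : Equiv.Perm (Fin (p + 1))}
    {v : Equiv.Perm (Fin (n + 1))} {w : Equiv.Perm (Fin m)} (hσ : IsUnshuffle (n + 1) σ)
    (hτ : IsUnshuffle (n + 1) τ) (e : τ = σ * blockPerm h v w) : v = 1 ∧ w = 1 := by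
  subst e
  rw [isUnshuffle_iff h] at hσ hτ
  exact ⟨strictMono_comp_perm hσ.1 (by simpa using hτ.1),
    strictMono_comp_perm hσ.2 (by simpa using hτ.2)⟩

theorem blockPerm_one (h : m + n = p) : blockPerm h 1 1 = 1 :=
  perm_ext_places h (fun i => by simp) (fun i => by simp)

/-- Unshuffles represent the cosets of the permutations that preserve head and tail. -/
theorem sum_perm_eq_sum_unshuffles (h : m + n = p) {R : Type*} [AddCommMonoid R]
    (φ : Equiv.Perm (Fin (p + 1)) → R) (hφ : ∀ σ v w, φ (σ * blockPerm h v w) = φ σ) :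
    ∑ σ, φ σ = ((n + 1).factorial * m.factorial) • ∑ σ ∈ unshuffles (p + 1) (n + 1), φ σ := by
  have key : ∑ x ∈ unshuffles (p + 1) (n + 1) ×ˢ
      (Finset.univ : Finset (Equiv.Perm (Fin (n + 1)) × Equiv.Perm (Fin m))),
      φ (x.1 * blockPerm h x.2.1 x.2.2) = ∑ σ, φ σ := by
    refine Finset.sum_bij (fun x _ => x.1 * blockPerm h x.2.1 x.2.2) (fun _ _ => Finset.mem_univ _)
      ?_ ?_ (fun _ _ => rfl)
    · rintro ⟨u, v, w⟩ hu ⟨u', v', w'⟩ hu' e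
      simp only [unshuffles, Finset.mem_product, Finset.mem_filter, Finset.mem_univ, true_and,
        and_true] at hu hu' e
      have e' : u' = u * blockPerm h (v * v'⁻¹) (w * w'⁻¹) := by
        rw [← blockPerm_mul, ← mul_assoc, e, mul_assoc, blockPerm_mul, mul_inv_cancel,
          mul_inv_cancel, blockPerm_one, mul_one]
      obtain ⟨e1, e2⟩ := isUnshuffle_unique h hu hu' e'
      rw [e1, e2, blockPerm_one, mul_one] at e'
      rw [mul_inv_eq_one] at e1 e2
      rw [e', e1, e2]
    · intro σ _
      obtain ⟨v, w, hu⟩ := exists_isUnshuffle h σ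
      refine ⟨(σ * blockPerm h v w, v⁻¹, w⁻¹), by simpa [unshuffles] using hu, ?_⟩
      simp only
      rw [mul_assoc, blockPerm_mul, mul_inv_cancel, mul_inv_cancel, blockPerm_one, mul_one]
  rw [← key, Finset.sum_product]
  simp only [hφ, Finset.sum_const]
  rw [Finset.sum_nsmul]
  simp [Fintype.card_perm]

/-- A sum over permutations that depends on the preimage of `0` only. -/
theorem sum_perm_of_preimage_zero {R : Type*} [AddCommMonoid R]
    (φ : Equiv.Perm (Fin (p + 1)) → R) (ψ : Fin (p + 1) → R) (hφ : ∀ σ, φ σ = ψ (σ⁻¹ 0)) :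
    ∑ σ, φ σ = p.factorial • ∑ j, ψ j := by
  rw [← Equiv.sum_comp (Equiv.inv (Equiv.Perm (Fin (p + 1)))),
    ← Equiv.sum_comp Equiv.Perm.decomposeFin.symm, Fintype.sum_prod_type]
  simp [hφ, Fintype.card_perm, Finset.sum_nsmul, Equiv.Perm.decomposeFin_symm_apply_zero]

end Blocks

/-! ### Skew-symmetrization; ⋄ as skew-symmetrized insertion -/

section Alt
variable {A B : Type*} [AddCommGroup A] [Module ℂ A] [Module (Polynomial ℂ) A]
  [IsScalarTower ℂ (Polynomial ℂ) A] [AddCommGroup B] [Module ℂ B]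

/-- The action of a permutation on `C^{n+1}`, with the sign. -/
def sperm {n : ℕ} (σ : Equiv.Perm (Fin (n + 1))) : CMap n B A →ₗ[ℂ] CMap n B A :=
  (Equiv.Perm.sign σ : ℤ) • perm σ

theorem sperm_apply {n : ℕ} (σ : Equiv.Perm (Fin (n + 1))) (F : CMap n B A) :
    sperm σ F = (Equiv.Perm.sign σ : ℤ) • perm σ F := rfl

theorem sperm_sperm {n : ℕ} (σ τ : Equiv.Perm (Fin (n + 1))) (F : CMap n B A) :
    sperm σ (sperm τ F) = sperm (σ * τ) F := by
  simp only [sperm_apply, map_zsmul, perm_perm, smul_smul, Equiv.Perm.sign_mul, Units.val_mul,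
    mul_comm]

/-- The skew-symmetrization. -/
def alt {n : ℕ} : CMap n B A →ₗ[ℂ] CMap n B A := ∑ σ, sperm σ

theorem alt_apply {n : ℕ} (F : CMap n B A) : alt F = ∑ σ, sperm σ F := by
  simp [alt]

theorem sperm_alt {n : ℕ} (σ : Equiv.Perm (Fin (n + 1))) (F : CMap n B A) :
    sperm σ (alt F) = alt F := by
  simp only [alt_apply, map_sum, sperm_sperm]
  exact Equiv.sum_comp (Equiv.mulLeft σ) (fun τ => sperm τ F)

theorem alt_sperm {n : ℕ} (σ : Equiv.Perm (Fin (n + 1))) (F : CMap n B A) :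
    alt (sperm σ F) = alt F := by
  simp only [alt_apply, sperm_sperm]
  exact Equiv.sum_comp (Equiv.mulRight σ) (fun τ => sperm τ F)

theorem mem_cochain_iff {B : Type*} [AddCommGroup B] [Module ℂ B] [Module (Polynomial ℂ) B]
    [IsScalarTower ℂ (Polynomial ℂ) B] {n : ℕ} (F : CMap n B A) :
    F ∈ Cochain n B A ↔ Sesq F ∧ ∀ σ, sperm σ F = F := by
  refine and_congr Iff.rfl (forall_congr' fun σ => ?_)
  rw [MultilinearMap.ext_iff]
  exact forall_congr' fun a => eq_comm

variable {m n p : ℕ}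

theorem ins_add_left (h : m + n = p) (f f' : CMap m A A) (g : CMap n A A) :
    ins h (f + f') g = ins h f g + ins h f' g := by
  ext a
  change circTerm h (f + f') g 1 a = circTerm h f g 1 a + circTerm h f' g 1 a
  have : ∀ r, firstArg (f + f') r = firstArg f r + firstArg f' r := fun r => rfl
  simp only [circTerm, this, LinearMap.comp_add, extend_add_right, LinearMap.add_apply]

theorem ins_smul_left (h : m + n = p) (c : ℂ) (f : CMap m A A) (g : CMap n A A) :
    ins h (c • f) g = c • ins h f g := by
  ext a
  change circTerm h (c • f) g 1 a = c • circTerm h f g 1 a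
  have : ∀ r, firstArg (c • f) r = c • firstArg f r := fun r => rfl
  simp only [circTerm, this, LinearMap.comp_smul, extend_smul_right, LinearMap.smul_apply]

/-- Insertion as a bilinear map. -/
def insL (h : m + n = p) : CMap m A A →ₗ[ℂ] CMap n A A →ₗ[ℂ] CMap p A A :=
  LinearMap.mk₂ ℂ (ins h) (ins_add_left h) (ins_smul_left h)
    (fun f g g' => by
      ext a
      change circTerm h f (g + g') 1 a = circTerm h f g 1 a + circTerm h f g' 1 a
      simp only [circTerm, add_apply, map_add])
    (fun c f g => by
      ext a
      change circTerm h f (c • g) 1 a = c • circTerm h f g 1 a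
      simp only [circTerm, smul_apply, map_smul])

@[simp]
theorem insL_apply (h : m + n = p) (f : CMap m A A) (g : CMap n A A) : insL h f g = ins h f g := rfl

theorem circ_eq_sum (h : m + n = p) (f : CMap m A A) (g : CMap n A A) :
    circ h f g = ∑ σ ∈ unshuffles (p + 1) (n + 1), sperm σ (ins h f g) := by
  ext a
  rw [sum_apply]
  refine Finset.sum_congr rfl fun σ _ => ?_
  rw [circTerm_eq_perm]
  rfl

theorem Sesq.ins {f : CMap m A A} {g : CMap n A A} (h : m + n = p) (hf : Sesq f) (hg : Sesq g) :
    Sesq (ins h f g) := by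
  intro i a
  have e : pts (Function.update a i (del A (a i))) =
      Function.update (pts a) i ((pts a i).1, del A (pts a i).2) := by
    funext j
    by_cases hj : j = i
    · subst hj; simp [pts]
    · simp [pts, Function.update_of_ne hj]
  rw [← Φ_pts, e, ← Φ_pts _ a]
  have hs : ∑ j, (Function.update (pts a) i ((pts a i).1, del A (pts a i).2) j).1 = -dv := by
    rw [← e]; exact sum_pts_one _
  rw [Φ_ins h f g (isConf_cst p) _ hs, Φ_ins h f g (isConf_cst p) _ (sum_pts_one a)]
  have hw := sum_places h (fun j => (pts a j).1)
  rw [sum_pts_one] at hw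
  obtain ⟨i, rfl⟩ | ⟨i, rfl⟩ := place_cases h i
  · have e1 : (fun j => Function.update (pts a) (headIx h i)
        ((pts a (headIx h i)).1, del A (pts a (headIx h i)).2) (headIx h j)) =
        Function.update (fun j => pts a (headIx h j)) i
          ((pts a (headIx h i)).1, del A (pts a (headIx h i)).2) :=
      Function.update_comp_eq_of_injective' _ (headIx_injective h) _ _
    have e2 : ∀ j, Function.update (pts a) (headIx h i)
        ((pts a (headIx h i)).1, del A (pts a (headIx h i)).2) (tailIx h j) = pts a (tailIx h j) :=
      fun j => Function.update_of_ne (headIx_ne_tailIx h i j).symm _ _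
    have e3 : ∀ j, (Function.update (pts a) (headIx h i)
        ((pts a (headIx h i)).1, del A (pts a (headIx h i)).2) (headIx h j)).1 =
          (pts a (headIx h j)).1 := by
      intro j
      by_cases hj : headIx h j = headIx h i
      · rw [hj]; simp
      · rw [Function.update_of_ne hj]
    simp only [e2, e3]
    rw [e1]
    refine Φ_del hg (isConf_first hf (isConf_cst p) _ _ hw.symm) (fun j => pts a (headIx h j)) ?_ i
    simp
  · have e1 : (fun j => Function.update (pts a) (tailIx h i)
        ((pts a (tailIx h i)).1, del A (pts a (tailIx h i)).2) (tailIx h j)) =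
        Function.update (fun j => pts a (tailIx h j)) i
          ((pts a (tailIx h i)).1, del A (pts a (tailIx h i)).2) :=
      Function.update_comp_eq_of_injective' _ (tailIx_injective h) _ _
    have e2 : ∀ j, Function.update (pts a) (tailIx h i)
        ((pts a (tailIx h i)).1, del A (pts a (tailIx h i)).2) (headIx h j) = pts a (headIx h j) :=
      fun j => Function.update_of_ne (headIx_ne_tailIx h j i) _ _
    simp only [e2]
    rw [e1]
    -- A ∂ on an argument of f outside the insertion gives minus the expression attached to it, and
    -- this factor commutes with the extension to the value of g.
    have e4 : first f (cst p A) (∑ j, (pts a (headIx h j)).1)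
        (Function.update (fun j => pts a (tailIx h j)) i
          ((pts a (tailIx h i)).1, del A (pts a (tailIx h i)).2)) =
        actL (-(pts a (tailIx h i)).1) ∘ₗ first f (cst p A) (∑ j, (pts a (headIx h j)).1)
          (fun j => pts a (tailIx h j)) := by
      ext1 b
      rw [LinearMap.comp_apply, first_apply, first_apply]
      have := Φ_del hf (isConf_cst p) (Fin.cons (α := fun _ => Expr p × A)
        (∑ j, (pts a (headIx h j)).1, b) (fun j => pts a (tailIx h j)))
        (by rw [Fin.sum_univ_succ]; simpa using hw.symm) i.succ
      rw [Fin.cons_succ, ← Fin.cons_update] at this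
      rw [this, actL_apply, map_neg]
      rfl
    rw [e4, Φ, extend_actL, map_neg]
    rfl

theorem Sesq.sum {ι : Type*} (s : Finset ι) (F : ι → CMap n B A) [Module (Polynomial ℂ) B]
    [IsScalarTower ℂ (Polynomial ℂ) B] (hF : ∀ i ∈ s, Sesq (F i)) : Sesq (∑ i ∈ s, F i) := by
  intro j a
  rw [sum_apply, sum_apply, map_sum, ← Finset.sum_neg_distrib]
  exact Finset.sum_congr rfl fun i hi => hF i hi j a

theorem Sesq.zsmul (c : ℤ) {F : CMap n B A} [Module (Polynomial ℂ) B]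
    [IsScalarTower ℂ (Polynomial ℂ) B] (hF : Sesq F) : Sesq (c • F) := by
  intro j a
  rw [smul_apply, smul_apply, hF, smul_neg, map_zsmul]

/-- Permuting the arguments of the inserted map. -/
theorem ins_perm_right (h : m + n = p) {f : CMap m A A} (hf : Sesq f) (g : CMap n A A)
    (v : Equiv.Perm (Fin (n + 1))) : ins h f (perm v g) = perm (blockPerm h v 1) (ins h f g) := by
  refine cmap_ext fun a => ?_
  have hw := sum_places h (fun j => (pts a j).1)
  rw [sum_pts_one] at hw
  rw [Φ_ins h _ _ (isConf_cst p) _ (sum_pts_one a), Φ_perm _ _ (isConf_cst p) _ (sum_pts_one a),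
    Φ_ins h _ _ (isConf_cst p) _ (sum_pts a _), Φ_perm v g (isConf_first hf (isConf_cst p) _ _ hw.symm)]
  · simp only [blockPerm_head, blockPerm_tail, Equiv.Perm.coe_one, id]
    rw [Equiv.sum_comp v (fun i => (pts a (headIx h i)).1)]
  · simp

theorem first_perm {q : ℕ} {M : Type*} [AddCommGroup M] [Module ℂ M] [Module (Polynomial ℂ) M]
    [IsScalarTower ℂ (Polynomial ℂ) M] {f : CMap m A A} {u : Equiv.Perm (Fin (m + 1))}
    {w : Equiv.Perm (Fin m)} (h0 : u 0 = 0) (hu : ∀ j, u (Fin.succ j) = Fin.succ (w j))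
    {κ : Expr q} {G : A →ₗ[ℂ] Val q M} (hG : IsConf κ G) (s : Expr q) (r : Fin m → Expr q × A)
    (hs : s + ∑ i, (r i).1 = -κ) : first (perm u f) G s r = first f G s (fun j => r (w j)) := by
  ext1 b
  rw [first_apply, first_apply, Φ_perm _ _ hG _ (by rw [Fin.sum_univ_succ]; simpa using hs)]
  congr 1
  funext i
  refine Fin.cases (by simp [h0]) (fun i => by simp [hu]) i

/-- Permuting the arguments, other than the first, of the map in which another is inserted. -/
theorem ins_perm_left (h : m + n = p) (f : CMap m A A) (g : CMap n A A)
    {u : Equiv.Perm (Fin (m + 1))} {w : Equiv.Perm (Fin m)} (h0 : u 0 = 0)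
    (hu : ∀ j, u (Fin.succ j) = Fin.succ (w j)) :
    ins h (perm u f) g = perm (blockPerm h 1 w) (ins h f g) := by
  refine cmap_ext fun a => ?_
  have hw := sum_places h (fun j => (pts a j).1)
  rw [sum_pts_one] at hw
  rw [Φ_ins h _ _ (isConf_cst p) _ (sum_pts_one a), Φ_perm _ _ (isConf_cst p) _ (sum_pts_one a),
    Φ_ins h _ _ (isConf_cst p) _ (sum_pts a _), first_perm h0 hu (isConf_cst p) _ _ hw.symm]
  simp only [blockPerm_head, blockPerm_tail, Equiv.Perm.coe_one, id]

theorem exists_consPerm (w : Equiv.Perm (Fin m)) : ∃ u : Equiv.Perm (Fin (m + 1)),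
    u 0 = 0 ∧ (∀ j, u (Fin.succ j) = Fin.succ (w j)) ∧ Equiv.Perm.sign u = Equiv.Perm.sign w := by
  refine ⟨Equiv.Perm.decomposeFin.symm (0, w), by simp, fun j => by simp, by simp⟩

theorem exists_of_fix_zero (u : Equiv.Perm (Fin (m + 1))) (h0 : u 0 = 0) :
    ∃ w : Equiv.Perm (Fin m), (∀ j, u (Fin.succ j) = Fin.succ (w j)) ∧
      Equiv.Perm.sign u = Equiv.Perm.sign w := by
  obtain ⟨⟨q, w⟩, rfl⟩ := Equiv.Perm.decomposeFin.symm.surjective u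
  simp only [Equiv.Perm.decomposeFin_symm_apply_zero] at h0
  subst h0
  exact ⟨w, fun j => by simp, by simp⟩

/-- The head is governed by the skewness of g. The tail is governed by that of f under permutations
fixing 0, the place where g is inserted. -/
theorem sperm_blockPerm_ins (h : m + n = p) {f g} (hf : f ∈ Cochain m A A) (hg : g ∈ Cochain n A A)
    (v : Equiv.Perm (Fin (n + 1))) (w : Equiv.Perm (Fin m)) :
    sperm (blockPerm h v w) (ins h f g) = ins h f g := by
  rw [mem_cochain_iff] at hf hg
  obtain ⟨u, h0, hu, hs⟩ := exists_consPerm w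
  have e1 : blockPerm h v w = blockPerm h v 1 * blockPerm h 1 w := by simp [blockPerm_mul]
  have e2 : sperm (blockPerm h 1 w) (ins h f g) = ins h (sperm u f) g := by
    rw [sperm_apply, sperm_apply, ← insL_apply h (_ • _), map_zsmul, LinearMap.smul_apply, insL_apply,
      ins_perm_left h f g h0 hu, sign_blockPerm, map_one, one_mul, hs]
  have e3 : sperm (blockPerm h v 1) (ins h f g) = ins h f (sperm v g) := by
    rw [sperm_apply, sperm_apply, ← insL_apply h _ (_ • _), map_zsmul, insL_apply,
      ins_perm_right h hf.1 g v, sign_blockPerm, map_one, mul_one]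
  rw [e1, ← sperm_sperm, e2, hf.2, e3, hg.2]

/-- By `sperm_blockPerm_ins` the summands of `alt` are constant on cosets of the block permutations,
of which there are (n+1)! m!. Sums over unshuffles can thus be traded for sums over full symmetric
groups, where reindexing is free. -/
theorem factorial_smul_circ (h : m + n = p) {f g} (hf : f ∈ Cochain m A A)
    (hg : g ∈ Cochain n A A) :
    ((n + 1).factorial * m.factorial) • circ h f g = alt (ins h f g) := by
  rw [alt_apply, sum_perm_eq_sum_unshuffles h, circ_eq_sum]
  intro σ v w
  rw [← sperm_sperm, sperm_blockPerm_ins h hf hg]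

theorem nsmul_cancel {V : Type*} [AddCommGroup V] [Module ℂ V] {k : ℕ} (hk : k ≠ 0) {x y : V}
    (h : k • x = k • y) : x = y := by
  rw [← Nat.cast_smul_eq_nsmul ℂ, ← Nat.cast_smul_eq_nsmul ℂ] at h
  exact smul_right_injective V (Nat.cast_ne_zero.2 hk : (k : ℂ) ≠ 0) h

/-- Sesquilinearity passes to each summand. Skewness is inherited from `alt` and survives division
by the factorials. -/
theorem circ_mem (h : m + n = p) {f g} (hf : f ∈ Cochain m A A)
    (hg : g ∈ Cochain n A A) : circ h f g ∈ Cochain p A A := by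
  have hf' := (mem_cochain_iff f).1 hf
  have hg' := (mem_cochain_iff g).1 hg
  rw [mem_cochain_iff]
  constructor
  · rw [circ_eq_sum]
    exact Sesq.sum _ _ fun σ _ => Sesq.zsmul _ ((hf'.1.ins h hg'.1).perm σ)
  · intro σ
    refine nsmul_cancel (k := (n + 1).factorial * m.factorial) (by positivity) ?_
    rw [← map_nsmul, factorial_smul_circ h hf hg, sperm_alt]

end Alt

theorem neg_one_pow_congr {a b : ℕ} (h : Even a ↔ Even b) : (-1 : ℤ) ^ a = (-1) ^ b := by
  by_cases ha : Even a
  · rw [ha.neg_one_pow, (h.1 ha).neg_one_pow]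
  · rw [(Nat.not_even_iff_odd.1 ha).neg_one_pow,
      (Nat.not_even_iff_odd.1 (fun hb => ha (h.2 hb))).neg_one_pow]

/-! ### The pre-Lie identity for ⋄ -/

section PreLie
variable {A : Type*} [AddCommGroup A] [Module ℂ A] [Module (Polynomial ℂ) A]
  [IsScalarTower ℂ (Polynomial ℂ) A] {m n k p q s : ℕ}

theorem first_ins {N : ℕ} (h : m + n = p) (f : CMap m A A) (g : CMap n A A) {κ : Expr N}
    {G : A →ₗ[ℂ] Val N A} (hG : IsConf κ G) (x : Expr N) (r : Fin p → Expr N × A)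
    (hs : x + ∑ i, (r i).1 = -κ) :
    first (ins h f g) G x r =
      first g (first f G (x + ∑ i : Fin n, (r ⟨i.val, by omega⟩).1)
        (fun j : Fin m => r ⟨n + j.val, by omega⟩)) x (fun i : Fin n => r ⟨i.val, by omega⟩) := by
  ext1 b
  rw [first_apply, first_apply, Φ_ins h f g hG _ (by rw [Fin.sum_univ_succ]; simpa using hs)]
  have e1 : ∀ j : Fin m, Fin.cons (α := fun _ => Expr N × A) (x, b) r (tailIx h j) =
      r ⟨n + j.val, by omega⟩ := by
    intro j
    have : tailIx h j = Fin.succ ⟨n + j.val, by omega⟩ := Fin.ext (by simp [tailIx]; omega)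
    rw [this, Fin.cons_succ]
  have e2 : (fun i : Fin (n + 1) => Fin.cons (α := fun _ => Expr N × A) (x, b) r (headIx h i)) =
      Fin.cons (α := fun _ => Expr N × A) (x, b) (fun i : Fin n => r ⟨i.val, by omega⟩) := by
    funext i
    refine Fin.cases rfl (fun i => rfl) i
  have e3 := congrArg (fun z : Fin (n + 1) → Expr N × A => ∑ i, (z i).1) e2
  simp only [Fin.sum_univ_succ (n := n), Fin.cons_zero, Fin.cons_succ] at e3
  rw [e2, Fin.sum_univ_succ, e3]
  simp only [e1]

/-- At points both sides unfold to the same nesting: h inside g inside f. The numbers of arguments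
are variables linked by equations, so that both sides have literally the same type. -/
theorem ins_assoc (h1 : m + n = p) (h2 : p + k = q) (h3 : n + k = s) (h4 : m + s = q)
    {f : CMap m A A} (hf : Sesq f) (g : CMap n A A) (h : CMap k A A) :
    ins h2 (ins h1 f g) h = ins h4 f (ins h3 g h) := by
  refine cmap_ext fun a => ?_
  have hw := sum_places h2 (fun j => (pts a j).1)
  rw [sum_pts_one] at hw
  have hw' := sum_places h4 (fun j => (pts a j).1)
  rw [sum_pts_one] at hw'
  rw [Φ_ins h2 _ _ (isConf_cst q) _ (sum_pts_one a), Φ_ins h4 _ _ (isConf_cst q) _ (sum_pts_one a),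
    Φ_ins h3 _ _ (isConf_first hf (isConf_cst q) _ _ hw'.symm),
    first_ins h1 f g (isConf_cst q) _ _ hw.symm]
  · have e0 := sum_places h3 (fun i => (pts a (headIx h4 i)).1)
    rw [e0]
    have e1 : ∀ j : Fin m, tailIx h2 ⟨n + j.val, by omega⟩ = tailIx h4 j :=
      fun j => Fin.ext (by simp only [tailIx]; omega)
    simp only [e1]
    rfl
  · simp

/-- The permutation that moves the place after the first `n + 1` to the front. -/
def frontPerm (h : m + 1 + n = p) : Equiv.Perm (Fin (p + 1)) :=
  blockPerm (show m + (n + 1) = p by omega) (finRotate (n + 2)) 1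

theorem sign_frontPerm (h : m + 1 + n = p) :
    Equiv.Perm.sign (frontPerm h) = (-1) ^ (n + 1) := by
  rw [frontPerm, sign_blockPerm, sign_finRotate]; simp

theorem frontPerm_head (h : m + 1 + n = p) (i : Fin (n + 1)) :
    frontPerm h (headIx h i) = Fin.succ ⟨i.val, by omega⟩ := by
  have e : headIx h i = headIx (show m + (n + 1) = p by omega) i.castSucc := rfl
  rw [e, frontPerm, blockPerm_head, finRotate_apply]
  ext
  simp [headIx]

theorem frontPerm_tail_zero (h : m + 1 + n = p) : frontPerm h (tailIx h 0) = 0 := by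
  have e : tailIx h 0 = headIx (show m + (n + 1) = p by omega) (Fin.last (n + 1)) := rfl
  rw [e, frontPerm, blockPerm_head, finRotate_apply]
  ext
  simp [headIx]

theorem frontPerm_tail_succ (h : m + 1 + n = p) (j : Fin m) :
    frontPerm h (tailIx h j.succ) = Fin.succ ⟨n + 1 + j.val, by omega⟩ := by
  have e : tailIx h j.succ = tailIx (show m + (n + 1) = p by omega) j :=
    Fin.ext (by simp [tailIx]; omega)
  rw [e, frontPerm, blockPerm_tail]
  ext
  simp [tailIx]; omega

theorem sum_tail {N : ℕ} (h : m + 1 + n = N) {R : Type*} [AddCommMonoid R] (w : Fin N → R) :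
    ∑ i, w i = ∑ i : Fin (n + 1), w ⟨i.val, by omega⟩ +
      ∑ j : Fin m, w ⟨n + 1 + j.val, by omega⟩ := by
  subst h
  have e : n + 1 + m = m + 1 + n := by omega
  rw [← Fin.sum_congr' w e, Fin.sum_univ_add]
  rfl

/-- The value of `f(g(y), h(x), z)`. -/
theorem Φ_ins_frontPerm (h1 : m + 1 + n = p) (h2 : p + k = q) (f : CMap (m + 1) A A)
    (g : CMap n A A) (h : CMap k A A) {N : ℕ} {κ : Expr N} {G : A →ₗ[ℂ] Val N A} (hG : IsConf κ G)
    (z : Fin (q + 1) → Expr N × A) (hz : ∑ i, (z i).1 = -κ) :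
    ∃ H : A →ₗ[ℂ] Val N A,
      (∀ b, H b = Φ g (first f G (∑ i : Fin (n + 1), (z ⟨k + 1 + i.val, by omega⟩).1)
        (Fin.cons (α := fun _ => Expr N × A) (∑ i : Fin (k + 1), (z ⟨i.val, by omega⟩).1, b)
          (fun j : Fin m => z ⟨k + 1 + (n + 1 + j.val), by omega⟩)))
        (fun i : Fin (n + 1) => z ⟨k + 1 + i.val, by omega⟩)) ∧
      Φ (ins h2 (perm (frontPerm h1) (ins h1 f g)) h) G z =
        Φ h H (fun i : Fin (k + 1) => z ⟨i.val, by omega⟩) := by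
  have hw := sum_places h2 (fun j => (z j).1)
  rw [hz] at hw
  refine ⟨first (perm (frontPerm h1) (ins h1 f g)) G (∑ i, (z (headIx h2 i)).1)
      (fun j => z (tailIx h2 j)), fun b => ?_, ?_⟩
  · have hs : ∑ i, (Fin.cons (α := fun _ => Expr N × A) (∑ i, (z (headIx h2 i)).1, b)
        (fun j => z (tailIx h2 j)) i).1 = -κ := by
      rw [Fin.sum_univ_succ]; simpa using hw.symm
    rw [first_apply, Φ_perm _ _ hG _ hs, Φ_ins h1 _ _ hG]
    · simp only [frontPerm_head, Fin.cons_succ]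
      have : (fun j => Fin.cons (α := fun _ => Expr N × A) (∑ i, (z (headIx h2 i)).1, b)
          (fun j => z (tailIx h2 j)) (frontPerm h1 (tailIx h1 j))) =
          Fin.cons (α := fun _ => Expr N × A) (∑ i : Fin (k + 1), (z ⟨i.val, by omega⟩).1, b)
          (fun j : Fin m => z ⟨k + 1 + (n + 1 + j.val), by omega⟩) := by
        funext j
        refine Fin.cases ?_ (fun j => ?_) j
        · rw [frontPerm_tail_zero, Fin.cons_zero, Fin.cons_zero]; rfl
        · rw [frontPerm_tail_succ, Fin.cons_succ, Fin.cons_succ]; rfl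
      rw [this]
      rfl
    · exact (Equiv.sum_comp (frontPerm h1) _).trans hs
  · rw [Φ_ins h2 _ _ hG _ hz]
    rfl

/-- The transposition of the first two places, with both slots displayed. It exchanges two inserted
cochains, and it also yields linearity in the second slot. -/
theorem first_skew {N : ℕ} {f : CMap (m + 1) A A} (hf : f ∈ Cochain (m + 1) A A) {κ : Expr N}
    {G : A →ₗ[ℂ] Val N A} (hG : IsConf κ G) (x y : Expr N) (r : Fin m → Expr N × A)
    (hs : x + (y + ∑ i, (r i).1) = -κ) (b c : A) :
    first f G x (Fin.cons (α := fun _ => Expr N × A) (y, b) r) c =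
      -first f G y (Fin.cons (α := fun _ => Expr N × A) (x, c) r) b := by
  rw [mem_cochain_iff] at hf
  have e := hf.2 (Equiv.swap 0 1)
  rw [sperm_apply, Equiv.Perm.sign_swap (by simp)] at e
  have e' : perm (Equiv.swap 0 1) f = -f := by
    rw [Units.val_neg, Units.val_one, neg_smul, one_smul] at e
    exact neg_eq_iff_eq_neg.1 e
  have e2 : ∀ z, Φ (-f) G z = -Φ f G z := fun z => by
    simp only [Φ]; rw [← map_neg]; rfl
  rw [first_apply, first_apply, ← e2, ← e', Φ_perm _ _ hG]
  · congr 1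
    funext i
    refine Fin.cases ?_ (fun i => Fin.cases ?_ (fun i => ?_) i) i
    · rw [Equiv.swap_apply_left]; rfl
    · rw [show Fin.succ (0 : Fin (m + 1)) = 1 from rfl, Equiv.swap_apply_right]; rfl
    · rw [Equiv.swap_apply_of_ne_of_ne (Fin.succ_ne_zero _)
        (show i.succ.succ ≠ 1 from fun h => Fin.succ_ne_zero i (Fin.succ_injective (m + 1) h))]
      rfl
  · simp only [Fin.sum_univ_succ, Fin.cons_zero, Fin.cons_succ]
    rw [← hs]; ring

/-- The exchange of the first `k + 1` places and the following `n + 1` places. -/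
def swapBlocks (n k : ℕ) (h : m + (n + k + 1) = q) : Equiv.Perm (Fin (q + 1)) :=
  blockPerm h (finRotate (n + k + 1 + 1) ^ (k + 1)) 1

theorem sign_swapBlocks (n k : ℕ) (h : m + (n + k + 1) = q) :
    Equiv.Perm.sign (swapBlocks n k h) = (-1) ^ ((n + k + 1) * (k + 1)) := by
  rw [swapBlocks, sign_blockPerm, map_pow, sign_finRotate, ← pow_mul]; simp

theorem finRotate_pow_val (N j : ℕ) (i : Fin (N + 1)) :
    ((finRotate (N + 1) ^ j) i).val = (i.val + j) % (N + 1) := by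
  induction j with
  | zero => simp [Nat.mod_eq_of_lt i.2]
  | succ j ih =>
    rw [pow_succ', Equiv.Perm.mul_apply, finRotate_apply, Fin.val_add, ih, Fin.val_one',
      ← Nat.add_mod, add_assoc]

theorem swapBlocks_left (n k : ℕ) (h : m + (n + k + 1) = q) (i : Fin (n + 1)) :
    swapBlocks n k h ⟨i.val, by omega⟩ = ⟨k + 1 + i.val, by omega⟩ := by
  have e : (⟨i.val, by omega⟩ : Fin (q + 1)) = headIx h ⟨i.val, by omega⟩ := rfl
  rw [e, swapBlocks, blockPerm_head]
  ext
  simp only [headIx, finRotate_pow_val]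
  rw [Nat.mod_eq_of_lt] <;> omega

theorem swapBlocks_right (n k : ℕ) (h : m + (n + k + 1) = q) (i : Fin (k + 1)) :
    swapBlocks n k h ⟨n + 1 + i.val, by omega⟩ = ⟨i.val, by omega⟩ := by
  have e : (⟨n + 1 + i.val, by omega⟩ : Fin (q + 1)) = headIx h ⟨n + 1 + i.val, by omega⟩ := rfl
  rw [e, swapBlocks, blockPerm_head]
  ext
  simp only [headIx, finRotate_pow_val]
  rw [Nat.mod_eq_sub_mod (by omega), Nat.mod_eq_of_lt] <;> omega

theorem swapBlocks_rest (n k : ℕ) (h : m + (n + k + 1) = q) (i : Fin m) :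
    swapBlocks n k h ⟨n + 1 + (k + 1 + i.val), by omega⟩ =
      ⟨k + 1 + (n + 1 + i.val), by omega⟩ := by
  have e : (⟨n + 1 + (k + 1 + i.val), by omega⟩ : Fin (q + 1)) = tailIx h i :=
    Fin.ext (by simp only [tailIx]; omega)
  rw [e, swapBlocks, blockPerm_tail]
  ext
  simp only [tailIx, Equiv.Perm.coe_one, id]
  omega

/-- Both sides are f with g and h in its first two slots. Exchanging the slots gives the sign, by
`first_skew`; that g and h may be inserted in either order is `extend_fubini`. -/
theorem ins_frontPerm_symm (h1 : m + 1 + n = p) (h2 : p + k = q) (h1' : m + 1 + k = s)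
    (h2' : s + n = q) (h5 : m + (n + k + 1) = q) {f : CMap (m + 1) A A}
    (hf : f ∈ Cochain (m + 1) A A) (g : CMap n A A) (h : CMap k A A) :
    ins h2 (perm (frontPerm h1) (ins h1 f g)) h =
      -perm (swapBlocks n k h5) (ins h2' (perm (frontPerm h1') (ins h1' f h)) g) := by
  have hf' := (mem_cochain_iff f).1 hf
  refine cmap_ext fun a => ?_
  have eneg : ∀ F : CMap q A A, Φ (-F) (cst q A) (pts a) = -Φ F (cst q A) (pts a) := fun F => by
    rw [Φ_pts, Φ_pts]; rfl
  rw [eneg, Φ_perm _ _ (isConf_cst q) _ (sum_pts_one a)]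
  have hsum := sum_places h2 (fun i => (pts a i).1)
  rw [sum_pts_one, sum_tail h1] at hsum
  obtain ⟨H, hH, e⟩ := Φ_ins_frontPerm h1 h2 f g h (isConf_cst q) (pts a) (sum_pts_one a)
  obtain ⟨H', hH', e'⟩ := Φ_ins_frontPerm h1' h2' f h g (isConf_cst q)
    (fun i => pts a (swapBlocks n k h5 i)) (sum_pts a _)
  rw [e, e']
  simp only [swapBlocks_left, swapBlocks_right, swapBlocks_rest] at hH' ⊢
  clear e e' eneg
  set z := pts a with hz
  set SA := ∑ i : Fin (k + 1), (z ⟨i.val, by omega⟩).1 with hSA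
  set SB := ∑ i : Fin (n + 1), (z ⟨k + 1 + i.val, by omega⟩).1 with hSB
  set zC : Fin m → Expr q × A := fun j => z ⟨k + 1 + (n + 1 + j.val), by omega⟩ with hzC
  have hs : SB + (SA + ∑ i, (zC i).1) = -dv := by
    rw [hsum, add_left_comm]; rfl
  have hsk := first_skew hf (isConf_cst q) SB SA zC hs
  -- The variable b sits in the second slot, so linearity in it is read off after exchanging the
  -- slots.
  let F : A →ₗ[ℂ] A →ₗ[ℂ] Val q A := LinearMap.mk₂ ℂ
    (fun b c => first f (cst q A) SB (Fin.cons (α := fun _ => Expr q × A) (SA, b) zC) c)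
    (fun b b' c => by simp only [hsk, map_add, neg_add])
    (fun x b c => by simp only [hsk, map_smul, smul_neg])
    (fun b c c' => map_add _ _ _) (fun x b c => map_smul _ _ _)
  have eF : ∀ b, F b = first f (cst q A) SB (Fin.cons (α := fun _ => Expr q × A) (SA, b) zC) :=
    fun b => LinearMap.ext fun c => rfl
  have eF' : ∀ c, F.flip c =
      -first f (cst q A) SA (Fin.cons (α := fun _ => Expr q × A) (SB, c) zC) :=
    fun c => LinearMap.ext fun b => hsk b c
  refine (extend_fubini _ (fun i : Fin n => (z ⟨k + 1 + i.castSucc.val, by omega⟩).1) F _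
    (g fun i => (z ⟨k + 1 + i.val, by omega⟩).2) H (-H') (fun b => ?_) (fun c => ?_)).trans ?_
  · rw [hH, eF]; rfl
  · rw [eF', LinearMap.neg_apply, hH', extend_neg_right]; rfl
  · rw [extend_neg_right]; rfl

/-- A permutation fixing 0 does not disturb the slot taken by h. It extends to a block permutation
of the composite, which `alt` absorbs. -/
theorem alt_ins_sperm_of_fix_zero (h2 : p + k = q) (F : CMap p A A) (h : CMap k A A)
    {u : Equiv.Perm (Fin (p + 1))} (hu : u 0 = 0) :
    alt (ins h2 (sperm u F) h) = alt (ins h2 F h) := by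
  obtain ⟨w, hw, hs⟩ := exists_of_fix_zero u hu
  have : ins h2 (sperm u F) h = sperm (blockPerm h2 1 w) (ins h2 F h) := by
    rw [sperm_apply, sperm_apply, ← insL_apply h2 (_ • _), map_zsmul, LinearMap.smul_apply,
      insL_apply, ins_perm_left h2 F h hu hw, sign_blockPerm, map_one, one_mul, hs]
  rw [this, alt_sperm]

/-- The factorials turn g ⋄ h into a sum over (s+1)! signed permutations. Each is a block
permutation of the composite and is absorbed by `alt`, so all summands agree. -/
theorem ins_circ_right (h3 : n + k = s) (h4 : m + s = q) {f : CMap m A A} (hf : Sesq f)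
    {g h} (hg : g ∈ Cochain n A A) (hh : h ∈ Cochain k A A) :
    ((k + 1).factorial * n.factorial) • alt (ins h4 f (circ h3 g h)) =
      (s + 1).factorial • alt (ins h4 f (ins h3 g h)) := by
  rw [← map_nsmul, ← insL_apply, ← map_nsmul, factorial_smul_circ h3 hg hh, alt_apply (ins h3 g h), map_sum,
    map_sum]
  have : ∀ v : Equiv.Perm (Fin (s + 1)), alt (insL h4 f (sperm v (ins h3 g h))) =
      alt (ins h4 f (ins h3 g h)) := by
    intro v
    have : insL h4 f (sperm v (ins h3 g h)) =
        sperm (blockPerm h4 v 1) (ins h4 f (ins h3 g h)) := by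
      rw [sperm_apply, sperm_apply, map_zsmul, insL_apply, ins_perm_right h4 hf,
        sign_blockPerm, map_one, mul_one]
    rw [this, alt_sperm]
  simp only [this, Finset.sum_const, Finset.card_univ, Fintype.card_perm, Fintype.card_fin]

theorem circ_circ_right (h3 : n + k = s) (h4 : m + s = q) {f g h} (hf : f ∈ Cochain m A A)
    (hg : g ∈ Cochain n A A) (hh : h ∈ Cochain k A A) :
    ((k + 1).factorial * n.factorial * m.factorial) • circ h4 f (circ h3 g h) =
      alt (ins h4 f (ins h3 g h)) := by
  refine nsmul_cancel (k := (s + 1).factorial) (by positivity) ?_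
  rw [← ins_circ_right h3 h4 ((mem_cochain_iff f).1 hf).1 hg hh,
    ← factorial_smul_circ h4 hf (circ_mem h3 hg hh), smul_smul, smul_smul]
  congr 1
  ring

/-- The antisymmetrization of `f(g(y), h(x), z)`. -/
def twoIns (h1 : m + 1 + n = p) (h2 : p + k = q) (f : CMap (m + 1) A A) (g : CMap n A A)
    (h : CMap k A A) : CMap q A A := alt (ins h2 (sperm (frontPerm h1) (ins h1 f g)) h)

theorem twoIns_eq (h1 : m + 1 + n = p) (h2 : p + k = q) (f : CMap (m + 1) A A) (g : CMap n A A)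
    (h : CMap k A A) : twoIns h1 h2 f g h =
      (-1 : ℤ) ^ (n + 1) • alt (ins h2 (perm (frontPerm h1) (ins h1 f g)) h) := by
  rw [twoIns, sperm_apply, sign_frontPerm, ← insL_apply h2 (_ • _), map_zsmul, LinearMap.smul_apply,
    map_zsmul]
  simp

/-- The sign collects those of the two `frontPerm`, that of `swapBlocks`, and the one from the
skewness of f. -/
theorem twoIns_symm (h1 : m + 1 + n = p) (h2 : p + k = q) (h1' : m + 1 + k = s)
    (h2' : s + n = q) {f : CMap (m + 1) A A}
    (hf : f ∈ Cochain (m + 1) A A) (g : CMap n A A) (h : CMap k A A) :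
    twoIns h1 h2 f g h = (-1 : ℤ) ^ (n * k) • twoIns h1' h2' f h g := by
  have h5 : m + (n + k + 1) = q := by omega
  have e := ins_frontPerm_symm h1 h2 h1' h2' h5 hf g h
  have hsg : ∀ X : CMap q A A, perm (swapBlocks n k h5) X =
      (-1 : ℤ) ^ ((n + k + 1) * (k + 1)) • sperm (swapBlocks n k h5) X := by
    intro X
    rw [sperm_apply, sign_swapBlocks, smul_smul]
    simp [← mul_pow]
  rw [twoIns_eq, twoIns_eq, e, hsg, map_neg, map_zsmul, alt_sperm, ← neg_smul, smul_smul, smul_smul]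
  congr 1
  have hp : ∀ a b : ℕ, (-1 : ℤ) ^ a * -(-1) ^ b = (-1) ^ (a + b + 1) := fun a b => by ring
  rw [← pow_add, hp]
  refine (neg_one_pow_congr ?_)
  simp only [Nat.even_add, Nat.even_mul, Nat.even_add_one]
  tauto

/-- Expand f ⋄ g over all permutations u. The summand depends only on u⁻¹ 0, the argument of the
composite f(g(…), …) that receives h. Of these arguments n + 1 belong to g and give f(g(h)), the
other m + 1 belong to f and give `twoIns`. -/
theorem circ_circ_left (h1 : m + 1 + n = p) (h2 : p + k = q) {f g h}
    (hf : f ∈ Cochain (m + 1) A A) (hg : g ∈ Cochain n A A) (hh : h ∈ Cochain k A A) :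
    ((k + 1).factorial * (n + 1).factorial * (m + 1).factorial) • circ h2 (circ h1 f g) h =
      (n + 1) • alt (ins h2 (ins h1 f g) h) + (m + 1) • twoIns h1 h2 f g h := by
  refine nsmul_cancel (k := p.factorial) (by positivity) ?_
  have e1 : p.factorial • ((k + 1).factorial * (n + 1).factorial * (m + 1).factorial) •
      circ h2 (circ h1 f g) h =
      ((n + 1).factorial * (m + 1).factorial) • alt (ins h2 (circ h1 f g) h) := by
    rw [← factorial_smul_circ h2 (circ_mem h1 hf hg) hh, smul_smul, smul_smul]
    congr 1
    ring
  rw [e1, ← map_nsmul, ← insL_apply, ← LinearMap.smul_apply, ← map_nsmul,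
    factorial_smul_circ h1 hf hg, alt_apply (ins h1 f g), map_sum, LinearMap.sum_apply, map_sum]
  have hb : ∀ (u : Equiv.Perm (Fin (p + 1))) v w,
      alt (ins h2 (sperm u (ins h1 f g)) h) =
        alt (ins h2 (sperm (u * blockPerm h1 v w) (ins h1 f g)) h) := fun u v w => by
    rw [← sperm_sperm, sperm_blockPerm_ins h1 hf hg]
  have ht0 : frontPerm h1 (tailIx h1 0) = 0 := frontPerm_tail_zero h1
  have hhead : ∀ i : Fin (n + 1), (headIx h1 i).val < n + 1 := fun i => i.2
  have htail : ∀ j : Fin (m + 1), ¬ (tailIx h1 j).val < n + 1 := fun j => by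
    simp only [tailIx]; omega
  rw [sum_perm_of_preimage_zero _ (fun j => if j.val < n + 1 then
      alt (ins h2 (ins h1 f g) h) else twoIns h1 h2 f g h)]
  · rw [sum_places h1]
    congr 1
    congr 1
    · simp only [hhead, if_true, Finset.sum_const, Finset.card_univ, Fintype.card_fin]
    · simp only [htail, if_false, Finset.sum_const, Finset.card_univ, Fintype.card_fin]
  · intro u
    simp only [insL_apply]
    obtain ⟨i, hi⟩ | ⟨j, hj⟩ := place_cases h1 (u⁻¹ 0)
    -- The block permutation, which the skewness of g allows, brings argument i of g to the front;
    -- the resulting permutation fixes 0.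
    · rw [hi, if_pos (hhead i), hb u (Equiv.swap 0 i) 1, alt_ins_sperm_of_fix_zero]
      have : (0 : Fin (p + 1)) = headIx h1 0 := rfl
      rw [Equiv.Perm.mul_apply]
      nth_rewrite 1 [this]
      rw [blockPerm_head, Equiv.swap_apply_left, ← hi]
      exact u.apply_symm_apply 0
    · rw [hj, if_neg (htail j), hb u 1 (Equiv.swap 0 j), twoIns]
      -- The chosen argument is first made the leading one of the tail, which `frontPerm` sends to
      -- 0; the factor to the left of `frontPerm` then fixes 0.
      have : u * blockPerm h1 1 (Equiv.swap 0 j) =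
          u * blockPerm h1 1 (Equiv.swap 0 j) * (frontPerm h1)⁻¹ * frontPerm h1 := by group
      rw [this, ← sperm_sperm, alt_ins_sperm_of_fix_zero]
      have e0 : (frontPerm h1)⁻¹ 0 = tailIx h1 0 := by rw [Equiv.Perm.inv_eq_iff_eq, ht0]
      rw [Equiv.Perm.mul_apply, Equiv.Perm.mul_apply, e0, blockPerm_tail, Equiv.swap_apply_left,
        ← hj]
      exact u.apply_symm_apply 0

/-- Here f has a single argument, which g occupies, so there is no term with h in another slot of f.
-/
theorem circ_circ_left_zero (h1 : 0 + n = p) (h2 : p + k = q) {f g h}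
    (hf : f ∈ Cochain 0 A A) (hg : g ∈ Cochain n A A) (hh : h ∈ Cochain k A A) :
    ((k + 1).factorial * (n + 1).factorial) • circ h2 (circ h1 f g) h =
      (n + 1) • alt (ins h2 (ins h1 f g) h) := by
  refine nsmul_cancel (k := p.factorial) (by positivity) ?_
  have e1 : p.factorial • ((k + 1).factorial * (n + 1).factorial) •
      circ h2 (circ h1 f g) h =
      ((n + 1).factorial * (0).factorial) • alt (ins h2 (circ h1 f g) h) := by
    rw [← factorial_smul_circ h2 (circ_mem h1 hf hg) hh, smul_smul, smul_smul]
    congr 1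
    simp
    ring
  rw [e1, ← map_nsmul, ← insL_apply, ← LinearMap.smul_apply, ← map_nsmul,
    factorial_smul_circ h1 hf hg, alt_apply (ins h1 f g), map_sum, LinearMap.sum_apply, map_sum]
  obtain rfl : n = p := by omega
  have hb : ∀ u : Equiv.Perm (Fin (n + 1)), sperm u (ins h1 f g) = ins h1 f g := fun u => by
    have := sperm_blockPerm_ins h1 hf hg u 1
    rwa [show blockPerm h1 u 1 = u from perm_ext_places h1 (fun i => by
      rw [blockPerm_head]; rfl) (fun i => i.elim0)] at this
  simp only [hb, insL_apply, Finset.sum_const, Finset.card_univ, Fintype.card_perm, Fintype.card_fin,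
    smul_smul, Nat.factorial_succ, mul_comm]

/-- The pre-Lie identity. -/
theorem circ_preLie (h1 : m + n = p) (h2 : p + k = q) (h3 : n + k = s) (h4 : m + s = q)
    {r t : ℕ} (h1' : m + k = r) (h2' : r + n = q) (h3' : k + n = t) (h4' : m + t = q)
    {f g h} (hf : f ∈ Cochain m A A) (hg : g ∈ Cochain n A A) (hh : h ∈ Cochain k A A) :
    circ h2 (circ h1 f g) h - circ h4 f (circ h3 g h) =
      (-1 : ℤ) ^ (n * k) •
        (circ h2' (circ h1' f h) g - circ h4' f (circ h3' h g)) := by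
  have hf' := ((mem_cochain_iff f).1 hf).1
  have a1 := ins_assoc h1 h2 h3 h4 hf' g h
  have a2 := ins_assoc h1' h2' h3' h4' hf' h g
  have b1 := circ_circ_right h3 h4 hf hg hh
  have b2 := circ_circ_right h3' h4' hf hh hg
  rw [← a1] at b1
  rw [← a2] at b2
  have hfac : ((k + 1).factorial * (n + 1).factorial * m.factorial) ≠ 0 := by positivity
  refine nsmul_cancel hfac ?_
  have b1' : ((k + 1).factorial * (n + 1).factorial * m.factorial) • circ h4 f (circ h3 g h) =
      (n + 1) • alt (ins h2 (ins h1 f g) h) := by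
    rw [← b1, smul_smul, Nat.factorial_succ n]; congr 1; ring
  have b2' : ((k + 1).factorial * (n + 1).factorial * m.factorial) • circ h4' f (circ h3' h g) =
      (k + 1) • alt (ins h2' (ins h1' f h) g) := by
    rw [← b2, smul_smul, Nat.factorial_succ k]; congr 1; ring
  rw [smul_sub, smul_comm _ ((-1 : ℤ) ^ (n * k)), smul_sub, b1', b2']
  -- The nested terms cancel on each side. What is left is a multiple of `twoIns`, or 0 if f has
  -- only one argument.
  cases m with
  | zero =>
    have c1 := circ_circ_left_zero h1 h2 hf hg hh
    have c2 := circ_circ_left_zero h1' h2' hf hh hg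
    rw [mul_comm] at c2
    rw [Nat.factorial_zero, mul_one, c1, c2]
    simp
  | succ m =>
    have c1 := circ_circ_left h1 h2 hf hg hh
    have c2 := circ_circ_left h1' h2' hf hh hg
    rw [mul_comm (n + 1).factorial] at c2
    rw [c1, c2, add_sub_cancel_left, add_sub_cancel_left, twoIns_symm h1 h2 h1' h2' hf,
      smul_comm]

end PreLie

/-! ### Derived brackets in an abstract graded Lie algebra -/

/-- A graded Lie algebra `𝔤` with a projection `P` onto an abelian subalgebra, the kernel of which
is a subalgebra as well, and an element `Δ` of degree `1` in the kernel with `[Δ, Δ] = 0`. -/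
structure DerivedData (𝔤 : Type*) [AddCommGroup 𝔤] [Module ℂ 𝔤] where
  br : 𝔤 →ₗ[ℂ] 𝔤 →ₗ[ℂ] 𝔤
  G : ℕ → Submodule ℂ 𝔤
  K : 𝔤 →ₗ[ℂ] 𝔤
  P : 𝔤 →ₗ[ℂ] 𝔤
  Δ : 𝔤
  br_mem : ∀ {m n x y}, x ∈ G m → y ∈ G n → br x y ∈ G (m + n)
  skew : ∀ {m n x y}, x ∈ G m → y ∈ G n → br x y = -((-1 : ℤ) ^ (m * n) • br y x)
  jacobi : ∀ {m n k x y z}, x ∈ G m → y ∈ G n → z ∈ G k →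
    br (br x y) z = br x (br y z) + (-1 : ℤ) ^ (n * k) • br (br x z) y
  K_apply : ∀ {n x}, x ∈ G n → K x = (-1 : ℤ) ^ n • x
  P_mem : ∀ {n x}, x ∈ G n → P x ∈ G n
  P_P : ∀ x, P (P x) = P x
  br_P_P : ∀ x y, br (P x) (P y) = 0
  P_br : ∀ x y, P (br (x - P x) (y - P y)) = 0
  Δ_mem : Δ ∈ G 1
  br_Δ : br Δ Δ = 0
  P_Δ : P Δ = 0

namespace DerivedData
variable {𝔤 : Type*} [AddCommGroup 𝔤] [Module ℂ 𝔤] (V : DerivedData 𝔤)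

/-- `y ↦ (-1)^|y| [y, a]`. -/
def T (a : 𝔤) : 𝔤 →ₗ[ℂ] 𝔤 := V.br.flip a ∘ₗ V.K

theorem T_apply {n : ℕ} {y : 𝔤} (hy : y ∈ V.G n) (a : 𝔤) :
    V.T a y = (-1 : ℤ) ^ n • V.br y a := by
  rw [T, LinearMap.comp_apply, V.K_apply hy, map_zsmul]
  rfl

theorem T_mem {m n : ℕ} {a y : 𝔤} (ha : a ∈ V.G m) (hy : y ∈ V.G n) : V.T a y ∈ V.G (n + m) := by
  rw [V.T_apply hy]
  exact zsmul_mem (V.br_mem hy ha) _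

/-- This is the Jacobi identity, in which the term with [b, a] vanishes because the image of P is
abelian. The sign is that of skew-symmetry in degrees m + 1 and n + 1, which accounts for the shift
of degrees. -/
theorem T_T {m n j : ℕ} {a b y : 𝔤} (ha : a ∈ V.G m) (hb : b ∈ V.G n) (hy : y ∈ V.G j)
    (ha' : V.P a = a) (hb' : V.P b = b) :
    V.T a (V.T b y) = (-1 : ℤ) ^ (1 + (m + 1) * (n + 1)) • V.T b (V.T a y) := by
  rw [V.T_apply (V.T_mem hb hy), V.T_apply hy, V.T_apply (V.T_mem ha hy), V.T_apply hy,
    map_zsmul, map_zsmul, LinearMap.smul_apply, LinearMap.smul_apply, V.jacobi hy hb ha, ← ha', ← hb',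
    V.br_P_P, map_zero, zero_add]
  simp only [smul_smul, ← pow_add]
  congr 1
  refine neg_one_pow_congr ?_
  simp only [Nat.even_add, Nat.even_mul, Nat.even_add_one, Nat.not_even_one]
  tauto

theorem T_br {i j m : ℕ} {X Y a : 𝔤} (hX : X ∈ V.G i) (hY : Y ∈ V.G j) (ha : a ∈ V.G m) :
    V.T a (V.br X Y) = (-1 : ℤ) ^ i • V.br X (V.T a Y) +
      (-1 : ℤ) ^ (j * (m + 1)) • V.br (V.T a X) Y := by
  rw [V.T_apply (V.br_mem hX hY), V.T_apply hX, V.T_apply hY, V.jacobi hX hY ha, map_zsmul,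
    map_zsmul, LinearMap.smul_apply, smul_add]
  simp only [smul_smul, ← pow_add]
  congr 2
  refine neg_one_pow_congr ?_
  simp only [Nat.even_add, Nat.even_mul, Nat.even_add_one]
  tauto

/-- The operators `T (x i)` with `i < n` and `c i` applied to `X`, in increasing order of `i`. -/
def W (x : ℕ → 𝔤) (c : ℕ → Prop) [DecidablePred c] (X : 𝔤) : ℕ → 𝔤
  | 0 => X
  | n + 1 => if c n then V.T (x n) (W x c X n) else W x c X n

end DerivedData

/-- The sum of the `d i` with `i < n` and `c i`. -/
def dsum (d : ℕ → ℕ) (c : ℕ → Prop) [DecidablePred c] (n : ℕ) : ℕ :=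
  ∑ i ∈ Finset.range n, if c i then d i else 0

theorem dsum_succ (d : ℕ → ℕ) (c : ℕ → Prop) [DecidablePred c] (n : ℕ) :
    dsum d c (n + 1) = dsum d c n + if c n then d n else 0 := Finset.sum_range_succ _ _

/-- The sign in the derivation rule for `T (x (n-1)) ⋯ T (x 0) [X, Y]`, `X` and `Y` of degree 1. -/
def leibnizSign (d : ℕ → ℕ) (c : ℕ → Prop) [DecidablePred c] : ℕ → ℤ
  | 0 => 1
  | n + 1 => leibnizSign d c n * if c n then (-1) ^ (1 + dsum d (fun i => ¬ c i) n)
      else (-1) ^ ((1 + dsum d c n) * (d n + 1))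

/-- The sign of the summand of the higher Jacobi identity that belongs to `c`. -/
def jacobiSign (d : ℕ → ℕ) (c : ℕ → Prop) [DecidablePred c] : ℕ → ℤ
  | 0 => 1
  | n + 1 => jacobiSign d c n * if c n then -∏ b ∈ Finset.range n, if c b then 1 else
      -(-1) ^ ((d b + 1) * (d n + 1)) else 1

theorem dsum_congr (d : ℕ → ℕ) {c c' : ℕ → Prop} [DecidablePred c] [DecidablePred c'] {n : ℕ}
    (h : ∀ i < n, (c i ↔ c' i)) : dsum d c n = dsum d c' n :=
  Finset.sum_congr rfl fun i hi => if_congr (h i (Finset.mem_range.1 hi)) rfl rfl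

theorem leibnizSign_congr (d : ℕ → ℕ) {c c' : ℕ → Prop} [DecidablePred c] [DecidablePred c']
    {n : ℕ} (h : ∀ i < n, (c i ↔ c' i)) : leibnizSign d c n = leibnizSign d c' n := by
  induction n with
  | zero => rfl
  | succ n ih =>
    have h' : ∀ i < n, (c i ↔ c' i) := fun i hi => h i (by omega)
    rw [leibnizSign, leibnizSign, ih h', dsum_congr d h',
      dsum_congr d (fun i hi => not_congr (h' i hi)), if_congr (h n (by omega)) rfl rfl]

theorem neg_one_pow_mul_self (a : ℕ) : (-1 : ℤ) ^ a * (-1) ^ a = 1 := by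
  rw [← mul_pow]; simp

/-- Complementing c exchanges the roles of the two factors, which have degrees 1 + `dsum`. The two
signs differ by that of graded skewness. -/
theorem leibnizSign_compl (d : ℕ → ℕ) (c : ℕ → Prop) [DecidablePred c] (n : ℕ) :
    leibnizSign d (fun i => ¬ c i) n = leibnizSign d c n *
      -(-1) ^ ((1 + dsum d c n) * (1 + dsum d (fun i => ¬ c i) n)) := by
  induction n with
  | zero => simp [leibnizSign, dsum]
  | succ n ih =>
    have e : dsum d (fun i => ¬ ¬ c i) n = dsum d c n := dsum_congr d fun i _ => not_not
    rw [leibnizSign, leibnizSign, ih, e, dsum_succ, dsum_succ]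
    by_cases h : c n
    · simp only [h, if_true, not_true_eq_false, if_false, mul_neg, neg_mul, mul_assoc, ← pow_add]
      congr 2
      refine neg_one_pow_congr ?_
      simp only [Nat.even_add, Nat.even_mul, Nat.even_add_one, Nat.not_even_one]
      tauto
    · simp only [h, if_true, not_false_eq_true, if_false, mul_neg, neg_mul, mul_assoc, ← pow_add]
      congr 2
      refine neg_one_pow_congr ?_
      simp only [Nat.even_add, Nat.even_mul, Nat.even_add_one, Nat.not_even_one]
      tauto

theorem prod_sign (d : ℕ → ℕ) (c : ℕ → Prop) [DecidablePred c] (n e : ℕ) :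
    (∏ b ∈ Finset.range n, if c b then (1 : ℤ) else -(-1) ^ ((d b + 1) * e)) =
      (-1) ^ (dsum (fun _ => 1) (fun i => ¬ c i) n +
        (dsum (fun _ => 1) (fun i => ¬ c i) n + dsum d (fun i => ¬ c i) n) * e) := by
  induction n with
  | zero => simp [dsum]
  | succ n ih =>
    rw [Finset.prod_range_succ, ih, dsum_succ, dsum_succ]
    by_cases h : c n
    · simp [h]
    · simp only [h, if_false, not_false_eq_true, if_true]
      ring

/-- Compares the sign of the Leibniz rule with that of the Jacobi identity. The exponent that
remains is, up to parity, what `W_T` and `T_apply` produce when the inner bracket is moved to the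
first argument; the minus sign is common to all summands. -/
theorem leibnizSign_eq (d : ℕ → ℕ) (c : ℕ → Prop) [DecidablePred c] (n : ℕ) :
    leibnizSign d c n = jacobiSign d c n * -(-1) ^ (dsum (fun _ => 1) (fun i => ¬ c i) n +
      dsum d c n * (dsum (fun _ => 1) (fun i => ¬ c i) n + dsum d (fun i => ¬ c i) n) +
      (1 + dsum d (fun i => ¬ c i) n)) := by
  induction n with
  | zero => simp [leibnizSign, jacobiSign, dsum]
  | succ n ih =>
    rw [leibnizSign, jacobiSign, ih, prod_sign, dsum_succ, dsum_succ, dsum_succ]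
    by_cases h : c n
    · simp only [h, if_true, not_true_eq_false, if_false, mul_neg, neg_mul, mul_assoc, ← pow_add,
        neg_neg]
      rw [← mul_neg, ← mul_neg_one, ← pow_succ]
      congr 1
      generalize dsum (fun _ => 1) (fun i => ¬ c i) n = a, dsum d c n = b,
        dsum d (fun i => ¬ c i) n = e, d n = f
      refine neg_one_pow_congr ?_
      by_cases ha : Even a <;> by_cases hb : Even b <;> by_cases he : Even e <;>
        by_cases hf : Even f <;> simp [Nat.even_add, Nat.even_mul, ha, hb, he, hf]
    · simp only [h, if_true, not_false_eq_true, if_false, mul_neg, neg_mul, mul_assoc, ← pow_add,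
        mul_one]
      congr 2
      generalize dsum (fun _ => 1) (fun i => ¬ c i) n = a, dsum d c n = b,
        dsum d (fun i => ¬ c i) n = e, d n = f
      refine neg_one_pow_congr ?_
      by_cases ha : Even a <;> by_cases hb : Even b <;> by_cases he : Even e <;>
        by_cases hf : Even f <;> simp [Nat.even_add, Nat.even_mul, ha, hb, he, hf]

/-! ### The higher Jacobi identity, indexed by subsets -/

namespace DerivedData
variable {𝔤 : Type*} [AddCommGroup 𝔤] [Module ℂ 𝔤] (V : DerivedData 𝔤)

theorem W_congr (x : ℕ → 𝔤) {c c' : ℕ → Prop} [DecidablePred c] [DecidablePred c'] (X : 𝔤) {n : ℕ}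
    (h : ∀ i < n, (c i ↔ c' i)) : V.W x c X n = V.W x c' X n := by
  induction n with
  | zero => rfl
  | succ n ih =>
    rw [W, W, ih (fun i hi => h i (by omega)), if_congr (h n (by omega)) rfl rfl]

variable {x : ℕ → 𝔤} {d : ℕ → ℕ}

theorem W_mem (hx : ∀ i, x i ∈ V.G (d i)) (c : ℕ → Prop) [DecidablePred c] {X : 𝔤} {j : ℕ}
    (hX : X ∈ V.G j) (n : ℕ) : V.W x c X n ∈ V.G (j + dsum d c n) := by
  induction n with
  | zero => simpa [dsum, W] using hX
  | succ n ih =>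
    rw [W, dsum_succ]
    split_ifs
    · rw [← add_assoc]; exact V.T_mem (hx n) ih
    · simpa using ih

/-- The iterated Leibniz rule: every operator acts on X or on Y, and S records those acting on Y. In
the induction the subsets of the larger range are split by whether they contain n. -/
theorem W_br (hx : ∀ i, x i ∈ V.G (d i)) {X Y : 𝔤} (hX : X ∈ V.G 1) (hY : Y ∈ V.G 1) (n : ℕ) :
    V.W x (fun _ => True) (V.br X Y) n = ∑ S ∈ (Finset.range n).powerset,
      leibnizSign d (· ∈ S) n • V.br (V.W x (· ∉ S) X n) (V.W x (· ∈ S) Y n) := by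
  induction n with
  | zero => simp [W, leibnizSign]
  | succ n ih =>
    rw [W, if_pos trivial, ih, Finset.range_add_one, Finset.sum_powerset_insert
      Finset.notMem_range_self, map_sum, ← Finset.sum_add_distrib]
    refine Finset.sum_congr rfl fun S hS => ?_
    have hn : n ∉ S := fun h => by
      simpa using Finset.mem_powerset.1 hS h
    have hc : ∀ i < n, (i ∈ insert n S ↔ i ∈ S) := fun i hi => by
      simp [Finset.mem_insert, hi.ne]
    have hc' : ∀ i < n, (i ∉ insert n S ↔ i ∉ S) := fun i hi => not_congr (hc i hi)
    rw [map_zsmul, V.T_br (V.W_mem hx (· ∉ S) hX n) (V.W_mem hx (· ∈ S) hY n) (hx n)]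
    simp only [W, leibnizSign, hn, not_false_eq_true, if_true, if_false, Finset.mem_insert_self,
      not_true_eq_false]
    rw [V.W_congr x Y hc, V.W_congr x X hc', leibnizSign_congr d hc, dsum_congr d hc', smul_add,
      smul_smul, smul_smul, add_comm]

/-- Expand `P_br`; the term with two projected factors vanishes because the image of P is abelian.
-/
theorem P_br_eq (u v : 𝔤) :
    V.P (V.br u v) = V.P (V.br (V.P u) v) + V.P (V.br u (V.P v)) := by
  have h := V.P_br u v
  simp only [map_sub, LinearMap.sub_apply, V.br_P_P, map_zero, sub_zero] at h
  rw [sub_sub, sub_eq_zero] at h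
  exact h

/-- Apply all operators and then P to [Δ, Δ] = 0. By `P_br_eq` the result is a sum of two sums,
which are exchanged by S ↦ complement of S together with graded skewness. So twice the sum vanishes.
-/
theorem sum_leibnizSign (hx : ∀ i, x i ∈ V.G (d i)) (n : ℕ) :
    ∑ S ∈ (Finset.range n).powerset, leibnizSign d (· ∈ S) n •
      V.P (V.br (V.W x (· ∉ S) V.Δ n) (V.P (V.W x (· ∈ S) V.Δ n))) = 0 := by
  have h0 : ∀ n, V.W x (fun _ => True) 0 n = 0 := fun n => by
    induction n with
    | zero => rfl
    | succ n ih => simp [W, ih]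
  have h := congrArg V.P (V.W_br hx V.Δ_mem V.Δ_mem n)
  rw [V.br_Δ, h0, map_zero, map_sum] at h
  simp only [map_zsmul] at h
  have e : ∑ S ∈ (Finset.range n).powerset, leibnizSign d (· ∈ S) n •
      V.P (V.br (V.P (V.W x (· ∉ S) V.Δ n)) (V.W x (· ∈ S) V.Δ n)) =
      ∑ S ∈ (Finset.range n).powerset, leibnizSign d (· ∈ S) n •
      V.P (V.br (V.W x (· ∉ S) V.Δ n) (V.P (V.W x (· ∈ S) V.Δ n))) := by
    refine Finset.sum_nbij' (fun S => Finset.range n \ S) (fun S => Finset.range n \ S)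
      (fun S hS => by simp) (fun S hS => by simp)
      (fun S hS => by simpa using Finset.mem_powerset.1 hS)
      (fun S hS => by simpa using Finset.mem_powerset.1 hS) (fun S hS => ?_)
    have hc : ∀ i < n, (i ∈ Finset.range n \ S ↔ i ∉ S) := fun i hi => by simp [hi]
    have hc' : ∀ i < n, (i ∉ Finset.range n \ S ↔ i ∈ S) := fun i hi => by simp [hi]
    rw [leibnizSign_congr d hc, V.W_congr x _ hc, V.W_congr x _ hc', leibnizSign_compl,
      V.skew (V.W_mem hx (· ∈ S) V.Δ_mem n) (V.P_mem (V.W_mem hx (· ∉ S) V.Δ_mem n)),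
      map_neg, map_zsmul, ← neg_smul, smul_smul]
    congr 1
    rw [mul_assoc, neg_mul_neg, neg_one_pow_mul_self, mul_one]
  simp only [V.P_br_eq (V.W x _ _ _) (V.W x _ _ _), smul_add, Finset.sum_add_distrib] at h
  rw [e, ← two_smul ℕ] at h
  exact nsmul_cancel two_ne_zero (by rw [← h, smul_zero])

/-- Repeated use of `T_T`. For y the inner derived bracket, it turns a bracket with y taken last
into one in which y is the first argument. -/
theorem W_T (hx : ∀ i, x i ∈ V.G (d i)) (hx' : ∀ i, V.P (x i) = x i) (c : ℕ → Prop)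
    [DecidablePred c] {X y : 𝔤} {i j : ℕ} (hX : X ∈ V.G i) (hy : y ∈ V.G j) (hy' : V.P y = y)
    (n : ℕ) :
    V.W x c (V.T y X) n = (-1 : ℤ) ^ (dsum (fun _ => 1) c n +
      (j + 1) * (dsum (fun _ => 1) c n + dsum d c n)) • V.T y (V.W x c X n) := by
  induction n with
  | zero => simp [W, dsum]
  | succ n ih =>
    rw [W, W, ih, dsum_succ, dsum_succ]
    by_cases h : c n
    · simp only [h, if_true]
      rw [map_zsmul, V.T_T (hx n) hy (V.W_mem hx c hX n) (hx' n) hy', smul_smul, ← pow_add]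
      congr 1
      refine neg_one_pow_congr ?_
      simp only [Nat.even_add, Nat.even_mul, Nat.even_add_one, Nat.not_even_one]
      tauto
    · simp only [h, if_false, add_zero]

/-- The higher Jacobi identity of derived brackets. -/
theorem sum_jacobiSign (hx : ∀ i, x i ∈ V.G (d i)) (hx' : ∀ i, V.P (x i) = x i) (n : ℕ) :
    ∑ S ∈ (Finset.range n).powerset, jacobiSign d (· ∈ S) n •
      V.P (V.W x (· ∉ S) (V.T (V.P (V.W x (· ∈ S) V.Δ n)) V.Δ) n) = 0 := by
  rw [← neg_eq_zero, ← V.sum_leibnizSign hx n, ← Finset.sum_neg_distrib]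
  refine Finset.sum_congr rfl fun S _ => ?_
  rw [V.W_T hx hx' (· ∉ S) V.Δ_mem (V.P_mem (V.W_mem hx (· ∈ S) V.Δ_mem n)) (V.P_P _),
    V.T_apply (V.W_mem hx (· ∉ S) V.Δ_mem n), map_zsmul, map_zsmul, smul_smul, smul_smul,
    ← neg_smul, leibnizSign_eq]
  congr 1
  rw [mul_assoc, ← pow_add, mul_neg]
  congr 2
  refine neg_one_pow_congr ?_
  simp only [Nat.even_add, Nat.even_mul, Nat.even_add_one, Nat.not_even_one]
  tauto

end DerivedData

/-! ### Unshuffles, subsets and Koszul signs -/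

section Subsets
variable {m n p : ℕ}

/-- The set of the values of `σ` on the head. -/
def headSet (h : m + n = p) (σ : Equiv.Perm (Fin (p + 1))) : Finset ℕ :=
  Finset.univ.image fun i : Fin (n + 1) => (σ (headIx h i)).val

theorem mem_headSet (h : m + n = p) (σ : Equiv.Perm (Fin (p + 1))) (k : Fin (p + 1)) :
    (σ k).val ∈ headSet h σ ↔ k.val < n + 1 := by
  rw [headSet, Finset.mem_image]
  constructor
  · rintro ⟨i, -, hi⟩
    rw [← σ.injective (Fin.ext hi)]
    exact i.2
  · intro hk
    exact ⟨⟨k.val, hk⟩, Finset.mem_univ _, rfl⟩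

theorem headSet_mem (h : m + n = p) (σ : Equiv.Perm (Fin (p + 1))) :
    headSet h σ ∈ Finset.powersetCard (n + 1) (Finset.range (p + 1)) := by
  rw [Finset.mem_powersetCard]
  constructor
  · intro k hk
    obtain ⟨i, -, rfl⟩ := Finset.mem_image.1 hk
    exact Finset.mem_range.2 (Fin.is_lt _)
  · rw [headSet, Finset.card_image_of_injective _ fun i j hij =>
      headIx_injective h (σ.injective (Fin.ext hij))]
    simp

/-- Both lists are strictly increasing and have the same members. -/
theorem ofFn_head (h : m + n = p) {σ : Equiv.Perm (Fin (p + 1))} (hσ : IsUnshuffle (n + 1) σ) :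
    List.ofFn (fun i : Fin (n + 1) => (σ (headIx h i)).val) =
      (List.range (p + 1)).filter (· ∈ headSet h σ) := by
  have h1 := ((isUnshuffle_iff h σ).1 hσ).1
  have s1 : (List.ofFn (fun i : Fin (n + 1) => (σ (headIx h i)).val)).SortedLT :=
    List.sortedLT_ofFn_iff.2 fun a b hab => h1 hab
  refine List.Pairwise.eq_of_mem_iff s1.pairwise
    ((List.sortedLT_range (p + 1)).pairwise.filter _) fun k => ?_
  simp only [List.mem_ofFn, List.mem_filter, List.mem_range, decide_eq_true_eq, headSet,
    Finset.mem_image, Finset.mem_univ, true_and]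
  constructor
  · rintro ⟨i, rfl⟩
    exact ⟨(σ (headIx h i)).2, i, rfl⟩
  · exact fun hk => hk.2

theorem ofFn_tail (h : m + n = p) {σ : Equiv.Perm (Fin (p + 1))} (hσ : IsUnshuffle (n + 1) σ) :
    List.ofFn (fun i : Fin m => (σ (tailIx h i)).val) =
      (List.range (p + 1)).filter (· ∉ headSet h σ) := by
  have h1 := ((isUnshuffle_iff h σ).1 hσ).2
  have s1 : (List.ofFn (fun i : Fin m => (σ (tailIx h i)).val)).SortedLT :=
    List.sortedLT_ofFn_iff.2 fun a b hab => h1 hab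
  refine List.Pairwise.eq_of_mem_iff s1.pairwise
    ((List.sortedLT_range (p + 1)).pairwise.filter _) fun k => ?_
  simp only [List.mem_ofFn, List.mem_filter, List.mem_range, decide_eq_true_eq]
  constructor
  · rintro ⟨i, rfl⟩
    refine ⟨(σ (tailIx h i)).2, ?_⟩
    rw [mem_headSet]
    simp only [tailIx]
    omega
  · rintro ⟨hk, hk'⟩
    obtain ⟨j, hj⟩ := σ.surjective ⟨k, hk⟩
    have e : k = (σ j).val := by rw [hj]
    subst e
    obtain ⟨i, rfl⟩ | ⟨i, rfl⟩ := place_cases h j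
    · rw [mem_headSet] at hk'
      exact absurd i.2 hk'
    · exact ⟨i, rfl⟩

/-- An unshuffle lists its head set and the complement of that set in increasing order, and so is
recovered from it. -/
theorem headSet_injOn (h : m + n = p) :
    Set.InjOn (headSet h) (unshuffles (p + 1) (n + 1) : Set (Equiv.Perm (Fin (p + 1)))) := by
  intro σ hσ τ hτ e
  simp only [unshuffles, Finset.coe_filter, Finset.mem_univ, true_and, Set.mem_ofPred_eq] at hσ hτ
  have e1 := ofFn_head h hσ
  have e2 := ofFn_tail h hσ
  rw [e] at e1 e2
  rw [← ofFn_head h hτ] at e1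
  rw [← ofFn_tail h hτ] at e2
  exact perm_ext_places h (fun i => Fin.ext (congrFun (List.ofFn_injective e1) i))
    (fun i => Fin.ext (congrFun (List.ofFn_injective e2) i))

theorem card_unshuffles (h : m + n = p) :
    (unshuffles (p + 1) (n + 1)).card = (p + 1).choose (n + 1) := by
  have := sum_perm_eq_sum_unshuffles h (fun _ => 1) (fun _ _ _ => rfl)
  simp only [Finset.sum_const, smul_eq_mul, mul_one, Finset.card_univ, Fintype.card_perm,
    Fintype.card_fin] at this
  rw [Nat.choose_eq_factorial_div_factorial (by omega), this,
    show p + 1 - (n + 1) = m by omega, Nat.mul_div_cancel_left _ (by positivity)]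

theorem image_headSet (h : m + n = p) :
    (unshuffles (p + 1) (n + 1)).image (headSet h) =
      Finset.powersetCard (n + 1) (Finset.range (p + 1)) := by
  refine Finset.eq_of_subset_of_card_le ?_ ?_
  · intro S hS
    obtain ⟨σ, -, rfl⟩ := Finset.mem_image.1 hS
    exact headSet_mem h σ
  · rw [Finset.card_image_of_injOn (headSet_injOn h), card_unshuffles h, Finset.card_powersetCard,
      Finset.card_range]

theorem sum_unshuffles_headSet (h : m + n = p) {R : Type*} [AddCommMonoid R] (φ : Finset ℕ → R) :
    ∑ σ ∈ unshuffles (p + 1) (n + 1), φ (headSet h σ) =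
      ∑ S ∈ Finset.powersetCard (n + 1) (Finset.range (p + 1)), φ S := by
  rw [← image_headSet h, Finset.sum_image (headSet_injOn h)]

/-- The empty set would belong to an inner bracket without arguments, which the L∞ identities do not
contain; hence the condition on φ ∅. -/
theorem sum_powerset_range {R : Type*} [AddCommMonoid R] (φ : Finset ℕ → R) (h0 : φ ∅ = 0) (N : ℕ) :
    ∑ S ∈ (Finset.range N).powerset, φ S =
      ∑ i : Fin N, ∑ S ∈ Finset.powersetCard (i.val + 1) (Finset.range N), φ S := by
  have e : ∀ j, ∑ S ∈ Finset.powersetCard j (Finset.range N), φ S =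
      ∑ S ∈ (Finset.range N).powerset with S.card = j, φ S := fun j =>
    Finset.sum_congr (by ext S; simp [Finset.mem_powersetCard]) fun _ _ => rfl
  rw [← Finset.sum_fiberwise_of_maps_to (t := Finset.range (N + 1)) (g := Finset.card)
    (fun S hS => by
      have := Finset.card_le_card (Finset.mem_powerset.1 hS)
      rw [Finset.card_range] at this
      simpa [Nat.lt_succ_iff] using this)]
  simp only [← e]
  rw [Finset.sum_range_succ', Finset.sum_range]
  simp [h0]

/-- The sign of σ contributes -1 for each inversion, so both factors of χ merge into one product
over inversions. -/
theorem koszul_eq_prod {N : ℕ} (D : Fin N → ℕ) (σ : Equiv.Perm (Fin N)) :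
    koszul D σ = ∏ i, ∏ j, if i < j ∧ σ j < σ i then -(-1 : ℤ) ^ (D (σ i) * D (σ j)) else 1 := by
  have : (Equiv.Perm.sign σ : ℤ) = ∏ i, ∏ j, if i < j ∧ σ j < σ i then (-1 : ℤ) else 1 := by
    rw [Equiv.Perm.sign_eq_prod_prod_Ioi, Units.coe_prod]
    refine Finset.prod_congr rfl fun i _ => ?_
    rw [Units.coe_prod, ← Finset.filter_lt_eq_Ioi, Finset.prod_filter]
    refine Finset.prod_congr rfl fun j _ => ?_
    by_cases hij : i < j
    · by_cases hs : σ i < σ j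
      · simp [hij, hs, hs.le]
      · have : σ j < σ i := lt_of_le_of_ne (not_lt.1 hs) (σ.injective.ne hij.ne')
        simp [hij, hs, this]
    · simp [hij]
  rw [koszul, this, ← Finset.prod_mul_distrib]
  refine Finset.prod_congr rfl fun i _ => ?_
  rw [← Finset.prod_mul_distrib]
  refine Finset.prod_congr rfl fun j _ => ?_
  split_ifs <;> simp

theorem jacobiSign_eq_prod (d : ℕ → ℕ) (c : ℕ → Prop) [DecidablePred c] (N : ℕ) :
    jacobiSign d c N = ∏ a ∈ Finset.range N, if c a then -∏ b ∈ Finset.range a,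
      if c b then 1 else -(-1) ^ ((d b + 1) * (d a + 1)) else 1 := by
  induction N with
  | zero => rfl
  | succ N ih => rw [jacobiSign, ih, Finset.prod_range_succ]

theorem jacobiSign_eq (d : ℕ → ℕ) (S : Finset ℕ) (N : ℕ) (hS : S ⊆ Finset.range N) :
    jacobiSign d (· ∈ S) N = (-1) ^ S.card * ∏ a : Fin N, ∏ b : Fin N,
      if b < a ∧ a.val ∈ S ∧ b.val ∉ S then -(-1) ^ ((d a + 1) * (d b + 1)) else 1 := by
  have e1 : (-1 : ℤ) ^ S.card = ∏ a ∈ Finset.range N, if a ∈ S then -1 else 1 := by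
    rw [← Finset.prod_filter, Finset.prod_const, Finset.filter_mem_eq_inter,
      Finset.inter_eq_right.2 hS]
  rw [jacobiSign_eq_prod, e1, Finset.prod_range, Finset.prod_range, ← Finset.prod_mul_distrib]
  refine Finset.prod_congr rfl fun a _ => ?_
  by_cases ha : a.val ∈ S
  · simp only [ha, if_true, true_and, neg_one_mul, neg_inj]
    have : Finset.range a.val = (Finset.range N).filter (· < a.val) := by
      ext b; simp only [Finset.mem_range, Finset.mem_filter]; omega
    rw [this, Finset.prod_filter, Finset.prod_range]
    refine Finset.prod_congr rfl fun b _ => ?_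
    simp only [Fin.lt_def, mul_comm]
    split_ifs <;> tauto
  · simp [ha]

/-- An unshuffle increases on head and tail, so its inversions are the pairs a > b of values with a
in the head set and b outside, exactly those counted by `jacobiSign`. Only parities of degrees
enter, hence the weak hypothesis relating D and d. -/
theorem koszul_unshuffle (h : m + n = p) {σ : Equiv.Perm (Fin (p + 1))}
    (hσ : IsUnshuffle (n + 1) σ) (D : Fin (p + 1) → ℕ) (d : ℕ → ℕ)
    (hd : ∀ j : Fin (p + 1), Even (D j) ↔ Even (d j + 1)) :
    (-1) ^ (n + 1) * koszul D σ = jacobiSign d (· ∈ headSet h σ) (p + 1) := by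
  have hc := Finset.mem_powersetCard.1 (headSet_mem h σ)
  rw [jacobiSign_eq d _ _ hc.1, hc.2, koszul_eq_prod]
  congr 1
  conv_rhs => rw [← Equiv.prod_comp σ]
  refine Finset.prod_congr rfl fun i _ => ?_
  conv_rhs => rw [← Equiv.prod_comp σ]
  refine Finset.prod_congr rfl fun j _ => ?_
  have e : (-1 : ℤ) ^ (D (σ i) * D (σ j)) = (-1) ^ ((d (σ i) + 1) * (d (σ j) + 1)) :=
    neg_one_pow_congr (by rw [Nat.even_mul, Nat.even_mul, hd, hd])
  rw [e]
  refine if_congr ?_ rfl rfl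
  rw [mem_headSet, mem_headSet]
  constructor
  · rintro ⟨hij, hs⟩
    refine ⟨hs, ?_, fun hj => ?_⟩
    · by_contra hi
      exact absurd (hσ.2 i j hij (by omega)) hs.not_gt
    · exact absurd (hσ.1 i j hij hj) hs.not_gt
  · rintro ⟨hs, hi, hj⟩
    exact ⟨by rw [Fin.lt_def]; omega, hs⟩

end Subsets

/-! ### The L∞-algebra of derived brackets -/

namespace DerivedData
variable {𝔤 : Type*} [AddCommGroup 𝔤] [Module ℂ 𝔤] (V : DerivedData 𝔤)

/-- Lists mediate between `W`, which is indexed by subsets of ℕ, and `iter`, which is indexed by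
`Fin k`. -/
theorem W_eq_foldl (x : ℕ → 𝔤) (c : ℕ → Prop) [DecidablePred c] (X : 𝔤) (n : ℕ) :
    V.W x c X n = (((List.range n).filter c).map x).foldl (fun y a => V.T a y) X := by
  induction n with
  | zero => rfl
  | succ n ih =>
    rw [W, ih, List.range_succ, List.filter_append, List.map_append, List.foldl_append]
    by_cases h : c n <;> simp [h]

/-- `(a₁, …, aₖ) ↦ T aₖ ⋯ T a₁ Δ`. -/
def iter : ∀ k : ℕ, MultilinearMap ℂ (fun _ : Fin k => 𝔤) 𝔤
  | 0 => MultilinearMap.constOfIsEmpty ℂ _ V.Δ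
  | k + 1 => MultilinearMap.uncurryRight (M := fun _ => 𝔤)
      ((V.br ∘ₗ V.K).compMultilinearMap (iter k))

theorem iter_succ {k : ℕ} (v : Fin (k + 1) → 𝔤) :
    V.iter (k + 1) v = V.T (v (Fin.last k)) (V.iter k (fun i => v i.castSucc)) := rfl

theorem iter_eq_foldl {k : ℕ} (v : Fin k → 𝔤) :
    V.iter k v = (List.ofFn v).foldl (fun y a => V.T a y) V.Δ := by
  induction k with
  | zero => rfl
  | succ k ih => rw [iter_succ, ih, List.ofFn_succ_last, List.foldl_append]; rfl

end DerivedData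

namespace DerivedData
variable {𝔤 U : Type*} [AddCommGroup 𝔤] [Module ℂ 𝔤] [AddCommGroup U] [Module ℂ U]
  (V : DerivedData 𝔤)

theorem iter_mem {k : ℕ} {v : Fin k → 𝔤} {d : Fin k → ℕ} (hv : ∀ i, v i ∈ V.G (d i)) :
    V.iter k v ∈ V.G (1 + ∑ i, d i) := by
  induction k with
  | zero => simpa [iter] using V.Δ_mem
  | succ k ih =>
    rw [iter_succ, Fin.sum_univ_castSucc, ← add_assoc]
    exact V.T_mem (hv _) (ih fun i => hv i.castSucc)

theorem T_zsmul (c : ℤ) (a y : 𝔤) : V.T (c • a) y = c • V.T a y := map_zsmul (V.br (V.K y)) c a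

theorem W_zsmul (x : ℕ → 𝔤) (c : ℕ → Prop) [DecidablePred c] (s : ℤ) (X : 𝔤) (n : ℕ) :
    V.W x c (s • X) n = s • V.W x c X n := by
  induction n with
  | zero => rfl
  | succ n ih =>
    rw [W, W, ih]
    split_ifs
    · exact map_zsmul _ _ _
    · rfl

/-- The derived brackets, transferred to a space `U` that is identified with the image of `P`. -/
def bracket (ι : U →ₗ[ℂ] 𝔤) (π : 𝔤 →ₗ[ℂ] U) : ∀ k : ℕ, MultilinearMap ℂ (fun _ : Fin k => U) U
  | 0 => 0
  | k + 1 => (-1 : ℤ) ^ (k + 1) •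
      (π.compMultilinearMap (V.iter (k + 1))).compLinearMap (fun _ => ι)

theorem bracket_apply (ι : U →ₗ[ℂ] 𝔤) (π : 𝔤 →ₗ[ℂ] U) {k : ℕ} (hk : 1 ≤ k) (v : Fin k → U) :
    V.bracket ι π k v = (-1 : ℤ) ^ k • π (V.iter k (fun i => ι (v i))) := by
  obtain ⟨k, rfl⟩ : ∃ k', k = k' + 1 := ⟨k - 1, by omega⟩
  rfl

theorem bracket_succ_apply (ι : U →ₗ[ℂ] 𝔤) (π : 𝔤 →ₗ[ℂ] U) {k : ℕ} (v : Fin (k + 1) → U) :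
    V.bracket ι π (k + 1) v = (-1 : ℤ) ^ (k + 1) • π (V.iter (k + 1) (fun i => ι (v i))) := rfl

/-- The identification of a graded space with the image of `P`, with a shift of the degree. -/
structure IsShift (ι : U →ₗ[ℂ] 𝔤) (π : 𝔤 →ₗ[ℂ] U) (H : ℕ → Submodule ℂ U) : Prop where
  ι_π : ∀ y, ι (π y) = V.P y
  π_ι : ∀ u, π (ι u) = u
  zero : H 0 = ⊥
  succ : ∀ n u, u ∈ H (n + 1) ↔ ι u ∈ V.G n

variable {V} {ι : U →ₗ[ℂ] 𝔤} {π : 𝔤 →ₗ[ℂ] U} {H : ℕ → Submodule ℂ U} (hV : V.IsShift ι π H)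
include hV

theorem IsShift.P_ι (u : U) : V.P (ι u) = ι u := by rw [← hV.ι_π, hV.π_ι]

theorem IsShift.exists_degree {D : ℕ} {u : U} (hu : u ∈ H D) :
    ∃ e, ι u ∈ V.G e ∧ (Even D ↔ Even (e + 1)) := by
  cases D with
  | zero =>
    rw [hV.zero, Submodule.mem_bot] at hu
    -- Degree 0 contains only the zero vector, which lies in every degree of 𝔤; degree 1 has the
    -- required parity.
    exact ⟨1, by rw [hu, map_zero]; exact zero_mem _, by simp⟩
  | succ D => exact ⟨D, (hV.succ D u).1 hu, Iff.rfl⟩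

theorem IsShift.degree {k : ℕ} (hk : 1 ≤ k) (d : Fin k → ℕ) (v : Fin k → U)
    (hv : ∀ j, v j ∈ H (d j)) :
    (∃ e : ℕ, (e : ℤ) = ∑ j, (d j : ℤ) + 2 - k ∧ V.bracket ι π k v ∈ H e) ∨
      V.bracket ι π k v = 0 := by
  by_cases h : ∃ j, d j = 0
  · obtain ⟨j, hj⟩ := h
    have := hv j
    rw [hj, hV.zero, Submodule.mem_bot] at this
    exact Or.inr (MultilinearMap.map_coord_zero _ j this)
  · push Not at h
    choose e he using fun j => Nat.exists_eq_succ_of_ne_zero (h j)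
    have hm : V.iter k (fun i => ι (v i)) ∈ V.G (1 + ∑ i, e i) :=
      V.iter_mem fun i => (hV.succ _ _).1 (by rw [← Nat.succ_eq_add_one, ← he]; exact hv i)
    -- One unit comes from Δ and one from the shift, while each d j is e j + 1.
    refine Or.inl ⟨1 + ∑ i, e i + 1, ?_, ?_⟩
    · push_cast [he]
      simp only [Finset.sum_add_distrib]
      simp
      ring
    · rw [V.bracket_apply ι π hk]
      refine zsmul_mem ?_ _
      rw [hV.succ, hV.ι_π]
      exact V.P_mem hm

theorem IsShift.T_T {D E j : ℕ} {a b : U} {y : 𝔤} (ha : a ∈ H D) (hb : b ∈ H E) (hy : y ∈ V.G j) :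
    V.T (ι a) (V.T (ι b) y) = -((-1 : ℤ) ^ (D * E) • V.T (ι b) (V.T (ι a) y)) := by
  obtain ⟨m, hm, hm'⟩ := hV.exists_degree ha
  obtain ⟨n, hn, hn'⟩ := hV.exists_degree hb
  rw [V.T_T hm hn hy (hV.P_ι a) (hV.P_ι b), ← neg_smul]
  congr 1
  rw [pow_add, pow_one, neg_one_mul, neg_inj]
  exact neg_one_pow_congr (by rw [Nat.even_mul, Nat.even_mul, hm', hn'])

theorem IsShift.skew_two (d : Fin 2 → ℕ) (v : Fin 2 → U) (hv : ∀ j, v j ∈ H (d j))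
    (σ : Equiv.Perm (Fin 2)) :
    V.bracket ι π 2 (fun j => v (σ j)) = koszul d σ • V.bracket ι π 2 v := by
  have hσ : σ = 1 ∨ σ = Equiv.swap 0 1 := by decide +revert
  have e : ∀ v : Fin 2 → U, V.bracket ι π 2 v = π (V.T (ι (v 1)) (V.T (ι (v 0)) V.Δ)) := by
    intro v
    rw [bracket_succ_apply]
    simp
    rfl
  rw [e, e, koszul_eq_prod]
  simp only [Fin.prod_univ_two]
  obtain rfl | rfl := hσ
  · simp
  · simp only [Equiv.swap_apply_left, Equiv.swap_apply_right]
    rw [hV.T_T (hv 0) (hv 1) V.Δ_mem, map_neg, map_zsmul, ← neg_smul]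
    simp [mul_comm]

/-- Adjacent operators are exchanged by `T_T`, the first two in `s1` and the last two in `s2`; each
of the six permutations is a product of such exchanges. -/
theorem IsShift.skew_three (d : Fin 3 → ℕ) (v : Fin 3 → U) (hv : ∀ j, v j ∈ H (d j))
    (σ : Equiv.Perm (Fin 3)) :
    V.bracket ι π 3 (fun j => v (σ j)) = koszul d σ • V.bracket ι π 3 v := by
  have e : ∀ v : Fin 3 → U, V.bracket ι π 3 v =
      -π (V.T (ι (v 2)) (V.T (ι (v 1)) (V.T (ι (v 0)) V.Δ))) := by
    intro v
    rw [bracket_succ_apply]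
    simp
    rfl
  let t : Fin 3 → Fin 3 → Fin 3 → 𝔤 := fun i j k =>
    V.T (ι (v k)) (V.T (ι (v j)) (V.T (ι (v i)) V.Δ))
  have hmem : ∀ i, ∃ n, V.T (ι (v i)) V.Δ ∈ V.G n := fun i => by
    obtain ⟨m, hm, -⟩ := hV.exists_degree (hv i)
    exact ⟨_, V.T_mem hm V.Δ_mem⟩
  have s1 : ∀ i j k, t j i k = -((-1 : ℤ) ^ (d i * d j) • t i j k) := fun i j k => by
    simp only [t]
    rw [hV.T_T (hv i) (hv j) V.Δ_mem, map_neg, map_zsmul]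
  have s2 : ∀ i j k, t i k j = -((-1 : ℤ) ^ (d j * d k) • t i j k) := fun i j k => by
    obtain ⟨n, hn⟩ := hmem i
    exact hV.T_T (hv j) (hv k) hn
  have e' : ∀ σ : Equiv.Perm (Fin 3), V.bracket ι π 3 (fun j => v (σ j)) =
      -π (t (σ 0) (σ 1) (σ 2)) := fun σ => e _
  have key : t (σ 0) (σ 1) (σ 2) = koszul d σ • t 0 1 2 := by
    have hσ : σ = 1 ∨ σ = Equiv.swap 0 1 ∨ σ = Equiv.swap 1 2 ∨ σ = Equiv.swap 0 2 ∨
        σ = Equiv.swap 0 1 * Equiv.swap 1 2 ∨ σ = Equiv.swap 1 2 * Equiv.swap 0 1 := by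
      decide +revert
    rw [koszul_eq_prod]
    simp only [Fin.prod_univ_three]
    obtain rfl | rfl | rfl | rfl | rfl | rfl := hσ
    · simp
    · rw [show Equiv.swap (0 : Fin 3) 1 0 = 1 by decide, show Equiv.swap (0 : Fin 3) 1 1 = 0 by decide,
        show Equiv.swap (0 : Fin 3) 1 2 = 2 by decide, s1 0 1 2]
      simp [mul_comm]
    · rw [show Equiv.swap (1 : Fin 3) 2 0 = 0 by decide, show Equiv.swap (1 : Fin 3) 2 1 = 2 by decide,
        show Equiv.swap (1 : Fin 3) 2 2 = 1 by decide, s2 0 1 2]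
      simp [mul_comm]
    · rw [show Equiv.swap (0 : Fin 3) 2 0 = 2 by decide, show Equiv.swap (0 : Fin 3) 2 1 = 1 by decide,
        show Equiv.swap (0 : Fin 3) 2 2 = 0 by decide, s1 1 2 0, s2 1 0 2, s1 0 1 2]
      simp [mul_comm, smul_smul, mul_assoc]
    · rw [show (Equiv.swap (0 : Fin 3) 1 * Equiv.swap 1 2 : Equiv.Perm (Fin 3)) 0 = 1 by decide,
        show (Equiv.swap (0 : Fin 3) 1 * Equiv.swap 1 2 : Equiv.Perm (Fin 3)) 1 = 2 by decide,
        show (Equiv.swap (0 : Fin 3) 1 * Equiv.swap 1 2 : Equiv.Perm (Fin 3)) 2 = 0 by decide, s2 1 0 2, s1 0 1 2]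
      simp [mul_comm, smul_smul]
    · rw [show (Equiv.swap (1 : Fin 3) 2 * Equiv.swap 0 1 : Equiv.Perm (Fin 3)) 0 = 2 by decide,
        show (Equiv.swap (1 : Fin 3) 2 * Equiv.swap 0 1 : Equiv.Perm (Fin 3)) 1 = 0 by decide,
        show (Equiv.swap (1 : Fin 3) 2 * Equiv.swap 0 1 : Equiv.Perm (Fin 3)) 2 = 1 by decide, s1 0 2 1, s2 0 1 2]
      simp [mul_comm, smul_smul]
  rw [e', key, map_zsmul, e, smul_neg]

/-- This is `sum_jacobiSign` with the subsets sorted by cardinality and replaced by unshuffles. -/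
theorem IsShift.jacobi {N : ℕ} (hN : 1 ≤ N) (D : Fin N → ℕ) (v : Fin N → U)
    (hv : ∀ j, v j ∈ H (D j)) :
    ∑ i : Fin N, (-1 : ℤ) ^ (i.val + 1) • ∑ σ ∈ unshuffles N (i.val + 1), koszul D σ •
      V.bracket ι π (N - 1 - i.val + 1)
        (Fin.cons (V.bracket ι π (i.val + 1) (fun a => v (σ ⟨a.val, by omega⟩)))
          (fun b : Fin (N - 1 - i.val) => v (σ ⟨i.val + 1 + b.val, by omega⟩))) = 0 := by
  obtain ⟨p, rfl⟩ : ∃ p, N = p + 1 := ⟨N - 1, by omega⟩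
  choose e he using fun j => hV.exists_degree (hv j)
  -- The vectors and their degrees are continued by 0 to all of ℕ, where `W` expects them.
  let x : ℕ → 𝔤 := fun i => if h : i < p + 1 then ι (v ⟨i, h⟩) else 0
  let d : ℕ → ℕ := fun i => if h : i < p + 1 then e ⟨i, h⟩ else 0
  have xval : ∀ i : Fin (p + 1), x i.val = ι (v i) := fun i => dif_pos i.2
  have dval : ∀ i : Fin (p + 1), d i.val = e i := fun i => dif_pos i.2
  have hx : ∀ i, x i ∈ V.G (d i) := fun i => by
    by_cases h : i < p + 1
    · simp only [x, d, h, dif_pos]; exact (he _).1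
    · simp only [x, d, h, dif_neg, not_false_eq_true]; exact zero_mem _
  have hx' : ∀ i, V.P (x i) = x i := fun i => by
    by_cases h : i < p + 1
    · simp only [x, h, dif_pos]; exact hV.P_ι _
    · simp only [x, h, dif_neg, not_false_eq_true, map_zero]
  let φ : Finset ℕ → 𝔤 := fun S => jacobiSign d (· ∈ S) (p + 1) •
      V.P (V.W x (· ∉ S) (V.T (V.P (V.W x (· ∈ S) V.Δ (p + 1))) V.Δ) (p + 1))
  -- For S = ∅ the inner bracket is P Δ = 0: the structure has no curvature term.
  have hφ0 : φ ∅ = 0 := by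
    have h1 : ∀ n, V.W x (· ∈ (∅ : Finset ℕ)) V.Δ n = V.Δ := fun n => by
      induction n with
      | zero => rfl
      | succ n ih => rw [W, if_neg (by simp), ih]
    have h2 : ∀ n, V.W x (· ∉ (∅ : Finset ℕ)) 0 n = 0 := fun n => by
      induction n with
      | zero => rfl
      | succ n ih => rw [W, if_pos (by simp), ih, map_zero]
    simp only [φ]
    rw [h1, V.P_Δ, show V.T 0 V.Δ = 0 by simp [T], h2, map_zero, smul_zero]
  have hsum := V.sum_jacobiSign hx hx' (p + 1)
  rw [sum_powerset_range φ hφ0] at hsum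
  have hι : Function.Injective ι := fun a b hab => by rw [← hV.π_ι a, hab, hV.π_ι]
  apply hι
  rw [map_zero, map_sum]
  -- Each bracket carries the sign (-1)^(number of its arguments). The inner and outer numbers add
  -- up to p + 2, so the two signs together are the same for all terms.
  refine Eq.trans ?_ ((congrArg (fun z => (-1 : ℤ) ^ (p + 1 + 1) • z) hsum).trans (smul_zero _))
  rw [Finset.smul_sum]
  refine Finset.sum_congr rfl fun i _ => ?_
  have h : p + 1 - 1 - i.val + i.val = p := by omega
  rw [← sum_unshuffles_headSet h φ, map_zsmul, map_sum, Finset.smul_sum, Finset.smul_sum]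
  refine Finset.sum_congr rfl fun σ hσ => ?_
  replace hσ : IsUnshuffle (i.val + 1) σ := by simpa [unshuffles] using hσ
  have hk := koszul_unshuffle h hσ D d (fun j => by rw [dval]; exact (he j).2)
  have hhead : V.iter (i.val + 1) (fun a : Fin (i.val + 1) => ι (v (σ (headIx h a)))) =
      V.W x (· ∈ headSet h σ) V.Δ (p + 1) := by
    rw [iter_eq_foldl, W_eq_foldl, ← ofFn_head h hσ, List.map_ofFn]
    congr 2
    funext a
    exact (xval _).symm
  have hinner : ι (V.bracket ι π (i.val + 1) (fun a => v (σ ⟨a.val, by omega⟩))) =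
      (-1 : ℤ) ^ (i.val + 1) • V.P (V.W x (· ∈ headSet h σ) V.Δ (p + 1)) := by
    rw [bracket_succ_apply, map_zsmul, hV.ι_π, ← hhead]
    rfl
  have houter : ι (V.bracket ι π (p + 1 - 1 - i.val + 1)
      (Fin.cons (V.bracket ι π (i.val + 1) (fun a => v (σ ⟨a.val, by omega⟩)))
          (fun b : Fin (p + 1 - 1 - i.val) => v (σ ⟨i.val + 1 + b.val, by omega⟩)))) =
      (-1 : ℤ) ^ (p + 1 - 1 - i.val + 1) • (-1 : ℤ) ^ (i.val + 1) •
        V.P (V.W x (· ∉ headSet h σ)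
          (V.T (V.P (V.W x (· ∈ headSet h σ) V.Δ (p + 1))) V.Δ) (p + 1)) := by
    have htail : ∀ X, (List.ofFn fun b : Fin (p + 1 - 1 - i.val) =>
        ι (v (σ ⟨i.val + 1 + b.val, by omega⟩))).foldl (fun y a => V.T a y) X =
        V.W x (· ∉ headSet h σ) X (p + 1) := by
      intro X
      rw [W_eq_foldl, ← ofFn_tail h hσ, List.map_ofFn]
      congr 2
      funext a
      exact (xval _).symm
    rw [bracket_succ_apply, map_zsmul, hV.ι_π, iter_eq_foldl, List.ofFn_succ]
    simp only [Fin.cons_zero, Fin.cons_succ, List.foldl_cons]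
    rw [hinner, htail, T_zsmul, W_zsmul, map_zsmul]
  rw [map_zsmul, houter]
  simp only [φ]
  rw [← hk]
  simp only [smul_smul]
  congr 1
  have : (-1 : ℤ) ^ (p + 1 - 1 - i.val + 1) * (-1) ^ (i.val + 1) = (-1) ^ (p + 1 + 1) := by
    rw [← pow_add]; congr 1; omega
  rw [this]
  ring

theorem IsShift.isLInftyAlgebra (hH : DirectSum.IsInternal H)
    (h4 : ∀ k, 4 ≤ k → V.bracket ι π k = 0) : IsLInftyAlgebra H (V.bracket ι π) where
  isInternal := hH
  zero := rfl
  degree _ hk := hV.degree hk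
  skew k hk d v hv σ := by
    by_cases hk4 : 4 ≤ k
    · rw [h4 k hk4]; simp
    · obtain rfl | rfl | rfl : k = 1 ∨ k = 2 ∨ k = 3 := by omega
      · obtain rfl : σ = 1 := Subsingleton.elim _ _
        simp [koszul_eq_prod]
      · exact hV.skew_two d v hv σ
      · exact hV.skew_three d v hv σ
  jacobi _ hN := hV.jacobi hN

end DerivedData

/-! ### The graded Lie algebra C^*(A, A) and the equation [Π, Π] = 0 -/

section Bracket
variable {A : Type*} [AddCommGroup A] [Module ℂ A] [Module (Polynomial ℂ) A]
  [IsScalarTower ℂ (Polynomial ℂ) A] {m n k p q : ℕ}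

/-- `circ` as a bilinear map. -/
def circL (h : m + n = p) : CMap m A A →ₗ[ℂ] CMap n A A →ₗ[ℂ] CMap p A A :=
  (insL h).compr₂ (∑ σ ∈ unshuffles (p + 1) (n + 1), sperm σ)

theorem circL_apply (h : m + n = p) (f : CMap m A A) (g : CMap n A A) :
    circL h f g = circ h f g := by
  rw [circ_eq_sum, circL, LinearMap.compr₂_apply, LinearMap.sum_apply]; rfl

/-- The Nijenhuis–Richardson bracket as a bilinear map. -/
def nrL (h : m + n = p) : CMap m A A →ₗ[ℂ] CMap n A A →ₗ[ℂ] CMap p A A :=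
  circL h - (-1 : ℤ) ^ (m * n) • (circL (show n + m = p by omega)).flip

theorem nrL_apply (h : m + n = p) (f : CMap m A A) (g : CMap n A A) :
    nrL h f g = circ h f g - (-1 : ℤ) ^ (m * n) • circ (show n + m = p by omega) g f := by
  rw [← circL_apply, ← circL_apply]; rfl

theorem nrL_rfl (f : CMap m A A) (g : CMap n A A) : nrL rfl f g = nr f g := nrL_apply rfl f g

theorem nrL_mem (h : m + n = p) {f g} (hf : f ∈ Cochain m A A) (hg : g ∈ Cochain n A A) :
    nrL h f g ∈ Cochain p A A := by
  rw [nrL_apply]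
  exact sub_mem (circ_mem h hf hg) (zsmul_mem (circ_mem _ hg hf) _)

theorem nrL_skew (h : m + n = p) (f : CMap m A A) (g : CMap n A A) :
    nrL h f g = -((-1 : ℤ) ^ (m * n) • nrL (show n + m = p by omega) g f) := by
  rw [nrL_apply, nrL_apply, smul_sub, smul_smul, mul_comm n m, neg_one_pow_mul_self, one_smul,
    neg_sub]

/-- A combination of three instances of the pre-Lie identity, with f, g and h in turn as the
leftmost cochain. The coefficients depend on the parities of mn, nk and mk, which are treated case
by case. -/
theorem nrL_jacobi {s r : ℕ} (h1 : m + n = p) (h2 : p + k = q) (h3 : n + k = s) (h4 : m + s = q)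
    (h5 : m + k = r) (h6 : r + n = q) {f g h} (hf : f ∈ Cochain m A A) (hg : g ∈ Cochain n A A)
    (hh : h ∈ Cochain k A A) :
    nrL h2 (nrL h1 f g) h = nrL h4 f (nrL h3 g h) +
      (-1 : ℤ) ^ (n * k) • nrL h6 (nrL h5 f h) g := by
  have P1 := circ_preLie h1 h2 h3 h4 h5 h6 (show k + n = s by omega) h4 hf hg hh
  have P2 := circ_preLie (show n + m = p by omega) h2 h5 (show n + r = q by omega) h3
    (show s + m = q by omega) (show k + m = r by omega) (show n + r = q by omega) hg hf hh
  have P3 := circ_preLie (show k + m = r by omega) h6 h1 (show k + p = q by omega)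
    (show k + n = s by omega) (show s + m = q by omega) (show n + m = p by omega)
    (show k + p = q by omega) hh hf hg
  have e1 : (-1 : ℤ) ^ (p * k) = (-1) ^ (m * k) * (-1) ^ (n * k) := by
    rw [← h1, add_mul, pow_add]
  have e2 : (-1 : ℤ) ^ (m * s) = (-1) ^ (m * n) * (-1) ^ (m * k) := by
    rw [← h3, mul_add, pow_add]
  have e3 : (-1 : ℤ) ^ (r * n) = (-1) ^ (m * n) * (-1) ^ (n * k) := by
    rw [← h5, add_mul, pow_add, mul_comm k n]
  simp only [nrL_apply, ← circL_apply, map_sub, map_zsmul, LinearMap.sub_apply,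
    LinearMap.smul_apply] at P1 P2 P3 ⊢
  rw [e1, e2, e3]
  have ha := neg_one_pow_eq_or ℤ (m * n)
  have hb := neg_one_pow_eq_or ℤ (n * k)
  have hc := neg_one_pow_eq_or ℤ (m * k)
  generalize (-1 : ℤ) ^ (m * n) = a at ha P3 ⊢
  generalize (-1 : ℤ) ^ (n * k) = b at hb P1 ⊢
  generalize (-1 : ℤ) ^ (m * k) = c at hc P2 ⊢
  obtain rfl | rfl := ha <;> obtain rfl | rfl := hb <;> obtain rfl | rfl := hc
  · linear_combination (norm := module) P1 - P2 + P3
  · linear_combination (norm := module) P1 - P2 - P3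
  · linear_combination (norm := module) P1 - P2 - P3
  · linear_combination (norm := module) P1 - P2 + P3
  · linear_combination (norm := module) P1 + P2 + P3
  · linear_combination (norm := module) P1 + P2 - P3
  · linear_combination (norm := module) P1 + P2 - P3
  · linear_combination (norm := module) P1 + P2 + P3

/-- The Nijenhuis–Richardson bracket of cochains. -/
def nrC (h : m + n = p) : Cochain m A A →ₗ[ℂ] Cochain n A A →ₗ[ℂ] Cochain p A A :=
  LinearMap.mk₂ ℂ (fun f g => ⟨nrL h f.1 g.1, nrL_mem h f.2 g.2⟩)
    (fun f f' g => Subtype.ext (by simp)) (fun c f g => Subtype.ext (by simp))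
    (fun f g g' => Subtype.ext (by simp)) (fun c f g => Subtype.ext (by simp))

theorem nrC_val (h : m + n = p) (f : Cochain m A A) (g : Cochain n A A) :
    (nrC h f g).1 = nrL h f.1 g.1 := rfl

/-- The space `C^*(A, A)`, as the underlying space of a graded Lie algebra. -/
def NRAlgebra (A : Type*) [AddCommGroup A] [Module ℂ A] [Module (Polynomial ℂ) A]
    [IsScalarTower ℂ (Polynomial ℂ) A] : Type _ := CochainSpace A A

instance : AddCommGroup (NRAlgebra A) := inferInstanceAs (AddCommGroup (CochainSpace A A))

instance : Module ℂ (NRAlgebra A) := inferInstanceAs (Module ℂ (CochainSpace A A))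

/-- The inclusion of `C^{n+1}(A, A)` in `C^*(A, A)`. -/
def nrIncl (n : ℕ) : Cochain n A A →ₗ[ℂ] NRAlgebra A := incl n

/-- The linear map on `C^*(A, A)` with given restrictions to the `C^{n+1}(A, A)`. -/
def nrDesc {W : Type*} [AddCommMonoid W] [Module ℂ W] (φ : ∀ n, Cochain n A A →ₗ[ℂ] W) :
    NRAlgebra A →ₗ[ℂ] W := DirectSum.toModule ℂ ℕ W φ

theorem nrDesc_incl {W : Type*} [AddCommMonoid W] [Module ℂ W] (φ : ∀ n, Cochain n A A →ₗ[ℂ] W)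
    (f : Cochain n A A) : nrDesc φ (nrIncl n f) = φ n f := DirectSum.toModule_lof ..

theorem nrAlgebra_induction {motive : NRAlgebra A → Prop} (x : NRAlgebra A)
    (zero : motive 0) (incl : ∀ n f, motive (nrIncl n f))
    (add : ∀ x y, motive x → motive y → motive (x + y)) : motive x :=
  DirectSum.induction_on x zero incl add

theorem nrIncl_injective (n : ℕ) : Function.Injective (nrIncl (A := A) n) :=
  DirectSum.of_injective n

theorem nrIncl_zsmul (n : ℕ) (c : ℤ) (f : Cochain n A A) : nrIncl n (c • f) = c • nrIncl n f :=
  map_zsmul (nrIncl n) c f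

theorem nrIncl_neg (n : ℕ) (f : Cochain n A A) : nrIncl n (-f) = -nrIncl n f :=
  map_neg (nrIncl n) f

/-- The Nijenhuis–Richardson bracket on `C^*(A, A)`. -/
def nrBr : NRAlgebra A →ₗ[ℂ] NRAlgebra A →ₗ[ℂ] NRAlgebra A :=
  nrDesc fun m => LinearMap.flip (nrDesc fun n =>
    ((nrC (A := A) (m := m) (n := n) rfl).compr₂ (nrIncl (m + n))).flip)

theorem nrBr_incl (h : m + n = p) (f : Cochain m A A) (g : Cochain n A A) :
    nrBr (nrIncl m f) (nrIncl n g) = nrIncl p (nrC h f g) := by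
  subst h
  rw [nrBr, nrDesc_incl, LinearMap.flip_apply, nrDesc_incl]
  rfl

/-- The operator `(-1)^n` on `C^{n+1}(A, A)`. -/
def signOp : NRAlgebra A →ₗ[ℂ] NRAlgebra A :=
  nrDesc fun n => (-1 : ℂ) ^ n • nrIncl (A := A) n

theorem signOp_incl (f : Cochain n A A) : signOp (nrIncl n f) = (-1 : ℤ) ^ n • nrIncl n f := by
  rw [signOp, nrDesc_incl, ← Int.cast_smul_eq_zsmul ℂ]
  simp

theorem unshuffles_three_two : unshuffles 3 2 =
    {1, Equiv.swap 1 2, Equiv.swap 0 1 * Equiv.swap 1 2} := by decide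

theorem LieConformalAlgebra.circTerm_self (L : LieConformalAlgebra A) (h : 1 + 1 = p)
    (σ : Equiv.Perm (Fin (p + 1))) (a : Fin (p + 1) → A) {x y z : Fin (p + 1)}
    (hx : σ (headIx h 0) = x) (hy : σ (headIx h 1) = y) (hz : σ (tailIx h 0) = z) :
    circTerm h L.toCochain.1 L.toCochain.1 σ a =
      extend (fun _ : Fin 1 => lam p x)
        (subst (fun _ : Fin 1 => lam p x + lam p y) ∘ₗ L.bracket.flip (a z))
        (L.bracket (a x) (a y)) := by
  subst hx hy hz
  have e1 : (fun i : Fin 1 => lam p (σ (headIx h i.castSucc))) =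
      fun _ => lam p (σ (headIx h 0)) := by
    funext i
    obtain rfl : i = 0 := Subsingleton.elim _ _
    rw [Fin.castSucc_zero]
  have e2 : (fun j : Fin 1 => Fin.cons (α := fun _ => Expr p) (∑ i : Fin 2, lam p (σ (headIx h i)))
      (fun j : Fin 1 => lam p (σ (tailIx h j))) j.castSucc) =
      fun _ => lam p (σ (headIx h 0)) + lam p (σ (headIx h 1)) := by
    funext j
    obtain rfl : j = 0 := Subsingleton.elim _ _
    rw [Fin.castSucc_zero, Fin.cons_zero, Fin.sum_univ_two]
  have e3 : firstArg L.toCochain.1 (fun j : Fin 1 => a (σ (tailIx h j))) =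
      L.bracket.flip (a (σ (tailIx h 0))) := LinearMap.ext fun b => rfl
  rw [circTerm, e1, e2, e3]
  rfl

/-- The three (2,1)-unshuffles give the three terms [[aᵢ aⱼ] aₖ] of Π ⋄ Π. Skewness (`hs`) rewrites
two of them as [a₁ [a₀ a₂]] and [a₀ [a₁ a₂]], and the sum vanishes by the Jacobi identity. -/
theorem LieConformalAlgebra.nr_self (L : LieConformalAlgebra A) (h : 1 + 1 = 2) :
    nrL h L.toCochain.1 L.toCochain.1 = 0 := by
  have hc : circ h L.toCochain.1 L.toCochain.1 = 0 := by
    ext a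
    have l0 : lam 2 0 = lv 0 := lam_castSucc 0
    have l1 : lam 2 1 = lv 1 := lam_castSucc 1
    have l2 : lam 2 2 = -(lv 0 + lv 1) - dv := by
      have := lam_last (n := 2)
      rwa [Fin.sum_univ_two] at this
    have hj := L.jacobi (a 0) (a 1) (a 2)
    have hs : ∀ (x y : Expr 2) (c : A), x + y = -dv →
        subst (fun _ : Fin 1 => x) ∘ₗ L.bracket.flip c =
          -(subst (fun _ : Fin 1 => y) ∘ₗ L.bracket c) := by
      intro x y c hxy
      ext1 b
      have := L.skew b c
      have e : ev (fun _ : Fin 1 => x) dv (-lv 0 - dv) = y := by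
        rw [map_sub, map_neg, ev_lv, ev_dv]; linear_combination -hxy
      rw [LinearMap.comp_apply, LinearMap.flip_apply, this, map_neg, subst,
        extend_subst _ (G := TensorProduct.mk ℂ (Lam 2) A 1) (isConf_cst 2), e]
      rfl
    change ∑ σ ∈ unshuffles 3 2, (Equiv.Perm.sign σ : ℤ) • circTerm h
      L.toCochain.1 L.toCochain.1 σ a = 0
    rw [unshuffles_three_two, Finset.sum_insert (by decide), Finset.sum_insert (by decide),
      Finset.sum_singleton, Equiv.Perm.sign_mul, Equiv.Perm.sign_swap (by decide),
      Equiv.Perm.sign_swap (by decide), Equiv.Perm.sign_one,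
      L.circTerm_self h 1 a (x := 0) (y := 1) (z := 2) rfl rfl rfl,
      L.circTerm_self h (Equiv.swap 1 2) a (x := 0) (y := 2) (z := 1) (by decide +revert)
        (by decide +revert) (by decide +revert),
      L.circTerm_self h (Equiv.swap 0 1 * Equiv.swap 1 2) a (x := 1) (y := 2) (z := 0)
        (by decide +revert) (by decide +revert) (by decide +revert), l0, l1, l2,
      hs (lv 0 + (-(lv 0 + lv 1) - dv)) (lv 1) (a 1) (by ring),
      hs (lv 1 + (-(lv 0 + lv 1) - dv)) (lv 0) (a 0) (by ring), extend_neg_right, extend_neg_right,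
      LinearMap.neg_apply, LinearMap.neg_apply, hj]
    simp
  rw [nrL_apply, hc]
  simp

end Bracket

/-! ### Induced maps of cochains; ⋄ with a linear map as 1-cochain -/

section Maps
variable {A B M N : Type*}
  [AddCommGroup A] [Module ℂ A] [Module (Polynomial ℂ) A] [IsScalarTower ℂ (Polynomial ℂ) A]
  [AddCommGroup B] [Module ℂ B] [Module (Polynomial ℂ) B] [IsScalarTower ℂ (Polynomial ℂ) B]
  [AddCommGroup M] [Module ℂ M] [Module (Polynomial ℂ) M] [IsScalarTower ℂ (Polynomial ℂ) M]
  [AddCommGroup N] [Module ℂ N] [Module (Polynomial ℂ) N] [IsScalarTower ℂ (Polynomial ℂ) N]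
  {m n p : ℕ}

theorem lTensor_subst {k : ℕ} (α : M →ₗ[ℂ] N) (hα : ∀ b, α (del M b) = del N (α b))
    (x : Fin k → Expr n) (v : Val k M) :
    α.lTensor (Lam n) (subst x v) = subst x (α.lTensor (Lam k) v) := by
  rw [subst, lTensor_extend α hα, subst, extend_comp_lTensor]
  congr 2

/-- The map of cochains that is induced by `ℂ[∂]`-linear maps of the coefficients and of the
arguments. -/
def mapC (n : ℕ) (α : M →ₗ[ℂ] N) (hα : ∀ b, α (del M b) = del N (α b)) (β : B →ₗ[ℂ] A)
    (hβ : ∀ b, β (del B b) = del A (β b)) : Cochain n A M →ₗ[ℂ] Cochain n B N where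
  toFun F := ⟨(α.lTensor (Lam n)).compMultilinearMap (F.1.compLinearMap fun _ => β), by
    obtain ⟨F, hF, hF'⟩ := F
    refine ⟨fun i a => ?_, fun σ a => ?_⟩
    · have e : (fun j => β (Function.update a i (del B (a i)) j)) =
          Function.update (fun j => β (a j)) i (del A (β (a i))) := by
        rw [← hβ]
        exact Function.comp_update β a i _
      change α.lTensor (Lam n) (F fun j => β (Function.update a i (del B (a i)) j)) =
        -act (lam n i) (α.lTensor (Lam n) (F fun j => β (a j)))
      rw [e, hF i (fun j => β (a j)), map_neg, act_lTensor α hα]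
    · change α.lTensor (Lam n) (F fun j => β (a j)) = _ •
        subst _ (α.lTensor (Lam n) (F fun j => β (a (σ j))))
      rw [hF' σ fun j => β (a j), map_zsmul, lTensor_subst α hα]⟩
  map_add' F F' := Subtype.ext (MultilinearMap.ext fun a => map_add (α.lTensor (Lam n)) _ _)
  map_smul' c F := Subtype.ext (MultilinearMap.ext fun a => map_smul (α.lTensor (Lam n)) _ _)

/-- A linear map as a `1`-cochain without its symmetry. -/
def linMap (ε : A →ₗ[ℂ] M) : CMap 0 A M :=
  MultilinearMap.ofSubsingleton ℂ A (Val 0 M) (0 : Fin 1) (cst 0 M ∘ₗ ε)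

theorem linMap_apply (ε : A →ₗ[ℂ] M) (a : Fin 1 → A) : linMap ε a = cst 0 M (ε (a 0)) := rfl

theorem linMap_mem (ε : A →ₗ[ℂ] M) (hε : ∀ b, ε (del A b) = del M (ε b)) :
    linMap ε ∈ Cochain 0 A M := by
  refine ⟨fun i a => ?_, fun σ a => ?_⟩
  · obtain rfl : i = 0 := Subsingleton.elim (α := Fin 1) _ _
    rw [linMap_apply, linMap_apply, Function.update_self, hε, isConf_cst]
    have : lam 0 0 = -dv := by simpa using sum_lam 0
    rw [this, map_neg, LinearMap.neg_apply, neg_neg]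
  · obtain rfl : σ = 1 := Subsingleton.elim (α := Equiv.Perm (Fin 1)) _ _
    have e : (fun i : Fin 0 => lam 0 ((1 : Equiv.Perm (Fin 1)) i.castSucc)) = fun i => lv i :=
      funext fun i => i.elim0
    rw [e, subst_lv]
    simp

theorem unshuffles_self (N : ℕ) : unshuffles N N = {1} := by
  ext σ
  simp only [unshuffles, Finset.mem_filter, Finset.mem_univ, true_and, Finset.mem_singleton]
  constructor
  · intro h
    have hs : StrictMono σ := fun a b hab => h.1 a b hab b.2
    exact strictMono_comp_perm (f := id) strictMono_id hs
  · rintro rfl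
    exact ⟨fun a b hab _ => hab, fun a b hab _ => hab⟩

theorem circ_linMap_left (h : 0 + n = n) (ε : A →ₗ[ℂ] A) (F : CMap n A A) (a : Fin (n + 1) → A) :
    circ h (linMap ε) F a = ε.lTensor (Lam n) (F a) := by
  change ∑ σ ∈ unshuffles (n + 1) (n + 1), (Equiv.Perm.sign σ : ℤ) • circTerm h (linMap ε) F σ a = _
  rw [unshuffles_self, Finset.sum_singleton, Equiv.Perm.sign_one]
  have e1 : (fun i : Fin n => lam n ((1 : Equiv.Perm (Fin (n + 1))) (headIx h i.castSucc))) =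
      fun i => lv i := funext fun i => lam_castSucc i
  have e2 : ∀ x : Fin 0 → Expr n, subst x ∘ₗ
      firstArg (linMap ε) (fun j => a ((1 : Equiv.Perm (Fin (n + 1))) (tailIx h j))) =
        cst n A ∘ₗ ε := by
    intro x
    ext b
    change subst x (cst 0 A (ε b)) = cst n A (ε b)
    rw [subst, cst, TensorProduct.mk_apply, extend_tmul]
    simp [cst]
  have e3 : (fun i => a ((1 : Equiv.Perm (Fin (n + 1))) (headIx h i))) = a := rfl
  rw [circTerm, e1, e2, e3, ← extend_comp_lTensor]
  change (1 : ℤ) • subst (fun i => lv i) _ = _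
  rw [subst_lv, one_smul]

theorem ins_linMap_right (h : n + 0 = n) (ε : A →ₗ[ℂ] A) (F : CMap n A A) (a : Fin (n + 1) → A) :
    ins h F (linMap ε) a = F (Function.update a 0 (ε (a 0))) := by
  change circTerm h F (linMap ε) 1 a = _
  have e1 : (linMap ε fun i => a ((1 : Equiv.Perm (Fin (n + 1))) (headIx h i))) =
      (1 : Lam 0) ⊗ₜ[ℂ] ε (a 0) := rfl
  have e2 : (fun j : Fin n => Fin.cons (α := fun _ => Expr n)
      (∑ i : Fin 1, lam n ((1 : Equiv.Perm (Fin (n + 1))) (headIx h i)))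
      (fun j => lam n ((1 : Equiv.Perm (Fin (n + 1))) (tailIx h j))) j.castSucc) =
      fun j => lv j := by
    funext j
    rw [← lam_castSucc]
    generalize j.castSucc = i
    refine Fin.cases ?_ (fun i => ?_) i
    · rw [Fin.cons_zero, Fin.sum_univ_one]
      rfl
    · rw [Fin.cons_succ]
      congr 1
      exact Fin.ext (by simp [tailIx, add_comm])
  rw [circTerm, e1, e2, extend_tmul, map_one, map_one]
  change subst (fun j => lv j) _ = _
  rw [subst_lv]
  change F (Fin.cons (ε (a 0)) _) = _
  congr 1
  funext i
  refine Fin.cases ?_ (fun i => ?_) i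
  · rw [Fin.cons_zero, Function.update_self]
  · rw [Fin.cons_succ, Function.update_of_ne (Fin.succ_ne_zero i)]
    congr 1
    exact Fin.ext (by simp [tailIx, add_comm])

theorem sum_perm_apply_zero {R : Type*} [AddCommMonoid R] (φ : Fin (n + 1) → R) :
    ∑ σ : Equiv.Perm (Fin (n + 1)), φ (σ 0) = n.factorial • ∑ i, φ i := by
  rw [← Equiv.Perm.decomposeFin.symm.sum_comp, Fintype.sum_prod_type, Finset.smul_sum]
  simp [Fintype.card_perm]

/-- In the skew-symmetrized insertion the skewness of F undoes each σ, so the summand depends only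
on the argument σ 0 to which ε is applied. -/
theorem circ_linMap_right (h : n + 0 = n) (ε : A →ₗ[ℂ] A) (hε : ∀ b, ε (del A b) = del A (ε b))
    {F : CMap n A A} (hF : F ∈ Cochain n A A) (a : Fin (n + 1) → A) :
    circ h F (linMap ε) a = ∑ i, F (Function.update a i (ε (a i))) := by
  have := congrArg (fun G => G a) (factorial_smul_circ h hF (linMap_mem ε hε))
  rw [alt_apply, _root_.sum_apply] at this
  change (Nat.factorial 1 * n.factorial) • circ h F (linMap ε) a = ∑ σ, (Equiv.Perm.sign σ : ℤ) •
    perm σ (ins h F (linMap ε)) a at this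
  simp only [perm_apply, ins_linMap_right] at this
  refine nsmul_cancel n.factorial_ne_zero ?_
  rw [← sum_perm_apply_zero fun i => F (Function.update a i (ε (a i)))]
  rw [Nat.factorial_one, one_mul] at this
  rw [this]
  refine Finset.sum_congr rfl fun σ _ => ?_
  rw [hF.2 σ (Function.update a (σ 0) (ε (a (σ 0))))]
  congr 3
  exact (Function.update_comp_eq_of_injective' a σ.injective 0 _).symm

end Maps

/-! ### Lifts, restrictions, and bidegrees as eigenvalues -/

section Twilled
variable {A₁ A₂ : Type*}
  [AddCommGroup A₁] [Module ℂ A₁] [Module (Polynomial ℂ) A₁] [IsScalarTower ℂ (Polynomial ℂ) A₁]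
  [AddCommGroup A₂] [Module ℂ A₂] [Module (Polynomial ℂ) A₂] [IsScalarTower ℂ (Polynomial ℂ) A₂]
  {m n p : ℕ}

theorem del_prod (x : A₁ × A₂) : del (A₁ × A₂) x = (del A₁ x.1, del A₂ x.2) := rfl

theorem inl_del (b : A₁) :
    LinearMap.inl ℂ A₁ A₂ (del A₁ b) =
      del (A₁ × A₂) (LinearMap.inl ℂ A₁ A₂ b) := by
  simp [del_prod]

theorem inr_del (b : A₂) :
    LinearMap.inr ℂ A₁ A₂ (del A₂ b) =
      del (A₁ × A₂) (LinearMap.inr ℂ A₁ A₂ b) := by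
  simp [del_prod]

theorem fst_del (b : A₁ × A₂) :
    LinearMap.fst ℂ A₁ A₂ (del (A₁ × A₂) b) =
      del A₁ (LinearMap.fst ℂ A₁ A₂ b) :=
  rfl

theorem snd_del (b : A₁ × A₂) :
    LinearMap.snd ℂ A₁ A₂ (del (A₁ × A₂) b) =
      del A₂ (LinearMap.snd ℂ A₁ A₂ b) :=
  rfl

/-- The lift as a linear map of cochains. -/
def liftC (n : ℕ) : Cochain n A₂ A₁ →ₗ[ℂ] Cochain n (A₁ × A₂) (A₁ × A₂) :=
  mapC n (LinearMap.inl ℂ A₁ A₂) inl_del (LinearMap.snd ℂ A₁ A₂) snd_del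

theorem liftC_val (f : Cochain n A₂ A₁) : (liftC n f).1 = lift f.1 := rfl

/-- The restriction of a cochain to arguments in `A₂`, projected to `A₁`. -/
def resC (n : ℕ) : Cochain n (A₁ × A₂) (A₁ × A₂) →ₗ[ℂ] Cochain n A₂ A₁ :=
  mapC n (LinearMap.fst ℂ A₁ A₂) fst_del (LinearMap.inr ℂ A₁ A₂) inr_del

theorem resC_apply (F : Cochain n (A₁ × A₂) (A₁ × A₂)) (a : Fin (n + 1) → A₂) :
    (resC n F).1 a = (LinearMap.fst ℂ A₁ A₂).lTensor (Lam n) (F.1 fun i => (0, a i)) := rfl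

theorem lift_apply (f : CMap n A₂ A₁) (a : Fin (n + 1) → A₁ × A₂) :
    lift f a = (LinearMap.inl ℂ A₁ A₂).lTensor (Lam n) (f fun i => (a i).2) := rfl

theorem fst_inl_lTensor (v : Val n A₁) : (LinearMap.fst ℂ A₁ A₂).lTensor (Lam n)
    ((LinearMap.inl ℂ A₁ A₂).lTensor (Lam n) v) = v := by
  rw [← LinearMap.lTensor_comp_apply, LinearMap.fst_comp_inl, LinearMap.lTensor_id_apply]

theorem resC_liftC (f : Cochain n A₂ A₁) : resC n (liftC n f) = f :=
  Subtype.ext (MultilinearMap.ext fun _ => fst_inl_lTensor _)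

theorem val_eq_add (v : Val n (A₁ × A₂)) :
    (LinearMap.inl ℂ A₁ A₂).lTensor (Lam n) ((LinearMap.fst ℂ A₁ A₂).lTensor (Lam n) v) +
      (LinearMap.inr ℂ A₁ A₂).lTensor (Lam n) ((LinearMap.snd ℂ A₁ A₂).lTensor (Lam n) v) = v := by
  rw [← LinearMap.lTensor_comp_apply, ← LinearMap.lTensor_comp_apply, ← LinearMap.add_apply,
    ← LinearMap.lTensor_add]
  have : LinearMap.inl ℂ A₁ A₂ ∘ₗ LinearMap.fst ℂ A₁ A₂ +
      LinearMap.inr ℂ A₁ A₂ ∘ₗ LinearMap.snd ℂ A₁ A₂ = LinearMap.id := by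
    ext <;> simp
  rw [this, LinearMap.lTensor_id_apply]

/-- The inserted value has coefficients in A₁, where a lift vanishes. -/
theorem circTerm_lift_lift (h : m + n = p) (f : CMap m A₂ A₁) (g : CMap n A₂ A₁)
    (σ : Equiv.Perm (Fin (p + 1))) (a : Fin (p + 1) → A₁ × A₂) :
    circTerm h (lift f) (lift g) σ a = 0 := by
  rw [circTerm, lift_apply, extend_comp_lTensor]
  have : ∀ (x : Fin m → Expr p) (r : Fin m → A₁ × A₂),
      (subst x ∘ₗ firstArg (lift f) r) ∘ₗ LinearMap.inl ℂ A₁ A₂ = 0 := by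
    intro x r
    ext b
    change subst x ((LinearMap.inl ℂ A₁ A₂).lTensor (Lam m) (f _)) = 0
    rw [f.map_coord_zero 0 (by simp), map_zero, map_zero]
  rw [this, ← zero_smul ℂ (0 : A₁ →ₗ[ℂ] Val p (A₁ × A₂)), extend_smul_right, zero_smul]
  rfl

theorem nrC_lift_lift (h : m + n = p) (f : Cochain m A₂ A₁) (g : Cochain n A₂ A₁) :
    nrC h (liftC m f) (liftC n g) = 0 := by
  have hc : ∀ {m n p : ℕ} (h : m + n = p) (f : CMap m A₂ A₁) (g : CMap n A₂ A₁),
      circ h (lift f) (lift g) = 0 := fun h f g => MultilinearMap.ext fun a =>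
    Finset.sum_eq_zero fun σ _ => by rw [circTerm_lift_lift, smul_zero]
  refine Subtype.ext ?_
  rw [nrC_val, nrL_apply, liftC_val, liftC_val, hc, hc]
  simp

/-- The vanishing of `resC` means that arguments in A₂ give values in A₂. The inserted value is then
again an argument in A₂. -/
theorem fst_circTerm (h : m + n = p) {f : Cochain m (A₁ × A₂) (A₁ × A₂)}
    {g : Cochain n (A₁ × A₂) (A₁ × A₂)} (hf : resC m f = 0) (hg : resC n g = 0)
    (σ : Equiv.Perm (Fin (p + 1))) (a : Fin (p + 1) → A₂) :
    (LinearMap.fst ℂ A₁ A₂).lTensor (Lam p) (circTerm h f.1 g.1 σ fun i => (0, a i)) = 0 := by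
  have hv := val_eq_add (g.1 fun i => ((0 : A₁), a (σ (headIx h i))))
  have hg' := congrArg (fun F => F.1 fun i => a (σ (headIx h i))) hg
  change (LinearMap.fst ℂ A₁ A₂).lTensor (Lam n) (g.1 fun i => (0, a (σ (headIx h i)))) = 0 at hg'
  rw [hg', map_zero, zero_add] at hv
  rw [circTerm, ← hv, extend_comp_lTensor, lTensor_extend _ fst_del]
  have : ∀ x : Fin m → Expr p, (LinearMap.fst ℂ A₁ A₂).lTensor (Lam p) ∘ₗ
      (subst x ∘ₗ firstArg f.1 (fun j => ((0 : A₁), a (σ (tailIx h j))))) ∘ₗ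
        LinearMap.inr ℂ A₁ A₂ = 0 := by
    intro x
    ext b
    have hf' := congrArg (fun F => F.1 (Fin.cons b fun j => a (σ (tailIx h j)))) hf
    change (LinearMap.fst ℂ A₁ A₂).lTensor (Lam m)
      (f.1 fun i => (0, (Fin.cons b fun j => a (σ (tailIx h j)) : Fin (m + 1) → A₂) i)) = 0 at hf'
    change (LinearMap.fst ℂ A₁ A₂).lTensor (Lam p) (subst x (f.1 (Fin.cons (0, b) _))) = 0
    rw [lTensor_subst _ fst_del]
    have e : (Fin.cons ((0 : A₁), b) fun j => ((0 : A₁), a (σ (tailIx h j))) :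
        Fin (m + 1) → A₁ × A₂) =
        fun i => (0, (Fin.cons b fun j => a (σ (tailIx h j)) : Fin (m + 1) → A₂) i) :=
      funext fun i => Fin.cases rfl (fun _ => rfl) i
    rw [e, hf', map_zero]
  rw [this, ← zero_smul ℂ (0 : A₂ →ₗ[ℂ] Val p A₁), extend_smul_right, zero_smul]
  rfl

theorem resC_nrC (h : m + n = p) {f : Cochain m (A₁ × A₂) (A₁ × A₂)}
    {g : Cochain n (A₁ × A₂) (A₁ × A₂)} (hf : resC m f = 0) (hg : resC n g = 0) :
    resC p (nrC h f g) = 0 := by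
  have hc : ∀ {m n p : ℕ} (h : m + n = p) {f : Cochain m (A₁ × A₂) (A₁ × A₂)}
      {g : Cochain n (A₁ × A₂) (A₁ × A₂)}, resC m f = 0 → resC n g = 0 → ∀ a : Fin (p + 1) → A₂,
      (LinearMap.fst ℂ A₁ A₂).lTensor (Lam p) (circ h f.1 g.1 fun i => (0, a i)) = 0 := by
    intro m n p h f g hf hg a
    change (LinearMap.fst ℂ A₁ A₂).lTensor (Lam p) (∑ σ ∈ unshuffles (p + 1) (n + 1),
      (Equiv.Perm.sign σ : ℤ) • circTerm h f.1 g.1 σ fun i => (0, a i)) = 0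
    rw [map_sum]
    exact Finset.sum_eq_zero fun σ _ => by rw [map_zsmul, fst_circTerm h hf hg, smul_zero]
  refine Subtype.ext (MultilinearMap.ext fun a => ?_)
  rw [resC_apply, nrC_val, nrL_apply]
  change (LinearMap.fst ℂ A₁ A₂).lTensor (Lam p) (circ h f.1 g.1 _ -
    (-1 : ℤ) ^ (m * n) • circ _ g.1 f.1 _) = 0
  rw [map_sub, map_zsmul, hc h hf hg, hc _ hg hf, smul_zero, sub_zero]

/-- The `1`-cochain `(a, v) ↦ (a, 0)`. -/
def euler (A₁ A₂ : Type*)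
    [AddCommGroup A₁] [Module ℂ A₁] [Module (Polynomial ℂ) A₁] [IsScalarTower ℂ (Polynomial ℂ) A₁]
    [AddCommGroup A₂] [Module ℂ A₂] [Module (Polynomial ℂ) A₂] [IsScalarTower ℂ (Polynomial ℂ) A₂] :
    Cochain 0 (A₁ × A₂) (A₁ × A₂) :=
  ⟨linMap (LinearMap.inl ℂ A₁ A₂ ∘ₗ LinearMap.fst ℂ A₁ A₂), linMap_mem _ fun b => by
    simp [del_prod]⟩

/-- F ⋄ E applies the projection to one argument at a time and so counts the arguments in A₁; E ⋄ F
projects the value to A₁. -/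
theorem nrC_euler_apply (F : Cochain n (A₁ × A₂) (A₁ × A₂)) {S : Finset (Fin (n + 1))}
    {x : Fin (n + 1) → A₁ × A₂} (h1 : ∀ i ∈ S, (x i).2 = 0) (h2 : ∀ i ∉ S, (x i).1 = 0) :
    (nrC (add_zero n) F (euler A₁ A₂)).1 x = S.card • F.1 x -
      (LinearMap.inl ℂ A₁ A₂ ∘ₗ LinearMap.fst ℂ A₁ A₂).lTensor (Lam n) (F.1 x) := by
  rw [nrC_val, nrL_apply, mul_zero, pow_zero, one_smul]
  change circ _ F.1 (linMap _) x - circ _ (linMap _) F.1 x = _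
  rw [circ_linMap_left, circ_linMap_right _ _ (fun b => by simp [del_prod]) F.2]
  congr 1
  rw [← Finset.sum_const, ← Finset.sum_subset S.subset_univ]
  · refine Finset.sum_congr rfl fun i hi => ?_
    have : (LinearMap.inl ℂ A₁ A₂ ∘ₗ LinearMap.fst ℂ A₁ A₂) (x i) = x i :=
      Prod.ext rfl (h1 i hi).symm
    rw [this, Function.update_eq_self]
  · intro i _ hi
    refine F.1.map_coord_zero i ?_
    rw [Function.update_self]
    exact Prod.ext (h2 i hi) rfl

theorem eq_of_homogeneous {F F' : CMap n (A₁ × A₂) (A₁ × A₂)}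
    (h : ∀ (S : Finset (Fin (n + 1))) (x : Fin (n + 1) → A₁ × A₂), (∀ i ∈ S, (x i).2 = 0) →
      (∀ i ∉ S, (x i).1 = 0) → F x = F' x) : F = F' := by
  ext1 a
  have e : a = (fun i => ((a i).1, (0 : A₂))) + fun i => ((0 : A₁), (a i).2) :=
    funext fun i => by simp
  rw [e, MultilinearMap.map_add_univ, MultilinearMap.map_add_univ]
  refine Finset.sum_congr rfl fun S _ => h S _ (fun i hi => ?_) fun i hi => ?_
  · rw [Finset.piecewise_eq_of_mem _ _ _ hi]
  · rw [Finset.piecewise_eq_of_notMem _ _ _ hi]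

theorem fst_lTensor_inl_fst (v : Val n (A₁ × A₂)) : (LinearMap.fst ℂ A₁ A₂).lTensor (Lam n)
    ((LinearMap.inl ℂ A₁ A₂ ∘ₗ LinearMap.fst ℂ A₁ A₂).lTensor (Lam n) v) =
      (LinearMap.fst ℂ A₁ A₂).lTensor (Lam n) v := by
  rw [LinearMap.lTensor_comp_apply, fst_inl_lTensor]

theorem snd_lTensor_inl_fst (v : Val n (A₁ × A₂)) : (LinearMap.snd ℂ A₁ A₂).lTensor (Lam n)
    ((LinearMap.inl ℂ A₁ A₂ ∘ₗ LinearMap.fst ℂ A₁ A₂).lTensor (Lam n) v) = 0 := by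
  rw [← LinearMap.lTensor_comp_apply, ← LinearMap.comp_assoc, LinearMap.snd_comp_inl,
    LinearMap.zero_comp, LinearMap.lTensor_zero, LinearMap.zero_apply]

/-- A value in A₁ comes with k + 1 arguments in A₁ and loses one for the projection. A value in A₂
comes with k and loses none. Both give the eigenvalue k. -/
theorem HasBidegree.nrC_euler {k l : ℤ} {F : Cochain n (A₁ × A₂) (A₁ × A₂)}
    (hF : HasBidegree k l F.1) : nrC (add_zero n) F (euler A₁ A₂) = k • F := by
  refine Subtype.ext (eq_of_homogeneous fun S x h1 h2 => ?_)
  obtain ⟨ha, hb, hc⟩ := hF.2 S x h1 h2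
  change _ = k • F.1 x
  rw [nrC_euler_apply F h1 h2, ← natCast_zsmul]
  have hv := val_eq_add (F.1 x)
  by_cases hk : (S.card : ℤ) = k + 1
  · rw [ha hk, map_zero, add_zero] at hv
    rw [LinearMap.lTensor_comp_apply, hv, hk, add_smul, one_smul, add_sub_cancel_right]
  · by_cases hk' : (S.card : ℤ) = k
    · rw [LinearMap.lTensor_comp_apply, hb hk', map_zero, sub_zero, hk']
    · simp [hc hk hk']

theorem zsmul_cancel {V : Type*} [AddCommGroup V] [Module ℂ V] {k : ℤ} (hk : k ≠ 0) {x : V}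
    (h : k • x = 0) : x = 0 := by
  rw [← Int.cast_smul_eq_zsmul ℂ] at h
  exact (smul_eq_zero.1 h).resolve_left (Int.cast_ne_zero.2 hk)

/-- If all arguments lie in A₂, then [F, E] is minus the A₁-component of F, so this component is
annihilated by k + 1. -/
theorem resC_eq_zero_of_eigen {k : ℤ} {F : Cochain n (A₁ × A₂) (A₁ × A₂)}
    (hF : nrC (add_zero n) F (euler A₁ A₂) = k • F) (hk : k ≠ -1) : resC n F = 0 := by
  refine Subtype.ext (MultilinearMap.ext fun a => ?_)
  rw [resC_apply]
  have h := nrC_euler_apply F (S := ∅) (x := fun i => ((0 : A₁), a i)) (by simp) (by simp)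
  rw [hF] at h
  change k • F.1 _ = _ at h
  have h' := congrArg ((LinearMap.fst ℂ A₁ A₂).lTensor (Lam n)) h
  rw [map_zsmul, map_sub, map_nsmul, Finset.card_empty, zero_smul, zero_sub,
    fst_lTensor_inl_fst] at h'
  refine zsmul_cancel (k := k + 1) (by omega) ?_
  rw [add_smul, one_smul, h', neg_add_cancel]

/-- For |S| arguments in A₁ the A₂-component of the value is annihilated by |S| + 1, hence is 0; the
value itself is then annihilated by |S|. Only S = ∅ survives, with values in A₁, which is the shape
of a lift. -/
theorem liftC_resC_of_eigen {F : Cochain n (A₁ × A₂) (A₁ × A₂)}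
    (hF : nrC (add_zero n) F (euler A₁ A₂) = (-1 : ℤ) • F) : liftC n (resC n F) = F := by
  have key : ∀ (S : Finset (Fin (n + 1))) (x : Fin (n + 1) → A₁ × A₂), (∀ i ∈ S, (x i).2 = 0) →
      (∀ i ∉ S, (x i).1 = 0) → (LinearMap.inl ℂ A₁ A₂ ∘ₗ LinearMap.fst ℂ A₁ A₂).lTensor (Lam n)
        (F.1 x) = F.1 x ∧ S.card • F.1 x = 0 := by
    intro S x h1 h2
    have h := nrC_euler_apply F h1 h2
    rw [hF] at h
    change (-1 : ℤ) • F.1 x = _ at h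
    have h' := congrArg ((LinearMap.snd ℂ A₁ A₂).lTensor (Lam n)) h
    rw [map_zsmul, map_sub, map_nsmul, snd_lTensor_inl_fst, sub_zero, ← natCast_zsmul] at h'
    have h0 : (LinearMap.snd ℂ A₁ A₂).lTensor (Lam n) (F.1 x) = 0 :=
      zsmul_cancel (k := S.card + 1) (by omega) (by rw [add_smul, ← h', ← add_smul]; simp)
    have hv := val_eq_add (F.1 x)
    rw [h0, map_zero, add_zero, ← LinearMap.lTensor_comp_apply] at hv
    refine ⟨hv, ?_⟩
    rw [hv, neg_one_zsmul, sub_eq_add_neg] at h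
    exact right_eq_add.1 h
  refine Subtype.ext (eq_of_homogeneous fun S x h1 h2 => ?_)
  rw [liftC_val, lift_apply, resC_apply, ← LinearMap.lTensor_comp_apply]
  obtain rfl | hS := S.eq_empty_or_nonempty
  · have e : (fun i => ((0 : A₁), (x i).2)) = x :=
      funext fun i => Prod.ext (h2 i (by simp)).symm rfl
    rw [e]
    exact (key ∅ x h1 h2).1
  · obtain ⟨i, hi⟩ := hS
    rw [F.1.map_coord_zero (m := fun i => ((0 : A₁), (x i).2)) i (by simp [h1 i hi]), map_zero]
    refine (nsmul_cancel (Finset.card_ne_zero_of_mem hi) ?_)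
    rw [smul_zero, (key S x h1 h2).2]

theorem nrC_liftC_euler (f : Cochain n A₂ A₁) :
    nrC (add_zero n) (liftC n f) (euler A₁ A₂) = (-1 : ℤ) • liftC n f := by
  refine Subtype.ext (eq_of_homogeneous fun S x h1 h2 => ?_)
  change _ = (-1 : ℤ) • lift f.1 x
  rw [nrC_euler_apply _ h1 h2, liftC_val, lift_apply, LinearMap.lTensor_comp_apply,
    fst_inl_lTensor]
  obtain rfl | ⟨i, hi⟩ := S.eq_empty_or_nonempty
  · simp
  · rw [f.1.map_coord_zero i (h1 i hi)]
    simp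

end Twilled

/-- As E has degree 0, the Jacobi identity makes [·, E] a derivation without signs, and eigenvalues
add. -/
theorem DerivedData.T_eigen {𝔤 : Type*} [AddCommGroup 𝔤] [Module ℂ 𝔤] (V : DerivedData 𝔤)
    {m n : ℕ} {k l : ℤ} {E a y : 𝔤} (hE : E ∈ V.G 0) (ha : a ∈ V.G m) (hy : y ∈ V.G n)
    (h : V.br y E = k • y) (h' : V.br a E = l • a) :
    V.br (V.T a y) E = (k + l) • V.T a y := by
  rw [V.T_apply hy, map_zsmul, LinearMap.smul_apply, V.jacobi hy ha hE, h, h', mul_zero, pow_zero,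
    one_smul, map_zsmul, map_zsmul, LinearMap.smul_apply, smul_comm, ← add_smul, add_comm l k,
    smul_comm]

/-! ### Direct sums of cochain spaces and the grading -/

section CochainSpace
variable {A M : Type*}
  [AddCommGroup A] [Module ℂ A] [Module (Polynomial ℂ) A] [IsScalarTower ℂ (Polynomial ℂ) A]
  [AddCommGroup M] [Module ℂ M] [Module (Polynomial ℂ) M] [IsScalarTower ℂ (Polynomial ℂ) M]

theorem cochainSpace_induction {motive : CochainSpace A M → Prop} (x : CochainSpace A M)
    (zero : motive 0) (incl : ∀ n f, motive (incl n f))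
    (add : ∀ x y, motive x → motive y → motive (x + y)) : motive x :=
  DirectSum.induction_on x zero incl add

theorem incl_zsmul (n : ℕ) (c : ℤ) (f : Cochain n A M) : incl n (c • f) = c • incl n f :=
  map_zsmul (incl n) c f

theorem cochainSpace_multilinear_ext {k : ℕ}
    {l l' : MultilinearMap ℂ (fun _ : Fin k => CochainSpace A M) (CochainSpace A M)}
    (h : ∀ (d : Fin k → ℕ) (f : ∀ i, Cochain (d i) A M),
      l (fun i => incl (d i) (f i)) = l' (fun i => incl (d i) (f i))) : l = l' :=
  MultilinearMap.dfinsupp_ext fun d => MultilinearMap.ext fun f => h d f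

theorem nrC_skew {m n p : ℕ} (h : m + n = p) (f : Cochain m A A) (g : Cochain n A A) :
    nrC h f g = -((-1 : ℤ) ^ (m * n) • nrC (show n + m = p by omega) g f) :=
  Subtype.ext (nrL_skew h f.1 g.1)

theorem nrC_jacobi {m n k p q s r : ℕ} (h1 : m + n = p) (h2 : p + k = q) (h3 : n + k = s)
    (h4 : m + s = q) (h5 : m + k = r) (h6 : r + n = q) (f : Cochain m A A) (g : Cochain n A A)
    (h : Cochain k A A) : nrC h2 (nrC h1 f g) h = nrC h4 f (nrC h3 g h) +
      (-1 : ℤ) ^ (n * k) • nrC h6 (nrC h5 f h) g :=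
  Subtype.ext (nrL_jacobi h1 h2 h3 h4 h5 h6 f.2 g.2 h.2)

theorem nrBr_jacobi {m n k : ℕ} (f : Cochain m A A) (g : Cochain n A A) (h : Cochain k A A) :
    nrBr (nrBr (nrIncl m f) (nrIncl n g)) (nrIncl k h) =
      nrBr (nrIncl m f) (nrBr (nrIncl n g) (nrIncl k h)) +
      (-1 : ℤ) ^ (n * k) • nrBr (nrBr (nrIncl m f) (nrIncl k h)) (nrIncl n g) := by
  rw [nrBr_incl (p := m + n) rfl f g, nrBr_incl (p := n + k) rfl g h,
    nrBr_incl (p := m + k) rfl f h, nrBr_incl (p := m + n + k) rfl _ h,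
    nrBr_incl (p := m + n + k) (by omega) f, nrBr_incl (p := m + n + k) (by omega) _ g,
    nrC_jacobi (p := m + n) (s := n + k) (r := m + k) (q := m + n + k) rfl rfl rfl (by omega) rfl
      (by omega) f g h, map_add, nrIncl_zsmul]

/-- The summand with index n is the homogeneous part of degree n + 1. The map D places it there, and
is inverse to the canonical map by a check on homogeneous elements. -/
theorem isInternal_cochainDeg : DirectSum.IsInternal (cochainDeg A M) := by
  let D : CochainSpace A M →ₗ[ℂ] DirectSum ℕ fun n => cochainDeg A M n :=
    DirectSum.toModule ℂ ℕ _ fun n =>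
      DirectSum.lof ℂ ℕ (fun n => cochainDeg A M n) (n + 1) ∘ₗ
        (incl n).codRestrict (cochainDeg A M (n + 1)) fun f => ⟨f, rfl⟩
  have hD : ∀ n f, D (incl n f) = DirectSum.lof ℂ ℕ (fun n => cochainDeg A M n) (n + 1)
      ((incl n).codRestrict (cochainDeg A M (n + 1)) (fun f => ⟨f, rfl⟩) f) :=
    fun n f => DirectSum.toModule_lof ..
  have h := DirectSum.Decomposition.ofLinearMap (cochainDeg A M) D
    (LinearMap.ext fun x => by
      induction x using cochainSpace_induction with
      | zero => simp only [map_zero]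
      | incl n f =>
        rw [LinearMap.comp_apply, hD, DirectSum.coeLinearMap_lof]
        rfl
      | add x y hx hy => simp only [map_add, hx, hy])
    (DirectSum.linearMap_ext _ fun n => LinearMap.ext fun x => by
      obtain ⟨x, hx⟩ := x
      rw [LinearMap.comp_apply, LinearMap.comp_apply, DirectSum.coeLinearMap_lof]
      cases n with
      | zero =>
        obtain rfl : x = 0 := hx
        rw [map_zero]
        exact (map_zero (DirectSum.lof ℂ ℕ (fun n => cochainDeg A M n) 0)).symm
      | succ n =>
        obtain ⟨f, rfl⟩ := hx
        exact hD n f)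
  exact DirectSum.Decomposition.isInternal _

end CochainSpace

/-! ### The derived data of a quasi-twilled Lie conformal algebra -/

section Twilled
variable {A₁ A₂ : Type*}
  [AddCommGroup A₁] [Module ℂ A₁] [Module (Polynomial ℂ) A₁] [IsScalarTower ℂ (Polynomial ℂ) A₁]
  [AddCommGroup A₂] [Module ℂ A₂] [Module (Polynomial ℂ) A₂] [IsScalarTower ℂ (Polynomial ℂ) A₂]

/-- The lift on `C^*(A₂, A₁)`. -/
def liftS : CochainSpace A₂ A₁ →ₗ[ℂ] NRAlgebra (A₁ × A₂) :=
  DirectSum.toModule ℂ ℕ _ fun n => nrIncl n ∘ₗ liftC n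

/-- The left inverse of the lift. -/
def resS : NRAlgebra (A₁ × A₂) →ₗ[ℂ] CochainSpace A₂ A₁ :=
  nrDesc fun n => incl n ∘ₗ resC n

theorem liftS_incl {n : ℕ} (f : Cochain n A₂ A₁) : liftS (incl n f) = nrIncl n (liftC n f) :=
  DirectSum.toModule_lof ..

theorem resS_incl {n : ℕ} (F : Cochain n (A₁ × A₂) (A₁ × A₂)) :
    resS (nrIncl n F) = incl n (resC n F) :=
  nrDesc_incl _ F

theorem resS_liftS (u : CochainSpace A₂ A₁) : resS (liftS u) = u := by
  induction u using cochainSpace_induction with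
  | zero => rw [map_zero, map_zero]
  | incl n f => rw [liftS_incl, resS_incl, resC_liftC]
  | add x y hx hy => rw [map_add, map_add, hx, hy]

theorem nrBr_liftS (u v : CochainSpace A₂ A₁) : nrBr (liftS u) (liftS v) = 0 := by
  induction u using cochainSpace_induction with
  | zero => rw [map_zero, map_zero, LinearMap.zero_apply]
  | add u u' h h' => rw [map_add, map_add, LinearMap.add_apply, h, h', add_zero]
  | incl m f =>
    induction v using cochainSpace_induction with
    | zero => rw [map_zero, map_zero]
    | add v v' h h' => rw [map_add, map_add, h, h', add_zero]
    | incl n g => rw [liftS_incl, liftS_incl, nrBr_incl (p := m + n) rfl, nrC_lift_lift, map_zero]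

/-- The projection to the cochains whose restriction to `A₂` has values in `A₂`. -/
def kerS : NRAlgebra (A₁ × A₂) →ₗ[ℂ] NRAlgebra (A₁ × A₂) :=
  LinearMap.id - liftS ∘ₗ resS

theorem kerS_apply (x : NRAlgebra (A₁ × A₂)) : kerS x = x - liftS (resS x) := rfl

theorem kerS_incl {n : ℕ} (F : Cochain n (A₁ × A₂) (A₁ × A₂)) :
    kerS (nrIncl n F) = nrIncl n (F - liftC n (resC n F)) := by
  rw [kerS_apply, resS_incl, liftS_incl, map_sub (nrIncl n)]

theorem resS_nrBr_kerS (x y : NRAlgebra (A₁ × A₂)) :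
    resS (nrBr (kerS x) (kerS y)) = 0 := by
  have hk : ∀ {n : ℕ} (F : Cochain n (A₁ × A₂) (A₁ × A₂)),
      resC n (F - liftC n (resC n F)) = 0 := fun F => by rw [map_sub, resC_liftC, sub_self]
  induction x using nrAlgebra_induction with
  | zero => rw [map_zero, map_zero, LinearMap.zero_apply, map_zero]
  | add u u' h h' => rw [map_add, map_add, LinearMap.add_apply, map_add, h, h', add_zero]
  | incl m f =>
    induction y using nrAlgebra_induction with
    | zero => rw [map_zero, map_zero, map_zero]
    | add v v' h h' => rw [map_add, map_add, map_add, h, h', add_zero]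
    | incl n g =>
      rw [kerS_incl, kerS_incl, nrBr_incl (p := m + n) rfl, resS_incl, resC_nrC _ (hk f) (hk g),
        map_zero]

theorem nrBr_toCochain (L : LieConformalAlgebra (A₁ × A₂)) :
    nrBr (nrIncl 1 L.toCochain) (nrIncl 1 L.toCochain) = 0 := by
  have : nrC (p := 2) rfl L.toCochain L.toCochain = 0 := Subtype.ext (L.nr_self rfl)
  rw [nrBr_incl (p := 2) rfl, this, map_zero]

/-- The data that the Lie conformal algebra `A₁ ⊕ A₂` with subalgebra `A₂` defines. -/
def derivedData (L : LieConformalAlgebra (A₁ × A₂)) (hL : resC 1 L.toCochain = 0) :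
    DerivedData (NRAlgebra (A₁ × A₂)) where
  br := nrBr
  G n := LinearMap.range (nrIncl n)
  K := signOp
  P := liftS ∘ₗ resS
  Δ := nrIncl 1 L.toCochain
  br_mem := by
    rintro m n _ _ ⟨f, rfl⟩ ⟨g, rfl⟩
    exact ⟨_, (nrBr_incl rfl f g).symm⟩
  skew := by
    rintro m n _ _ ⟨f, rfl⟩ ⟨g, rfl⟩
    rw [nrBr_incl rfl, nrBr_incl (add_comm n m), nrC_skew, nrIncl_neg, nrIncl_zsmul]
  jacobi := by
    rintro m n k _ _ _ ⟨f, rfl⟩ ⟨g, rfl⟩ ⟨h, rfl⟩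
    exact nrBr_jacobi f g h
  K_apply := by
    rintro n _ ⟨f, rfl⟩
    exact signOp_incl f
  P_mem := by
    rintro n _ ⟨f, rfl⟩
    exact ⟨liftC n (resC n f), by rw [LinearMap.comp_apply, resS_incl, liftS_incl]⟩
  P_P x := by simp only [LinearMap.comp_apply, resS_liftS]
  br_P_P x y := nrBr_liftS _ _
  P_br x y := by
    have h := resS_nrBr_kerS x y
    rw [kerS_apply, kerS_apply] at h
    exact (congrArg liftS h).trans (map_zero liftS)
  Δ_mem := ⟨_, rfl⟩
  br_Δ := nrBr_toCochain L
  P_Δ := by rw [LinearMap.comp_apply, resS_incl, hL, map_zero, map_zero]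

theorem isShift_derivedData (L : LieConformalAlgebra (A₁ × A₂)) (hL : resC 1 L.toCochain = 0) :
    (derivedData L hL).IsShift (U := CochainSpace A₂ A₁) liftS resS (cochainDeg A₂ A₁) where
  ι_π _ := rfl
  π_ι := resS_liftS
  zero := rfl
  succ n u := by
    constructor
    · rintro ⟨f, rfl⟩
      exact ⟨liftC n f, (liftS_incl f).symm⟩
    · rintro ⟨F, hF⟩
      exact ⟨resC n F, by rw [← resS_incl, hF, resS_liftS]⟩

/-- `y` is a cochain of degree `n` that is of bidegree `k|n-k`. -/
def Eigen (n : ℕ) (k : ℤ) (y : NRAlgebra (A₁ × A₂)) : Prop :=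
  y ∈ LinearMap.range (nrIncl (A := A₁ × A₂) n) ∧
    nrBr y (nrIncl 0 (euler A₁ A₂)) = k • y

theorem eigen_incl_iff {n : ℕ} {k : ℤ} (F : Cochain n (A₁ × A₂) (A₁ × A₂)) :
    Eigen n k (nrIncl n F) ↔ nrC (add_zero n) F (euler A₁ A₂) = k • F := by
  rw [Eigen, nrBr_incl (add_zero n), ← nrIncl_zsmul, (nrIncl_injective n).eq_iff]
  exact and_iff_right ⟨F, rfl⟩

theorem Eigen.resS_eq_zero {n : ℕ} {k : ℤ} {y : NRAlgebra (A₁ × A₂)}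
    (hy : Eigen n k y) (hk : k ≠ -1) : resS y = 0 := by
  obtain ⟨F, rfl⟩ := hy.1
  rw [resS_incl, resC_eq_zero_of_eigen ((eigen_incl_iff F).1 hy) hk, map_zero]

theorem Eigen.T {L : LieConformalAlgebra (A₁ × A₂)} {hL : resC 1 L.toCochain = 0} {m n : ℕ} {k : ℤ}
    {y : NRAlgebra (A₁ × A₂)} (hy : Eigen n k y) (f : Cochain m A₂ A₁) :
    Eigen (n + m) (k - 1) ((derivedData L hL).T (nrIncl m (liftC m f)) y) :=
  ⟨(derivedData L hL).T_mem ⟨_, rfl⟩ hy.1, (derivedData L hL).T_eigen ⟨_, rfl⟩ ⟨_, rfl⟩ hy.1 hy.2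
    ((eigen_incl_iff _).2 (nrC_liftC_euler f)).2⟩

theorem T_incl (L : LieConformalAlgebra (A₁ × A₂)) (hL : resC 1 L.toCochain = 0) {m n : ℕ}
    (F : Cochain n (A₁ × A₂) (A₁ × A₂)) (f : Cochain m (A₁ × A₂) (A₁ × A₂)) :
    (derivedData L hL).T (nrIncl m f) (nrIncl n F) = (-1 : ℤ) ^ n • nrIncl (n + m) (nrC rfl F f) := by
  rw [(derivedData L hL).T_apply ⟨F, rfl⟩]
  exact congrArg _ (nrBr_incl rfl F f)

end Twilled

/-! ### The brackets l₁, l₂, l₃ and their uniqueness -/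

section Twilled
variable {A₁ A₂ : Type*}
  [AddCommGroup A₁] [Module ℂ A₁] [Module (Polynomial ℂ) A₁] [IsScalarTower ℂ (Polynomial ℂ) A₁]
  [AddCommGroup A₂] [Module ℂ A₂] [Module (Polynomial ℂ) A₂] [IsScalarTower ℂ (Polynomial ℂ) A₂]
  {L : LieConformalAlgebra (A₁ × A₂)} {φ₁ μ₁ μ₂ : Cochain 1 (A₁ × A₂) (A₁ × A₂)}

theorem HasBidegree.eigen {n : ℕ} {k l : ℤ} {F : Cochain n (A₁ × A₂) (A₁ × A₂)}
    (hF : HasBidegree k l F.1) : Eigen n k (nrIncl n F) :=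
  (eigen_incl_iff F).2 hF.nrC_euler

/-- The eigenvalues 2, 1, 0 of the three components differ from -1. -/
theorem IsQuasiTwilled.resC_toCochain (h : IsQuasiTwilled L φ₁ μ₁ μ₂) : resC 1 L.toCochain = 0 := by
  rw [h.structure_eq, map_add, map_add,
    resC_eq_zero_of_eigen h.bidegree_φ₁.nrC_euler (by norm_num),
    resC_eq_zero_of_eigen h.bidegree_μ₁.nrC_euler (by norm_num),
    resC_eq_zero_of_eigen h.bidegree_μ₂.nrC_euler (by norm_num), add_zero, add_zero]

/-- The brackets of the theorem. -/
def IsQuasiTwilled.bracket (h : IsQuasiTwilled L φ₁ μ₁ μ₂) (k : ℕ) :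
    MultilinearMap ℂ (fun _ : Fin k => CochainSpace A₂ A₁) (CochainSpace A₂ A₁) :=
  (derivedData L h.resC_toCochain).bracket (U := CochainSpace A₂ A₁) liftS resS k

/-- The operator `T` of the cochain `f`. -/
def IsQuasiTwilled.op (h : IsQuasiTwilled L φ₁ μ₁ μ₂) {m : ℕ} (f : Cochain m A₂ A₁) :
    NRAlgebra (A₁ × A₂) →ₗ[ℂ] NRAlgebra (A₁ × A₂) :=
  (derivedData L h.resC_toCochain).T (nrIncl m (liftC m f))

theorem Eigen.op {n m : ℕ} {k : ℤ} {y : NRAlgebra (A₁ × A₂)} (hy : Eigen n k y)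
    (h : IsQuasiTwilled L φ₁ μ₁ μ₂) (f : Cochain m A₂ A₁) : Eigen (n + m) (k - 1) (h.op f y) :=
  hy.T f

theorem IsQuasiTwilled.op_incl (h : IsQuasiTwilled L φ₁ μ₁ μ₂) {m n : ℕ} (f : Cochain m A₂ A₁)
    (F : Cochain n (A₁ × A₂) (A₁ × A₂)) :
    h.op f (nrIncl n F) = (-1 : ℤ) ^ n • nrIncl (n + m) (nrC rfl F (liftC m f)) :=
  T_incl L h.resC_toCochain F _

/-- The operators of several cochains, applied to `X` one after the other. -/
def IsQuasiTwilled.ops (h : IsQuasiTwilled L φ₁ μ₁ μ₂) (X : NRAlgebra (A₁ × A₂)) :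
    ∀ {k : ℕ} (_ : Fin k → Σ n, Cochain n A₂ A₁), NRAlgebra (A₁ × A₂)
  | 0, _ => X
  | k + 1, f => h.op (f (Fin.last k)).2 (h.ops X fun i => f i.castSucc)

theorem IsQuasiTwilled.ops_add (h : IsQuasiTwilled L φ₁ μ₁ μ₂)
    (X Y : NRAlgebra (A₁ × A₂)) {k : ℕ} (f : Fin k → Σ n, Cochain n A₂ A₁) :
    h.ops (X + Y) f = h.ops X f + h.ops Y f := by
  induction k with
  | zero => rfl
  | succ k ih => rw [ops, ops, ops, ih, map_add]

theorem Eigen.ops (h : IsQuasiTwilled L φ₁ μ₁ μ₂) {n : ℕ} {j : ℤ}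
    {X : NRAlgebra (A₁ × A₂)} (hX : Eigen n j X) {k : ℕ} (f : Fin k → Σ n, Cochain n A₂ A₁) :
    Eigen (n + ∑ i, (f i).1) (j - k) (h.ops X f) := by
  induction k with
  | zero =>
    change Eigen (n + 0) (j - (0 : ℕ)) X
    simpa using hX
  | succ k ih =>
    rw [IsQuasiTwilled.ops, Fin.sum_univ_castSucc, ← add_assoc, Nat.cast_succ, ← sub_sub]
    exact (ih fun i => f i.castSucc).op h _

theorem IsQuasiTwilled.iter_eq_ops (h : IsQuasiTwilled L φ₁ μ₁ μ₂) {k : ℕ}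
    (f : Fin k → Σ n, Cochain n A₂ A₁) :
    (derivedData L h.resC_toCochain).iter k (fun i => liftS (incl (f i).1 (f i).2)) =
      h.ops (nrIncl 1 φ₁ + nrIncl 1 μ₁ + nrIncl 1 μ₂) f := by
  induction k with
  | zero =>
    change nrIncl 1 L.toCochain = _
    rw [h.structure_eq, map_add, map_add]
    rfl
  | succ k ih =>
    rw [DerivedData.iter_succ, ops, ih fun i => f i.castSucc, liftS_incl]
    rfl

theorem IsQuasiTwilled.bracket_incl (h : IsQuasiTwilled L φ₁ μ₁ μ₂) {k : ℕ} (hk : 1 ≤ k)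
    (f : Fin k → Σ n, Cochain n A₂ A₁) :
    h.bracket k (fun i => incl (f i).1 (f i).2) = (-1 : ℤ) ^ k •
      (resS (h.ops (nrIncl 1 φ₁) f) + resS (h.ops (nrIncl 1 μ₁) f) + resS (h.ops (nrIncl 1 μ₂) f)) := by
  rw [bracket, DerivedData.bracket_apply _ _ _ hk, h.iter_eq_ops, ops_add, ops_add, map_add, map_add]

/-- After k lifts the eigenvalue is 2 - k, and only -1 survives the restriction. For μ₁ and μ₂ below
the eigenvalues are 1 - k and -k. -/
theorem IsQuasiTwilled.resS_ops_φ₁ (h : IsQuasiTwilled L φ₁ μ₁ μ₂) {k : ℕ} (hk : k ≠ 3)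
    (f : Fin k → Σ n, Cochain n A₂ A₁) : resS (h.ops (nrIncl 1 φ₁) f) = 0 :=
  (h.bidegree_φ₁.eigen.ops h f).resS_eq_zero (by omega)

theorem IsQuasiTwilled.resS_ops_μ₁ (h : IsQuasiTwilled L φ₁ μ₁ μ₂) {k : ℕ} (hk : k ≠ 2)
    (f : Fin k → Σ n, Cochain n A₂ A₁) : resS (h.ops (nrIncl 1 μ₁) f) = 0 :=
  (h.bidegree_μ₁.eigen.ops h f).resS_eq_zero (by omega)

theorem IsQuasiTwilled.resS_ops_μ₂ (h : IsQuasiTwilled L φ₁ μ₁ μ₂) {k : ℕ} (hk : k ≠ 1)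
    (f : Fin k → Σ n, Cochain n A₂ A₁) : resS (h.ops (nrIncl 1 μ₂) f) = 0 :=
  (h.bidegree_μ₂.eigen.ops h f).resS_eq_zero (by omega)

theorem IsQuasiTwilled.bracket_eq_zero (h : IsQuasiTwilled L φ₁ μ₁ μ₂) (k : ℕ) (hk : 4 ≤ k) :
    h.bracket k = 0 := by
  refine cochainSpace_multilinear_ext fun d f => ?_
  rw [h.bracket_incl (by omega) fun i => ⟨d i, f i⟩, h.resS_ops_φ₁ (by omega),
    h.resS_ops_μ₁ (by omega), h.resS_ops_μ₂ (by omega), add_zero, add_zero, smul_zero]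
  rfl

theorem IsQuasiTwilled.isLInftyAlgebra (h : IsQuasiTwilled L φ₁ μ₁ μ₂) :
    IsLInftyAlgebra (V := CochainSpace A₂ A₁) (cochainDeg A₂ A₁) h.bracket :=
  (isShift_derivedData L h.resC_toCochain).isLInftyAlgebra isInternal_cochainDeg h.bracket_eq_zero

/-- A multiple of an eigenvector with eigenvalue `-1` is the lift of its restriction. -/
theorem exists_lift_eq {n : ℕ} (c : ℤ) (F : Cochain n (A₁ × A₂) (A₁ × A₂))
    (hF : Eigen n (-1) (nrIncl n F)) :
    ∃ g : Cochain n A₂ A₁, lift g.1 = c • F.1 ∧ c • resS (nrIncl n F) = incl n g := by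
  refine ⟨c • resC n F, ?_, by rw [resS_incl, incl_zsmul]⟩
  have := liftC_resC_of_eigen ((eigen_incl_iff F).1 hF)
  rw [← liftC_val, map_zsmul, this]
  rfl

theorem Eigen.nrC {m n : ℕ} {k : ℤ} {F : Cochain n (A₁ × A₂) (A₁ × A₂)}
    (hF : Eigen n k (nrIncl n F)) (h : IsQuasiTwilled L φ₁ μ₁ μ₂) (f : Cochain m A₂ A₁) :
    Eigen (n + m) (k - 1) (nrIncl (n + m) (LieConformal.nrC rfl F (liftC m f))) := by
  have := hF.op h f
  rw [h.op_incl, ← nrIncl_zsmul, eigen_incl_iff, map_zsmul, LinearMap.smul_apply] at this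
  have := congrArg (fun G => (-1 : ℤ) ^ n • G) this
  simp only [smul_smul, mul_left_comm _ (k - 1), neg_one_pow_mul_self, mul_one, one_smul] at this
  exact (eigen_incl_iff _).2 this

theorem IsQuasiTwilled.bracket_one (h : IsQuasiTwilled L φ₁ μ₁ μ₂) {m : ℕ}
    (f₁ : Cochain m A₂ A₁) :
    ∃ g : Cochain (1 + m) A₂ A₁, lift g.1 = nr μ₂.1 (lift f₁.1) ∧
      h.bracket 1 ![incl m f₁] = incl (1 + m) g := by
  obtain ⟨g, hg, hg'⟩ := exists_lift_eq 1 _ (h.bidegree_μ₂.eigen.nrC h f₁)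
  refine ⟨g, by rw [hg, one_smul, nrC_val, nrL_rfl, liftC_val], ?_⟩
  have e : ![incl m f₁] = fun i => incl ((![⟨m, f₁⟩] : Fin 1 → Σ n, Cochain n A₂ A₁) i).1
      ((![⟨m, f₁⟩] : Fin 1 → Σ n, Cochain n A₂ A₁) i).2 := by
    funext i
    fin_cases i
    rfl
  have e' : h.ops (nrIncl 1 μ₂) ![⟨m, f₁⟩] = h.op f₁ (nrIncl 1 μ₂) := rfl
  rw [e, h.bracket_incl le_rfl, h.resS_ops_φ₁ (by omega), h.resS_ops_μ₁ (by omega), e', h.op_incl,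
    zero_add, zero_add, map_zsmul, smul_smul, ← hg']
  norm_num

theorem IsQuasiTwilled.bracket_two (h : IsQuasiTwilled L φ₁ μ₁ μ₂) {m n : ℕ}
    (f₁ : Cochain m A₂ A₁) (f₂ : Cochain n A₂ A₁) :
    ∃ g : Cochain (1 + m + n) A₂ A₁,
      lift g.1 = (-1 : ℤ) ^ m • nr (nr μ₁.1 (lift f₁.1)) (lift f₂.1) ∧
      h.bracket 2 ![incl m f₁, incl n f₂] = incl (1 + m + n) g := by
  obtain ⟨g, hg, hg'⟩ := exists_lift_eq ((-1) ^ m) _ ((h.bidegree_μ₁.eigen.nrC h f₁).nrC h f₂)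
  refine ⟨g, by rw [hg, nrC_val, nrC_val, nrL_rfl, nrL_rfl, liftC_val, liftC_val], ?_⟩
  have e : ![incl m f₁, incl n f₂] = fun i =>
      incl ((![⟨m, f₁⟩, ⟨n, f₂⟩] : Fin 2 → Σ n, Cochain n A₂ A₁) i).1
        ((![⟨m, f₁⟩, ⟨n, f₂⟩] : Fin 2 → Σ n, Cochain n A₂ A₁) i).2 := by
    funext i
    fin_cases i <;> rfl
  have e' : h.ops (nrIncl 1 μ₁) ![⟨m, f₁⟩, ⟨n, f₂⟩] = h.op f₂ (h.op f₁ (nrIncl 1 μ₁)) := rfl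
  rw [e, h.bracket_incl (by omega), h.resS_ops_φ₁ (by omega), h.resS_ops_μ₂ (by omega), e',
    h.op_incl, map_zsmul, h.op_incl, zero_add, add_zero, map_zsmul, map_zsmul, smul_smul,
    smul_smul, ← hg']
  -- The signs are (-1)^2 from the bracket and (-1)^1, (-1)^(1+m) from the two operators; their
  -- product is (-1)^m.
  congr 1
  ring

theorem IsQuasiTwilled.bracket_three (h : IsQuasiTwilled L φ₁ μ₁ μ₂) {m n k : ℕ}
    (f₁ : Cochain m A₂ A₁) (f₂ : Cochain n A₂ A₁) (f₃ : Cochain k A₂ A₁) :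
    ∃ g : Cochain (1 + m + n + k) A₂ A₁,
      lift g.1 = (-1 : ℤ) ^ n • nr (nr (nr φ₁.1 (lift f₁.1)) (lift f₂.1)) (lift f₃.1) ∧
      h.bracket 3 ![incl m f₁, incl n f₂, incl k f₃] = incl (1 + m + n + k) g := by
  obtain ⟨g, hg, hg'⟩ := exists_lift_eq ((-1) ^ n) _
    (((h.bidegree_φ₁.eigen.nrC h f₁).nrC h f₂).nrC h f₃)
  refine ⟨g, by rw [hg, nrC_val, nrC_val, nrC_val, nrL_rfl, nrL_rfl, nrL_rfl, liftC_val, liftC_val,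
    liftC_val], ?_⟩
  have e : ![incl m f₁, incl n f₂, incl k f₃] = fun i =>
      incl ((![⟨m, f₁⟩, ⟨n, f₂⟩, ⟨k, f₃⟩] : Fin 3 → Σ n, Cochain n A₂ A₁) i).1
        ((![⟨m, f₁⟩, ⟨n, f₂⟩, ⟨k, f₃⟩] : Fin 3 → Σ n, Cochain n A₂ A₁) i).2 := by
    funext i
    fin_cases i <;> rfl
  have e' : h.ops (nrIncl 1 φ₁) ![⟨m, f₁⟩, ⟨n, f₂⟩, ⟨k, f₃⟩] =
      h.op f₃ (h.op f₂ (h.op f₁ (nrIncl 1 φ₁))) := rfl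
  rw [e, h.bracket_incl (by omega), h.resS_ops_μ₁ (by omega), h.resS_ops_μ₂ (by omega), e',
    h.op_incl, map_zsmul, map_zsmul, h.op_incl, map_zsmul, map_zsmul, h.op_incl, add_zero, add_zero,
    map_zsmul, map_zsmul, smul_smul, smul_smul, smul_smul, ← hg']
  -- The signs are (-1)^3 from the bracket and (-1)^1, (-1)^(1+m), (-1)^(1+m+n) from the three
  -- operators; their product is (-1)^n.
  congr 1
  have := neg_one_pow_mul_self m
  linear_combination (-1 : ℤ) ^ n * this

theorem lift_injective {n : ℕ} {g g' : Cochain n A₂ A₁} (h : lift g.1 = lift g'.1) : g = g' := by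
  rw [← resC_liftC g, ← resC_liftC g']
  exact congrArg (resC n) (Subtype.ext h)

/-- For uniqueness, a multilinear map on the direct sum is determined on homogeneous cochains. There
the value of lₖ, k ≤ 3, is determined by its lift, since the lift is injective. The case k = 0 is
fixed by the convention l 0 = 0. -/
theorem IsQuasiTwilled.existsUnique (hL : IsQuasiTwilled L φ₁ μ₁ μ₂) :
    ∃! l : ∀ k : ℕ, MultilinearMap ℂ (fun _ : Fin k => CochainSpace A₂ A₁) (CochainSpace A₂ A₁),
      IsLInftyAlgebra (V := CochainSpace A₂ A₁) (cochainDeg A₂ A₁) l ∧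
      (∀ (m : ℕ) (f₁ : Cochain m A₂ A₁),
        ∃ g : Cochain (1 + m) A₂ A₁,
          lift g.1 = nr μ₂.1 (lift f₁.1) ∧
          l 1 ![incl m f₁] = incl (1 + m) g) ∧
      (∀ (m n : ℕ) (f₁ : Cochain m A₂ A₁) (f₂ : Cochain n A₂ A₁),
        ∃ g : Cochain (1 + m + n) A₂ A₁,
          lift g.1 = (-1 : ℤ) ^ m • nr (nr μ₁.1 (lift f₁.1)) (lift f₂.1) ∧
          l 2 ![incl m f₁, incl n f₂] = incl (1 + m + n) g) ∧
      (∀ (m n k : ℕ) (f₁ : Cochain m A₂ A₁) (f₂ : Cochain n A₂ A₁) (f₃ : Cochain k A₂ A₁),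
        ∃ g : Cochain (1 + m + n + k) A₂ A₁,
          lift g.1 =
            (-1 : ℤ) ^ n • nr (nr (nr φ₁.1 (lift f₁.1)) (lift f₂.1)) (lift f₃.1) ∧
          l 3 ![incl m f₁, incl n f₂, incl k f₃] = incl (1 + m + n + k) g) ∧
      (∀ k : ℕ, 4 ≤ k → l k = 0) := by
  refine ⟨hL.bracket, ⟨hL.isLInftyAlgebra, fun m f₁ => hL.bracket_one f₁,
    fun m n f₁ f₂ => hL.bracket_two f₁ f₂, fun m n k f₁ f₂ f₃ => hL.bracket_three f₁ f₂ f₃,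
    hL.bracket_eq_zero⟩, ?_⟩
  rintro l ⟨hl, h1, h2, h3, h4⟩
  funext k
  obtain rfl | rfl | rfl | rfl | hk : k = 0 ∨ k = 1 ∨ k = 2 ∨ k = 3 ∨ 4 ≤ k := by omega
  · rw [hl.zero, hL.isLInftyAlgebra.zero]
  · refine cochainSpace_multilinear_ext fun d f => ?_
    have e : (fun i => incl (d i) (f i)) = ![incl (d 0) (f 0)] := by
      funext i
      fin_cases i
      rfl
    obtain ⟨g, hg, hg'⟩ := h1 _ (f 0)
    obtain ⟨g₀, hg₀, hg₀'⟩ := hL.bracket_one (f 0)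
    rw [e, hg', hg₀', lift_injective (hg.trans hg₀.symm)]
  · refine cochainSpace_multilinear_ext fun d f => ?_
    have e : (fun i => incl (d i) (f i)) = ![incl (d 0) (f 0), incl (d 1) (f 1)] := by
      funext i
      fin_cases i <;> rfl
    obtain ⟨g, hg, hg'⟩ := h2 _ _ (f 0) (f 1)
    obtain ⟨g₀, hg₀, hg₀'⟩ := hL.bracket_two (f 0) (f 1)
    rw [e, hg', hg₀', lift_injective (hg.trans hg₀.symm)]
  · refine cochainSpace_multilinear_ext fun d f => ?_
    have e : (fun i => incl (d i) (f i)) =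
        ![incl (d 0) (f 0), incl (d 1) (f 1), incl (d 2) (f 2)] := by
      funext i
      fin_cases i <;> rfl
    obtain ⟨g, hg, hg'⟩ := h3 _ _ _ (f 0) (f 1) (f 2)
    obtain ⟨g₀, hg₀, hg₀'⟩ := hL.bracket_three (f 0) (f 1) (f 2)
    rw [e, hg', hg₀', lift_injective (hg.trans hg₀.symm)]
  · rw [h4 k hk, hL.bracket_eq_zero k hk]

end Twilled

end LieConformal

end

theorem theorem3p13 {A₁ A₂ : Type*}
    [AddCommGroup A₁] [Module ℂ A₁] [Module (Polynomial ℂ) A₁] [IsScalarTower ℂ (Polynomial ℂ) A₁]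
    [AddCommGroup A₂] [Module ℂ A₂] [Module (Polynomial ℂ) A₂] [IsScalarTower ℂ (Polynomial ℂ) A₂]
    (L : LieConformalAlgebra (A₁ × A₂)) (φ₁ μ₁ μ₂ : Cochain 1 (A₁ × A₂) (A₁ × A₂))
    (hL : IsQuasiTwilled L φ₁ μ₁ μ₂) :
    ∃! l : ∀ k : ℕ, MultilinearMap ℂ (fun _ : Fin k => CochainSpace A₂ A₁) (CochainSpace A₂ A₁),
      IsLInftyAlgebra (V := CochainSpace A₂ A₁) (cochainDeg A₂ A₁) l ∧
      (∀ (m : ℕ) (f₁ : Cochain m A₂ A₁),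
        ∃ g : Cochain (1 + m) A₂ A₁,
          lift g.1 = nr μ₂.1 (lift f₁.1) ∧
          l 1 ![incl m f₁] = incl (1 + m) g) ∧
      (∀ (m n : ℕ) (f₁ : Cochain m A₂ A₁) (f₂ : Cochain n A₂ A₁),
        ∃ g : Cochain (1 + m + n) A₂ A₁,
          lift g.1 = (-1 : ℤ) ^ m • nr (nr μ₁.1 (lift f₁.1)) (lift f₂.1) ∧
          l 2 ![incl m f₁, incl n f₂] = incl (1 + m + n) g) ∧
      (∀ (m n k : ℕ) (f₁ : Cochain m A₂ A₁) (f₂ : Cochain n A₂ A₁) (f₃ : Cochain k A₂ A₁),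
        ∃ g : Cochain (1 + m + n + k) A₂ A₁,
          lift g.1 =
            (-1 : ℤ) ^ n • nr (nr (nr φ₁.1 (lift f₁.1)) (lift f₂.1)) (lift f₃.1) ∧
          l 3 ![incl m f₁, incl n f₂, incl k f₃] = incl (1 + m + n + k) g) ∧
      (∀ k : ℕ, 4 ≤ k → l k = 0) :=
  hL.existsUnique
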